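/- Let $R$ be a commutative ring without zero-divisors such that $2\neq 0$ in $R$, let $G\subset R^\times$ be a subgroup of its group of units, and assume that $R$ has an involutive ring endomorphism $r\mapsto \overline r$ with $\overline{x}=x^{-1}$ for all $x\in G$. For an integer $g\ge 0$, let $F_g$ be the model compact connected oriented surface of genus $g$ with one boundary component, with base point $\star\in\partial F_g$, and let $(\alpha_1,\dots,\alpha_g,\beta_1,\dots,\beta_g)$ be its system of meridians and parallels: viewing $F_g$ as a disk with $2g$ bands attached along one side, whose feet occur along this side in the order $a_1,b_1,a_1,b_1,a_2,b_2,a_2,b_2,\dots,a_g,b_g,a_g,b_g$, the curve $\alpha_i$ (resp. $\beta_i$) is a simple closed curve running once through the band $a_i$ (resp. $b_i$) and otherwise lying in the disk; it is made into a loop based at $\star$ by an arc in the disk. For a path-connected space $X$ with base point $\star$, a subspace $Y\ni\star$ and a homomorphism $\varphi\colon H_1(X)\to G$, let $H_1^\varphi(X,Y)$ be the first homology of $R\otimes_{\mathbb Z[H_1(X)]}C(\widehat X,p^{-1}(Y))$, where $p\colon\widehat X\to X$ is the maximal abelian cover; for a loop $\gamma$ based at $\star$, let $\widehat\gamma$ be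 its lift starting at the preferred lift of $\star$. For a cobordism $M$ from $F_{g_-}$ to $F_{g_+}$ with boundary parametrizations $m_\pm\colon F_{g_\pm}\to M$ and for $\varphi\colon H_1(M)\to G$, set $\varphi_\pm:=\varphi\circ m_\pm$ and $$\mathsf{Mag}(M,\varphi):=\operatorname{cl}\Big(\ker\big((-m_-)\oplus m_+\colon H_1^{\varphi_-}(F_{g_-},\star)\oplus H_1^{\varphi_+}(F_{g_+},\star)\to H_1^{\varphi}(M,\star)\big)\Big),$$ where $\operatorname{cl}(A):=\{x : rx\in A \text{ for some } r\in R\setminus\{0\}\}$, and where the base points of the bottom and of the top are identified along the vertical segment of $\partial M$ that joins them. Let the lower handlebody $C_0^g$ be the cobordism from $F_0$ to $F_g$ obtained from $F_g\times[-1,1]$ by attaching $g$ $2$-handles along $\alpha_1\times\{-1\},\dots,\alpha_g\times\{-1\}$, and let the upper handlebody $C_g^0$ be the cobordism from $F_g$ to $F_0$ obtained from $F_g\times[-1,1]$ by attaching $g$ $2$-handles along $\beta_1\times\{1\},\dots,\beta_g\times\{1\}$. Note that $H_1^{\varphi}(F_0,\star)=0$ since $F_0$ is a disk. Then, for any homomorphism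 $\varphi\colon H_1(C_0^g)\to G$ inducing $\varphi_+\colon H_1(F_g)\to G$ on the top boundary, the submodule $\mathsf{Mag}(C_0^g,\varphi)$ of $H_1^{\varphi_+}(F_g,\star)$ is freely generated by $a_i^{\varphi_+}:=[1\otimes\widehat\alpha_i]$, $i=1,\dots,g$. Similarly, for any homomorphism $\varphi\colon H_1(C_g^0)\to G$ inducing $\varphi_-\colon H_1(F_g)\to G$ on the bottom boundary, the submodule $\mathsf{Mag}(C_g^0,\varphi)$ of $H_1^{\varphi_-}(F_g,\star)$ is freely generated by $b_i^{\varphi_-}:=[1\otimes\widehat\beta_i]$, $i=1,\dots,g$. -/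

import Mathlib

noncomputable section

namespace Magnus

open Set

/-! ## Homology with twisted coefficients -/

section Twisted

variable {X : Type*} [TopologicalSpace X]

/-- The standard topological `n`-simplex. -/
abbrev Simplex (n : ℕ) : Type := stdSimplex ℝ (Fin (n + 1))

/-- The `i`-th face inclusion `Δⁿ → Δⁿ⁺¹`, which omits the `i`-th vertex. -/
def coface (n : ℕ) (i : Fin (n + 2)) : C(Simplex n, Simplex (n + 1)) :=
  ⟨stdSimplex.map i.succAbove, stdSimplex.continuous_map _⟩

/-- The straight segment of `Δⁿ` from the vertex `i` to the vertex `j`. -/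
def vertexPath {n : ℕ} (i j : Fin (n + 1)) :
    Path (stdSimplex.vertex (S := ℝ) i) (stdSimplex.vertex (S := ℝ) j) where
  toFun t := stdSimplex.map ![i, j] (stdSimplexHomeomorphUnitInterval.symm t)
  continuous_toFun := (stdSimplex.continuous_map _).comp
    stdSimplexHomeomorphUnitInterval.symm.continuous
  source' := by
    have h : stdSimplexHomeomorphUnitInterval.symm 0 = stdSimplex.vertex (S := ℝ) (0 : Fin 2) := by
      rw [Homeomorph.symm_apply_eq]; exact stdSimplexHomeomorphUnitInterval_zero.symm
    rw [h, stdSimplex.map_vertex]; rfl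
  target' := by
    have h : stdSimplexHomeomorphUnitInterval.symm 1 = stdSimplex.vertex (S := ℝ) (1 : Fin 2) := by
      rw [Homeomorph.symm_apply_eq]; exact stdSimplexHomeomorphUnitInterval_one.symm
    rw [h, stdSimplex.map_vertex]; rfl

/-- The first integral homology group of a path-connected space `X` (written multiplicatively),
as the abelianized fundamental group. -/
abbrev H1 (X : Type*) [TopologicalSpace X] (x₀ : X) : Type _ :=
  Abelianization (FundamentalGroup X x₀)

/-- A singular `n`-simplex `σ` of `X` together with the homotopy class of a path in `X` from `x₀` to
the leading vertex of `σ`. By unique lifting, this is a singular `n`-simplex of the universal cover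
of `X` based at `x₀`; the preferred lift of `x₀` is the class of the constant path. -/
structure LiftedSimplex (x₀ : X) (n : ℕ) where
  simplex : C(Simplex n, X)
  start : Path.Homotopic.Quotient x₀ (simplex (stdSimplex.vertex 0))

variable {x₀ : X}

theorem trans_assoc' {a b c d : X} (p : Path.Homotopic.Quotient a b)
    (q : Path.Homotopic.Quotient b c) (r : Path.Homotopic.Quotient c d) :
    (p.trans q).trans r = p.trans (q.trans r) :=
  CategoryTheory.Category.assoc (obj := FundamentalGroupoid X)
    (W := ⟨a⟩) (X := ⟨b⟩) (Y := ⟨c⟩) (Z := ⟨d⟩) p q r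

theorem symm_trans_cancel {a b c : X} (p : Path.Homotopic.Quotient a b)
    (q : Path.Homotopic.Quotient b c) : p.symm.trans (p.trans q) = q := by
  let f : FundamentalGroupoid.mk a ⟶ FundamentalGroupoid.mk b := p
  let h : FundamentalGroupoid.mk b ⟶ FundamentalGroupoid.mk c := q
  change CategoryTheory.CategoryStruct.comp (CategoryTheory.Groupoid.inv f)
    (CategoryTheory.CategoryStruct.comp f h) = h
  simp

theorem map_trans' {Y : Type*} [TopologicalSpace Y] {a b c : X} (p : Path.Homotopic.Quotient a b)
    (q : Path.Homotopic.Quotient b c) (f : C(X, Y)) :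
    (p.trans q).map f = (p.map f).trans (q.map f) :=
  (FundamentalGroupoid.map f).map_comp (X := ⟨a⟩) (Y := ⟨b⟩) (Z := ⟨c⟩) p q

/-- The `i`-th face: the leading vertex is moved along the segment of the simplex that joins
the old leading vertex to the new one. -/
def LiftedSimplex.face {n : ℕ} (s : LiftedSimplex x₀ (n + 1)) (i : Fin (n + 2)) :
    LiftedSimplex x₀ n where
  simplex := s.simplex.comp (coface n i)
  start := (s.start.trans
      (.mk ((vertexPath 0 (i.succAbove 0)).map s.simplex.continuous))).cast rfl
    (congrArg s.simplex (stdSimplex.map_vertex i.succAbove 0))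

/-- The action of `π₁(X, x₀)` on simplices of the universal cover by deck transformations. -/
def LiftedSimplex.translate {n : ℕ} (l : FundamentalGroup X x₀) (s : LiftedSimplex x₀ n) :
    LiftedSimplex x₀ n where
  simplex := s.simplex
  start := (FundamentalGroup.toPath l).trans s.start

theorem LiftedSimplex.face_translate {n : ℕ} (l : FundamentalGroup X x₀)
    (s : LiftedSimplex x₀ (n + 1)) (i : Fin (n + 2)) :
    (s.translate l).face i = (s.face i).translate l := by
  obtain ⟨σ, γ⟩ := s
  have key : ∀ {a b c : X} (p : Path.Homotopic.Quotient x₀ x₀) (q : Path.Homotopic.Quotient x₀ a)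
      (r : Path.Homotopic.Quotient a b) (h : c = b),
      ((p.trans q).trans r).cast rfl h = p.trans ((q.trans r).cast rfl h) := by
    intro a b c p q r h
    subst h
    simp only [Path.Homotopic.Quotient.cast_rfl_rfl]
    exact trans_assoc' p q r
  simp only [face, translate]
  congr 1
  exact key _ _ _ _

variable {R : Type*} [CommRing R] {G : Subgroup Rˣ}

/-- The relations of `R ⊗_{ℤ[H₁(X)]} C_n(X̂, p⁻¹(A))` between the lifted `n`-simplices:
`1 ⊗ l s = φ(l) ⊗ s` for all `l`, and `1 ⊗ s = 0` if `s` lies over `A`. Since `φ` is trivial on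
commutators, the first relations identify lifts to the universal cover that have the same image in
the maximal abelian cover `X̂`. -/
def relations (A : Set X) (φ : H1 X x₀ →* G) (n : ℕ) : Submodule R (LiftedSimplex x₀ n →₀ R) :=
  Submodule.span R
    ({v | ∃ (l : FundamentalGroup X x₀) (s : LiftedSimplex x₀ n),
        v = Finsupp.single (s.translate l) 1 -
          Finsupp.single s (((φ (Abelianization.of l) : G) : Rˣ) : R)} ∪
      {v | ∃ s : LiftedSimplex x₀ n, range s.simplex ⊆ A ∧ v = Finsupp.single s 1})

/-- The twisted chain module `C_n^φ(X, A) = R ⊗_{ℤ[H₁(X)]} C_n(X̂, p⁻¹(A))` for `φ : H₁(X) → G ⊆ Rˣ`,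
where `p : X̂ → X` is the maximal abelian cover. -/
abbrev Chain (A : Set X) (φ : H1 X x₀ →* G) (n : ℕ) : Type _ :=
  (LiftedSimplex x₀ n →₀ R) ⧸ relations A φ n

/-- The alternating sum of the faces, on the free module on the lifted simplices. -/
def freeBoundary (R : Type*) [CommRing R] (x₀ : X) (n : ℕ) :
    (LiftedSimplex x₀ (n + 1) →₀ R) →ₗ[R] (LiftedSimplex x₀ n →₀ R) :=
  Finsupp.linearCombination R fun s =>
    ∑ i : Fin (n + 2), (-1 : R) ^ (i : ℕ) • Finsupp.single (s.face i) (1 : R)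

theorem relations_le_comap_freeBoundary (A : Set X) (φ : H1 X x₀ →* G) (n : ℕ) :
    relations A φ (n + 1) ≤ (relations A φ n).comap (freeBoundary R x₀ n) := by
  refine Submodule.span_le.2 ?_
  rintro v (⟨l, s, rfl⟩ | ⟨s, hs, rfl⟩)
  · simp only [freeBoundary, SetLike.mem_coe, Submodule.mem_comap, map_sub,
      Finsupp.linearCombination_single, one_smul, Finset.smul_sum, ← Finset.sum_sub_distrib]
    refine Submodule.sum_mem _ fun i _ => ?_
    rw [smul_comm, ← smul_sub]
    refine Submodule.smul_mem _ _ (Submodule.subset_span (Or.inl ⟨l, s.face i, ?_⟩))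
    rw [LiftedSimplex.face_translate, Finsupp.smul_single, smul_eq_mul, mul_one]
  · simp only [freeBoundary, SetLike.mem_coe, Submodule.mem_comap,
      Finsupp.linearCombination_single, one_smul]
    refine Submodule.sum_mem _ fun i _ => Submodule.smul_mem _ _
      (Submodule.subset_span (Or.inr ⟨s.face i, ?_, rfl⟩))
    rintro _ ⟨t, rfl⟩
    exact hs ⟨coface n i t, rfl⟩

/-- The boundary operator of the twisted chain complex. -/
def boundary (A : Set X) (φ : H1 X x₀ →* G) (n : ℕ) : Chain A φ (n + 1) →ₗ[R] Chain A φ n :=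
  Submodule.mapQ _ _ (freeBoundary R x₀ n) (relations_le_comap_freeBoundary A φ n)

/-- The twisted homology module `H₁^φ(X, A)`. -/
abbrev TwistedH1 (A : Set X) (φ : H1 X x₀ →* G) : Type _ :=
  LinearMap.ker (boundary A φ 0) ⧸
    (LinearMap.range (boundary A φ 1)).submoduleOf (LinearMap.ker (boundary A φ 0))

/-- A path, as a singular `1`-simplex. -/
def pathSimplex {x y : X} (p : Path x y) : C(Simplex 1, X) :=
  p.toContinuousMap.comp
    ⟨stdSimplexHomeomorphUnitInterval, stdSimplexHomeomorphUnitInterval.continuous⟩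

theorem pathSimplex_vertex_zero {x y : X} (p : Path x y) :
    pathSimplex p (stdSimplex.vertex 0) = x :=
  p.source

theorem pathSimplex_vertex_one {x y : X} (p : Path x y) :
    pathSimplex p (stdSimplex.vertex 1) = y :=
  p.target

/-- The lift of a loop to the cover that starts at the preferred lift of the base point. -/
def liftLoop (p : Path x₀ x₀) : LiftedSimplex x₀ 1 where
  simplex := pathSimplex p
  start := (Path.Homotopic.Quotient.refl x₀).cast rfl (pathSimplex_vertex_zero p)

theorem liftLoop_mem_ker (A : Set X) (φ : H1 X x₀ →* G) (hA : x₀ ∈ A) (p : Path x₀ x₀) :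
    (Submodule.Quotient.mk (Finsupp.single (liftLoop p) 1) : Chain A φ 1) ∈
      LinearMap.ker (boundary A φ 0) := by
  rw [LinearMap.mem_ker]
  refine (Submodule.Quotient.mk_eq_zero _).2 ?_
  simp only [freeBoundary, Finsupp.linearCombination_single, one_smul]
  refine Submodule.sum_mem _ fun i _ => Submodule.smul_mem _ _
    (Submodule.subset_span (Or.inr ⟨_, ?_, rfl⟩))
  rintro _ ⟨t, rfl⟩
  obtain rfl : t = stdSimplex.vertex 0 := Subsingleton.elim _ _
  have h : ((liftLoop p).face i).simplex (stdSimplex.vertex 0) =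
      pathSimplex p (stdSimplex.vertex (i.succAbove 0)) :=
    congrArg (pathSimplex p) (stdSimplex.map_vertex i.succAbove 0)
  rw [h]
  fin_cases i
  · exact (pathSimplex_vertex_one p).symm ▸ hA
  · exact (pathSimplex_vertex_zero p).symm ▸ hA

/-- The class `[1 ⊗ p̂]` in `H₁^φ(X, x₀)` of a loop `p` based at `x₀`, where `p̂` is the lift of `p`
that starts at the preferred lift of `x₀`. -/
def loopClass (φ : H1 X x₀ →* G) (p : Path x₀ x₀) : TwistedH1 {x₀} φ :=
  Submodule.Quotient.mk ⟨_, liftLoop_mem_ker {x₀} φ rfl p⟩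

variable {Y : Type*} [TopologicalSpace Y] {y₀ : Y}

/-- The homomorphism `H₁(X) → H₁(Y)` induced by a map `f`, where the base points are related by a
path from `y₀` to `f x₀`. -/
def H1.map (f : C(X, Y)) (w : Path y₀ (f x₀)) : H1 X x₀ →* H1 Y y₀ :=
  Abelianization.map
    ((FundamentalGroup.fundamentalGroupMulEquivOfPath w).symm.toMonoidHom.comp
      (FundamentalGroup.map f x₀))

/-- The map induced by `f` on lifted simplices, where the base points are related by a path from
`y₀` to `f x₀`. -/
def LiftedSimplex.map {n : ℕ} (f : C(X, Y)) (w : Path y₀ (f x₀)) (s : LiftedSimplex x₀ n) :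
    LiftedSimplex y₀ n where
  simplex := f.comp s.simplex
  start := (Path.Homotopic.Quotient.mk w).trans (s.start.map f)

theorem LiftedSimplex.map_translate {n : ℕ} (f : C(X, Y)) (w : Path y₀ (f x₀))
    (l : FundamentalGroup X x₀) (s : LiftedSimplex x₀ n) :
    (s.translate l).map f w = (s.map f w).translate
      ((FundamentalGroup.fundamentalGroupMulEquivOfPath w).symm (FundamentalGroup.map f x₀ l)) := by
  obtain ⟨σ, γ⟩ := s
  simp only [map, translate]
  congr 1
  change _ = ((Path.Homotopic.Quotient.mk w).trans
    (((FundamentalGroup.toPath l).map f).trans (Path.Homotopic.Quotient.mk w).symm)).trans _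
  rw [trans_assoc', trans_assoc', symm_trans_cancel, map_trans']

theorem LiftedSimplex.map_face {n : ℕ} (f : C(X, Y)) (w : Path y₀ (f x₀))
    (s : LiftedSimplex x₀ (n + 1)) (i : Fin (n + 2)) :
    (s.map f w).face i = (s.face i).map f w := by
  obtain ⟨σ, γ⟩ := s
  have key : ∀ {a b c : X} (q : Path.Homotopic.Quotient x₀ a)
      (r : Path.Homotopic.Quotient a b) (h : c = b) (h' : f c = f b),
      (((Path.Homotopic.Quotient.mk w).trans (q.map f)).trans (r.map f)).cast rfl h' =
        (Path.Homotopic.Quotient.mk w).trans (((q.trans r).cast rfl h).map f) := by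
    intro a b c q r h h'
    subst h
    simp only [Path.Homotopic.Quotient.cast_rfl_rfl]
    rw [trans_assoc', map_trans']
  simp only [map, face]
  congr 1
  exact key γ (.mk ((vertexPath 0 (i.succAbove 0)).map σ.continuous))
    (congrArg σ (stdSimplex.map_vertex i.succAbove 0)) _

/-- The map induced on the free modules on the lifted simplices. -/
def freeMap (R : Type*) [CommRing R] (f : C(X, Y)) (w : Path y₀ (f x₀)) (n : ℕ) :
    (LiftedSimplex x₀ n →₀ R) →ₗ[R] (LiftedSimplex y₀ n →₀ R) :=
  Finsupp.lmapDomain R R (LiftedSimplex.map f w)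

theorem relations_le_comap_freeMap {A : Set X} {B : Set Y} (φ : H1 Y y₀ →* G) (f : C(X, Y))
    (w : Path y₀ (f x₀)) (hf : MapsTo f A B) (n : ℕ) :
    relations A (φ.comp (H1.map f w)) n ≤ (relations B φ n).comap (freeMap R f w n) := by
  refine Submodule.span_le.2 ?_
  rintro v (⟨l, s, rfl⟩ | ⟨s, hs, rfl⟩)
  · simp only [freeMap, SetLike.mem_coe, Submodule.mem_comap, map_sub,
      Finsupp.lmapDomain_apply, Finsupp.mapDomain_single]
    refine Submodule.subset_span (Or.inl ⟨(FundamentalGroup.fundamentalGroupMulEquivOfPath w).symm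
      (FundamentalGroup.map f x₀ l), s.map f w, ?_⟩)
    rw [LiftedSimplex.map_translate]
    rfl
  · simp only [freeMap, SetLike.mem_coe, Submodule.mem_comap,
      Finsupp.lmapDomain_apply, Finsupp.mapDomain_single]
    refine Submodule.subset_span (Or.inr ⟨s.map f w, ?_, rfl⟩)
    rintro _ ⟨t, rfl⟩
    exact hf (hs ⟨t, rfl⟩)

theorem freeBoundary_freeMap (f : C(X, Y)) (w : Path y₀ (f x₀)) (n : ℕ)
    (v : LiftedSimplex x₀ (n + 1) →₀ R) :
    freeBoundary R y₀ n (freeMap R f w (n + 1) v) = freeMap R f w n (freeBoundary R x₀ n v) := by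
  induction v using Finsupp.induction_linear with
  | zero => simp
  | add a b ha hb => simp only [map_add, ha, hb]
  | single s r =>
    simp [freeMap, freeBoundary, Finsupp.mapDomain_single, LiftedSimplex.map_face, map_sum]

/-- The chain map induced by `f : (X, A) → (Y, B)`, where the coefficients of `X` are pulled back
from those of `Y`. -/
def chainMap {A : Set X} {B : Set Y} (φ : H1 Y y₀ →* G) (f : C(X, Y))
    (w : Path y₀ (f x₀)) (hf : MapsTo f A B) (n : ℕ) :
    Chain A (φ.comp (H1.map f w)) n →ₗ[R] Chain B φ n :=
  Submodule.mapQ _ _ (freeMap R f w n) (relations_le_comap_freeMap φ f w hf n)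

theorem boundary_chainMap {A : Set X} {B : Set Y} (φ : H1 Y y₀ →* G) (f : C(X, Y))
    (w : Path y₀ (f x₀)) (hf : MapsTo f A B) (n : ℕ)
    (c : Chain A (φ.comp (H1.map f w)) (n + 1)) :
    boundary B φ n (chainMap φ f w hf (n + 1) c) = chainMap φ f w hf n (boundary A _ n c) := by
  induction c using Submodule.Quotient.induction_on with
  | H v => exact congrArg Submodule.Quotient.mk (freeBoundary_freeMap f w n v)

/-- The linear map `H₁^{φ f}(X, A) → H₁^φ(Y, B)` induced by `f : (X, A) → (Y, B)`. -/
def TwistedH1.map {A : Set X} {B : Set Y} (φ : H1 Y y₀ →* G) (f : C(X, Y))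
    (w : Path y₀ (f x₀)) (hf : MapsTo f A B) :
    TwistedH1 A (φ.comp (H1.map f w)) →ₗ[R] TwistedH1 B φ :=
  Submodule.mapQ _ _
    ((chainMap φ f w hf 1).restrict fun c hc => by
      rw [LinearMap.mem_ker] at hc ⊢
      rw [boundary_chainMap, hc, map_zero])
    (by
      rintro ⟨c, hc⟩ ⟨d, rfl⟩
      exact ⟨chainMap φ f w hf 2 d, boundary_chainMap φ f w hf 1 d⟩)

end Twisted

/-! ## The model surfaces, with their meridians and parallels -/

/-- The rectangle `[0, 16 (g + 1)] × [-10, 0]` in the plane `ℂ = ℂ × {0}`. -/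
def InBase (g : ℕ) (p : ℂ × ℝ) : Prop :=
  0 ≤ p.1.re ∧ p.1.re ≤ 16 * (g + 1) ∧ -10 ≤ p.1.im ∧ p.1.im ≤ 0 ∧ p.2 = 0

/-- The centre of the `i`-th band of the first kind. -/
def centerA (i : ℕ) : ℝ := 16 * i + 8

/-- The centre of the `i`-th band of the second kind. -/
def centerB (i : ℕ) : ℝ := 16 * i + 11

/-- The linear map `x + i y ↦ x + 2 i y`. -/
def stretch (z : ℂ) : ℂ := ⟨z.re, 2 * z.im⟩

/-- The inverse of `stretch`. -/
def squash (z : ℂ) : ℂ := ⟨z.re, z.im / 2⟩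

/-- A half-annulus in the half-plane `y ≥ 0`, `h = 0`, which meets the rectangle along
`[c - 4, c - 2] ∪ [c + 2, c + 4]` where `c = 16 i + 8`. -/
def InBandA (i : ℕ) (p : ℂ × ℝ) : Prop :=
  0 ≤ p.1.im ∧ p.2 = 0 ∧ 2 ≤ ‖p.1 - centerA i‖ ∧ ‖p.1 - centerA i‖ ≤ 4

/-- A half-annulus (stretched in the `y`-direction) in the half-plane `y ≥ 0`, `h = y`, which meets
the rectangle along `[c - 1, c + 1] ∪ [c + 5, c + 7]` where `c = 16 i + 8`. -/
def InBandB (i : ℕ) (p : ℂ × ℝ) : Prop :=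
  0 ≤ p.1.im ∧ p.2 = p.1.im ∧ 2 ≤ ‖squash (p.1 - centerB i)‖ ∧ ‖squash (p.1 - centerB i)‖ ≤ 4

/-- The model surface `F_g`, compact, connected, orientable, of genus `g`, with one boundary
component: a disk (a rectangle) in `ℝ³` with `2 g` bands attached to its upper side. The feet of the
bands are met in the order `a₀, b₀, a₀, b₀, a₁, b₁, a₁, b₁, …` along this side, so that `F_g` is the
iterated boundary-connected sum of `g` copies of a torus with one hole. -/
def Surface (g : ℕ) : Type :=
  {p : ℂ × ℝ // InBase g p ∨ ∃ i : Fin g, InBandA i p ∨ InBandB i p}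

instance (g : ℕ) : TopologicalSpace (Surface g) :=
  instTopologicalSpaceSubtype

/-- The base point `⋆ ∈ ∂F_g`: the lower left corner of the rectangle. -/
def star (g : ℕ) : Surface g :=
  ⟨(⟨0, -10⟩, 0), Or.inl ⟨le_rfl, by positivity, le_rfl, by norm_num, rfl⟩⟩

/-- The interval `[-1, 1]`. -/
abbrev J : Type := Icc (-1 : ℝ) 1

/-- The point `-1` of `[-1, 1]`. -/
def jBot : J := ⟨-1, by norm_num⟩

/-- The point `0` of `[-1, 1]`. -/
def jMid : J := ⟨0, by norm_num⟩

/-- The point `1` of `[-1, 1]`. -/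
def jTop : J := ⟨1, by norm_num⟩

theorem norm_annulus (u : Circle) (t : J) : ‖((3 + (t : ℝ) / 2 : ℝ) : ℂ) * u‖ = 3 + (t : ℝ) / 2 := by
  have h := t.2.1
  rw [norm_mul, Circle.norm_coe, mul_one, Complex.norm_real, Real.norm_of_nonneg (by linarith)]

/-- An annulus in `F_g` with core the `i`-th meridian: the circle of centre `c` and radius `3` that
runs through the `i`-th band of the first kind and is closed up in the rectangle. -/
def annulusA (g : ℕ) (i : Fin g) : C(Circle × J, Surface g) where
  toFun x := ⟨(centerA i + ((3 + (x.2 : ℝ) / 2 : ℝ) : ℂ) * x.1, 0), by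
    have hi : ((i : ℕ) : ℝ) + 1 ≤ g := by exact_mod_cast i.2
    have hi0 : (0 : ℝ) ≤ (i : ℕ) := Nat.cast_nonneg _
    have ht := x.2.2
    have hn := norm_annulus x.1 x.2
    generalize ((3 + (x.2 : ℝ) / 2 : ℝ) : ℂ) * (x.1 : ℂ) = v at hn ⊢
    have hre := abs_le.1 (Complex.abs_re_le_norm v)
    have him := abs_le.1 (Complex.abs_im_le_norm v)
    rcases le_total v.im 0 with h | h
    · left
      simp only [InBase, centerA, Complex.add_re, Complex.add_im, Complex.ofReal_re,
        Complex.ofReal_im]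
      refine ⟨?_, ?_, ?_, ?_, trivial⟩ <;> linarith [ht.1, ht.2]
    · right
      refine ⟨i, Or.inl ⟨?_, rfl, ?_, ?_⟩⟩
      · simpa using h
      all_goals rw [add_sub_cancel_left, hn]; linarith [ht.1, ht.2]⟩
  continuous_toFun := by
    refine Continuous.subtype_mk ?_ _
    fun_prop

/-- An annulus in `F_g` with core the `i`-th parallel: the ellipse that runs through the `i`-th band
of the second kind and is closed up in the rectangle. -/
def annulusB (g : ℕ) (i : Fin g) : C(Circle × J, Surface g) where
  toFun x := ⟨(centerB i + stretch (((3 + (x.2 : ℝ) / 2 : ℝ) : ℂ) * x.1),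
      max 0 (stretch (((3 + (x.2 : ℝ) / 2 : ℝ) : ℂ) * x.1)).im), by
    have hi : ((i : ℕ) : ℝ) + 1 ≤ g := by exact_mod_cast i.2
    have hi0 : (0 : ℝ) ≤ (i : ℕ) := Nat.cast_nonneg _
    have ht := x.2.2
    have hn := norm_annulus x.1 x.2
    generalize ((3 + (x.2 : ℝ) / 2 : ℝ) : ℂ) * (x.1 : ℂ) = v at hn ⊢
    have hre := abs_le.1 (Complex.abs_re_le_norm v)
    have him := abs_le.1 (Complex.abs_im_le_norm v)
    rcases le_total v.im 0 with h | h
    · left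
      simp only [InBase, centerB, stretch, Complex.add_re, Complex.add_im, Complex.ofReal_re,
        Complex.ofReal_im]
      refine ⟨?_, ?_, ?_, ?_, max_eq_left ?_⟩ <;> linarith [ht.1, ht.2]
    · right
      have hs : squash (stretch v) = v := by simp [squash, stretch]
      refine ⟨i, Or.inr ⟨?_, ?_, ?_, ?_⟩⟩
      · simpa [stretch] using h
      · simpa [stretch] using h
      all_goals rw [add_sub_cancel_left, hs, hn]; linarith [ht.1, ht.2]⟩
  continuous_toFun := by
    have hs : Continuous stretch := by
      have : stretch = fun z : ℂ => (z.re : ℂ) + ((2 * z.im : ℝ) : ℂ) * Complex.I := by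
        funext z; exact (Complex.mk_eq_add_mul_I _ _)
      rw [this]; fun_prop
    refine Continuous.subtype_mk ?_ _
    fun_prop

theorem convex_inBase (g : ℕ) : Convex ℝ {p : ℂ × ℝ | InBase g p} := by
  rintro p ⟨h1, h2, h3, h4, h5⟩ q ⟨k1, k2, k3, k4, k5⟩ a b ha hb hab
  simp only [InBase, mem_ofPred_eq, Prod.fst_add, Prod.smul_fst, Complex.add_re, Complex.add_im,
    Complex.smul_re, Complex.smul_im, Prod.snd_add, Prod.smul_snd, smul_eq_mul, h5, k5]
  obtain rfl : b = 1 - a := by linarith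
  refine ⟨?_, ?_, ?_, ?_, by simp⟩ <;> nlinarith

/-- The straight segment between two points of the rectangle. -/
def baseSegment {g : ℕ} (p q : Surface g) (hp : InBase g p.1) (hq : InBase g q.1) : Path p q where
  toFun t := ⟨AffineMap.lineMap p.1 q.1 (t : ℝ), Or.inl ((convex_inBase g).lineMap_mem hp hq t.2)⟩
  continuous_toFun := Continuous.subtype_mk
    (AffineMap.lineMap_continuous.comp continuous_subtype_val) _
  source' := Subtype.ext (by simp)
  target' := Subtype.ext (by simp)

/-- The core of the `i`-th annulus of the first kind, run clockwise from its lowest point. -/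
def coreA (g : ℕ) (i : Fin g) :
    Path (annulusA g i (Circle.exp (-(Real.pi / 2)), jMid))
      (annulusA g i (Circle.exp (-(Real.pi / 2)), jMid)) where
  toFun t := annulusA g i (Circle.exp (-(Real.pi / 2) - 2 * Real.pi * t), jMid)
  continuous_toFun := by fun_prop
  source' := by simp
  target' := by simp

/-- The core of the `i`-th annulus of the second kind, run counterclockwise from its lowest point. -/
def coreB (g : ℕ) (i : Fin g) :
    Path (annulusB g i (Circle.exp (-(Real.pi / 2)), jMid))
      (annulusB g i (Circle.exp (-(Real.pi / 2)), jMid)) where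
  toFun t := annulusB g i (Circle.exp (-(Real.pi / 2) + 2 * Real.pi * t), jMid)
  continuous_toFun := by fun_prop
  source' := by simp
  target' := by simp

theorem exp_bottom : (Circle.exp (-(Real.pi / 2)) : ℂ) = -Complex.I := by
  rw [Circle.coe_exp]
  push_cast
  rw [neg_mul, Complex.exp_neg, Complex.exp_pi_div_two_mul_I, Complex.inv_I]

theorem inBase_coreA (g : ℕ) (i : Fin g) :
    InBase g (annulusA g i (Circle.exp (-(Real.pi / 2)), jMid)).1 := by
  have hi : ((i : ℕ) : ℝ) + 1 ≤ g := by exact_mod_cast i.2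
  have hi0 : (0 : ℝ) ≤ (i : ℕ) := Nat.cast_nonneg _
  have h : (annulusA g i (Circle.exp (-(Real.pi / 2)), jMid)).1 =
      ((centerA i : ℂ) + ((3 + (jMid : ℝ) / 2 : ℝ) : ℂ) * (Circle.exp (-(Real.pi / 2)) : ℂ), 0) := rfl
  rw [h, exp_bottom]
  simp only [InBase, centerA, jMid]
  refine ⟨?_, ?_, ?_, ?_, trivial⟩ <;> simp <;> linarith

theorem inBase_coreB (g : ℕ) (i : Fin g) :
    InBase g (annulusB g i (Circle.exp (-(Real.pi / 2)), jMid)).1 := by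
  have hi : ((i : ℕ) : ℝ) + 1 ≤ g := by exact_mod_cast i.2
  have hi0 : (0 : ℝ) ≤ (i : ℕ) := Nat.cast_nonneg _
  have h : (annulusB g i (Circle.exp (-(Real.pi / 2)), jMid)).1 =
      ((centerB i : ℂ) + stretch
          (((3 + (jMid : ℝ) / 2 : ℝ) : ℂ) * (Circle.exp (-(Real.pi / 2)) : ℂ)),
        max 0 (stretch
          (((3 + (jMid : ℝ) / 2 : ℝ) : ℂ) * (Circle.exp (-(Real.pi / 2)) : ℂ))).im) := rfl
  rw [h, exp_bottom]
  simp only [InBase, stretch, centerB, jMid]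
  refine ⟨?_, ?_, ?_, ?_, max_eq_left ?_⟩ <;> simp <;> linarith

theorem inBase_star (g : ℕ) : InBase g (star g).1 :=
  ⟨le_rfl, by change (0 : ℝ) ≤ _; positivity, le_rfl, by change (-10 : ℝ) ≤ 0; norm_num, rfl⟩

/-- The `i`-th meridian, as a loop based at `⋆`. -/
def loopA (g : ℕ) (i : Fin g) : Path (star g) (star g) :=
  ((baseSegment _ _ (inBase_star g) (inBase_coreA g i)).trans (coreA g i)).trans
    (baseSegment _ _ (inBase_star g) (inBase_coreA g i)).symm

/-- The `i`-th parallel, as a loop based at `⋆`. -/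
def loopB (g : ℕ) (i : Fin g) : Path (star g) (star g) :=
  ((baseSegment _ _ (inBase_star g) (inBase_coreB g i)).trans (coreB g i)).trans
    (baseSegment _ _ (inBase_star g) (inBase_coreB g i)).symm

/-! ## Cobordisms and the Magnus functor -/

/-- The part of the data of a cobordism `(M, m)` from `F_{g₋}` to `F_{g₊}` on which its value under
the Magnus functor depends: the space `M`, the parametrizations `m₋` and `m₊` of the bottom and of
the top, and the vertical segment `m(⋆ × [-1, 1])` of the side. -/
structure CobordismData (gBot gTop : ℕ) where
  M : Type
  [top : TopologicalSpace M]
  mBot : C(Surface gBot, M)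
  mTop : C(Surface gTop, M)
  side : Path (mBot (star gBot)) (mTop (star gTop))

attribute [instance] CobordismData.top

section Mag

variable {R : Type*} [CommRing R] {G : Subgroup Rˣ}

/-- The closure `{x | ∃ r ≠ 0, r x ∈ N}` of a submodule `N`. -/
def closure [IsDomain R] {H : Type*} [AddCommGroup H] [Module R H] (N : Submodule R H) :
    Submodule R H where
  carrier := {x | ∃ r : R, r ≠ 0 ∧ r • x ∈ N}
  zero_mem' := ⟨1, one_ne_zero, by simp⟩
  add_mem' := by
    rintro x y ⟨r, hr, hx⟩ ⟨s, hs, hy⟩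
    refine ⟨r * s, mul_ne_zero hr hs, ?_⟩
    rw [smul_add, mul_smul r s y, mul_comm, mul_smul s r x]
    exact N.add_mem (N.smul_mem s hx) (N.smul_mem r hy)
  smul_mem' := by
    rintro c x ⟨r, hr, hx⟩
    exact ⟨r, hr, by rw [smul_comm]; exact N.smul_mem c hx⟩

namespace CobordismData

variable {gBot gTop : ℕ} (C : CobordismData gBot gTop)

/-- `H₁(M)`, based at the lower end of the vertical segment. -/
abbrev H1M : Type := H1 C.M (C.mBot (star gBot))

/-- The homomorphism `φ₋ = φ ∘ m₋ : H₁(F_{g₋}) → G`. -/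
def phiBot (φ : C.H1M →* G) : H1 (Surface gBot) (star gBot) →* G :=
  φ.comp (H1.map C.mBot (Path.refl _))

/-- The homomorphism `φ₊ = φ ∘ m₊ : H₁(F_{g₊}) → G`. -/
def phiTop (φ : C.H1M →* G) : H1 (Surface gTop) (star gTop) →* G :=
  φ.comp (H1.map C.mTop C.side)

/-- The map `m₋ : H₁^{φ₋}(F_{g₋}, ⋆) → H₁^φ(M, ⋆)`. The base point of `M` is thickened to the
vertical segment `m(⋆ × [-1, 1])`, which contains the base points of the bottom and of the top. -/
def twistedBot (φ : C.H1M →* G) :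
    TwistedH1 {star gBot} (C.phiBot φ) →ₗ[R] TwistedH1 (range C.side) φ :=
  TwistedH1.map φ C.mBot (Path.refl _) (by rintro _ rfl; exact ⟨0, C.side.source⟩)

/-- The map `m₊ : H₁^{φ₊}(F_{g₊}, ⋆) → H₁^φ(M, ⋆)`. -/
def twistedTop (φ : C.H1M →* G) :
    TwistedH1 {star gTop} (C.phiTop φ) →ₗ[R] TwistedH1 (range C.side) φ :=
  TwistedH1.map φ C.mTop C.side (by rintro _ rfl; exact ⟨1, C.side.target⟩)

/-- The submodule `Mag(M, φ) = cl (ker ((-m₋) ⊕ m₊))` of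
`H₁^{φ₋}(F_{g₋}, ⋆) ⊕ H₁^{φ₊}(F_{g₊}, ⋆)`. -/
def Mag [IsDomain R] (φ : C.H1M →* G) :
    Submodule R (TwistedH1 {star gBot} (C.phiBot φ) × TwistedH1 {star gTop} (C.phiTop φ)) :=
  closure (LinearMap.ker ((-C.twistedBot φ).coprod (C.twistedTop φ)))

end CobordismData

end Mag

/-! ## The handlebodies -/

/-- The identification of `∂D² × [-1, 1]` in the `i`-th `2`-handle `D² × [-1, 1]` with the annulus
`c i` in `F_g × {e}`. -/
inductive HandleRel {g : ℕ} (c : Fin g → C(Circle × J, Surface g)) (e : J) :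
    (Surface g × J) ⊕ (Fin g × Metric.closedBall (0 : ℂ) 1 × J) →
      (Surface g × J) ⊕ (Fin g × Metric.closedBall (0 : ℂ) 1 × J) → Prop
  | glue (i : Fin g) (u : Circle) (t : J) :
      HandleRel c e (Sum.inl (c i (u, t), e))
        (Sum.inr (i, ⟨(u : ℂ), by simp [Circle.norm_coe]⟩, t))

/-- The space obtained from `F_g × [-1, 1]` by attaching `g` `2`-handles along the annuli
`c i × {e}`. -/
def Handlebody {g : ℕ} (c : Fin g → C(Circle × J, Surface g)) (e : J) : Type :=
  Quot (HandleRel c e)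

instance {g : ℕ} (c : Fin g → C(Circle × J, Surface g)) (e : J) :
    TopologicalSpace (Handlebody c e) :=
  inferInstanceAs (TopologicalSpace (Quot (HandleRel c e)))

/-- The image of `F_g × [-1, 1]` in the handlebody. -/
def Handlebody.cyl {g : ℕ} (c : Fin g → C(Circle × J, Surface g)) (e : J) :
    C(Surface g × J, Handlebody c e) where
  toFun x := Quot.mk _ (Sum.inl x)
  continuous_toFun := continuous_quot_mk.comp continuous_inl

/-- The inclusion `x ↦ (x, t)` of `F_g` as `F_g × {t}`. -/
def Handlebody.level {g : ℕ} (c : Fin g → C(Circle × J, Surface g)) (e t : J) :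
    C(Surface g, Handlebody c e) :=
  (Handlebody.cyl c e).comp ((ContinuousMap.id _).prodMk (ContinuousMap.const _ t))

/-- The vertical segment `⋆ × [-1, 1]`. -/
def Handlebody.side {g : ℕ} (c : Fin g → C(Circle × J, Surface g)) (e : J) :
    Path (Handlebody.level c e jBot (star g)) (Handlebody.level c e jTop (star g)) where
  toFun t := Handlebody.cyl c e (star g, ⟨2 * (t : ℝ) - 1, by
    have := t.2.1; have := t.2.2; constructor <;> linarith⟩)
  continuous_toFun := by fun_prop
  source' := by simp [Handlebody.level, jBot]
  target' := by
    simp only [Handlebody.level, jTop, ContinuousMap.comp_apply]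
    congr 3
    norm_num

/-- The handlebody underlying `C_0^g`: the `2`-handles are attached along the meridians in
`F_g × {-1}`. -/
abbrev LowerSpace (g : ℕ) : Type := Handlebody (annulusA g) jBot

/-- The handlebody underlying `C_g^0`: the `2`-handles are attached along the parallels in
`F_g × {1}`. -/
abbrev UpperSpace (g : ℕ) : Type := Handlebody (annulusB g) jTop

/-- The lower handlebody `C_0^g`. The top is `F_g × {1}`; the bottom is the disk obtained from
`F_g × {-1}` by surgery along the meridians, and `d` is its parametrization by the disk `F_0`
(unique up to isotopy; any continuous map `d` that preserves the base points is allowed here). -/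
def lowerHandlebody (g : ℕ) (d : C(Surface 0, LowerSpace g))
    (hd : d (star 0) = Handlebody.level (annulusA g) jBot jBot (star g)) : CobordismData 0 g where
  M := LowerSpace g
  mBot := d
  mTop := Handlebody.level (annulusA g) jBot jTop
  side := (Handlebody.side (annulusA g) jBot).cast hd rfl

/-- The upper handlebody `C_g^0`. The bottom is `F_g × {-1}`; the top is the disk obtained from
`F_g × {1}` by surgery along the parallels, and `d` is its parametrization by the disk `F_0`
(unique up to isotopy; any continuous map `d` that preserves the base points is allowed here). -/
def upperHandlebody (g : ℕ) (d : C(Surface 0, UpperSpace g))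
    (hd : d (star 0) = Handlebody.level (annulusB g) jTop jTop (star g)) : CobordismData g 0 where
  M := UpperSpace g
  mBot := Handlebody.level (annulusB g) jTop jBot
  mTop := d
  side := (Handlebody.side (annulusB g) jTop).cast rfl hd

end Magnus

end

/-!
Collapsing all of `F_g × [-1, 1]` except the bands that carry no handle, and then the handles, maps
the handlebody to a wedge of circles in such a way that the loops of the remaining bands go around
the circles once each. Affine transformations of `R` assigned to the circles give a holonomy on the
wedge. Pull it back to the handlebody: if the linear parts on the circles are prescribed by `φ`,
then all its linear parts are, because the remaining loops generate the fundamental group. The image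
of `0` under the holonomy along paths therefore defines a linear form on the twisted homology, whose
values on the remaining loops are the translation parts, which can be chosen freely. This gives
forms dual to the remaining loops, whereas the loops along which the handles are attached become
null-homotopic: if `r x` lies in the kernel for some `r ≠ 0`, then the coordinates of `x` along the
remaining loops vanish. The same forms, for `F_g` itself, give the freeness.
-/

noncomputable section

namespace Magnus

open Set

/-! ## Twisted one-chains modulo boundaries -/

section TwistedChains

variable {X : Type*} [TopologicalSpace X] {x₀ : X} {R : Type*} [CommRing R] {G : Subgroup Rˣ}

/-- The value in `R` of `φ : H₁(X) → G ⊆ Rˣ` on the homotopy class of a loop. -/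
def weight (φ : H1 X x₀ →* G) (l : Path.Homotopic.Quotient x₀ x₀) : R :=
  ((φ (Abelianization.of (FundamentalGroup.fromPath l)) : G) : Rˣ)

theorem weight_trans (φ : H1 X x₀ →* G) (l m : Path.Homotopic.Quotient x₀ x₀) :
    weight φ (l.trans m) = weight φ l * weight φ m := by
  have h : FundamentalGroup.fromPath (l.trans m) =
      FundamentalGroup.fromPath m * FundamentalGroup.fromPath l := rfl
  rw [weight, h, map_mul, map_mul, mul_comm]
  simp [weight]

theorem weight_refl (φ : H1 X x₀ →* G) : weight φ (.refl x₀) = 1 := by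
  have h : FundamentalGroup.fromPath (.refl x₀) = (1 : FundamentalGroup X x₀) := rfl
  rw [weight, h, map_one, map_one]
  simp

/-- The generator `1 ⊗ s` of the twisted chain module. -/
def chainClass (A : Set X) (φ : H1 X x₀ →* G) {n : ℕ} (s : LiftedSimplex x₀ n) : Chain A φ n :=
  Submodule.Quotient.mk (Finsupp.single s 1)

theorem chainClass_translate (A : Set X) (φ : H1 X x₀ →* G) {n : ℕ}
    (l : Path.Homotopic.Quotient x₀ x₀) (s : LiftedSimplex x₀ n) :
    chainClass A φ (s.translate (FundamentalGroup.fromPath l)) =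
      weight φ l • chainClass A φ s := by
  rw [chainClass, chainClass, ← Submodule.Quotient.mk_smul, Submodule.Quotient.eq,
    Finsupp.smul_single, smul_eq_mul, mul_one]
  exact Submodule.subset_span (Or.inl ⟨FundamentalGroup.fromPath l, s, rfl⟩)

theorem boundary_chainClass (A : Set X) (φ : H1 X x₀ →* G) {n : ℕ}
    (s : LiftedSimplex x₀ (n + 1)) :
    boundary A φ n (chainClass A φ s) =
      ∑ i : Fin (n + 2), (-1 : R) ^ (i : ℕ) • chainClass A φ (s.face i) := by
  change (relations A φ n).mkQ (freeBoundary R x₀ n (Finsupp.single s 1)) = _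
  rw [freeBoundary, Finsupp.linearCombination_single, one_smul, map_sum]
  rfl

theorem span_chainClass (A : Set X) (φ : H1 X x₀ →* G) (n : ℕ) :
    Submodule.span R (range (chainClass A φ (n := n))) = ⊤ := by
  have h : range (chainClass A φ (n := n)) =
      (relations A φ n).mkQ '' range fun s => Finsupp.single s (1 : R) := by
    rw [← range_comp]; rfl
  have hs : Submodule.span R (range fun s : LiftedSimplex x₀ n => Finsupp.single s (1 : R)) =
      ⊤ := by
    rw [← Finsupp.coe_basisSingleOne, Module.Basis.span_eq]
  rw [h, Submodule.span_image, hs, Submodule.map_top, Submodule.range_mkQ]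

section Lift

variable {N : Type*} [AddCommGroup N] [Module R N]

/-- The universal property of the twisted chain module. -/
def chainLift (A : Set X) (φ : H1 X x₀ →* G) (n : ℕ) (v : LiftedSimplex x₀ n → N)
    (hv : ∀ l s, v (s.translate (FundamentalGroup.fromPath l)) = weight φ l • v s)
    (hA : ∀ s, range s.simplex ⊆ A → v s = 0) : Chain A φ n →ₗ[R] N :=
  Submodule.liftQ _ (Finsupp.linearCombination R v) <| Submodule.span_le.2 <| by
    rintro _ (⟨l, s, rfl⟩ | ⟨s, hs, rfl⟩)
    · simp only [SetLike.mem_coe, LinearMap.mem_ker, map_sub, Finsupp.linearCombination_single,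
        one_smul]
      exact sub_eq_zero.2 (hv (FundamentalGroup.toPath l) s)
    · simp only [SetLike.mem_coe, LinearMap.mem_ker, Finsupp.linearCombination_single, one_smul,
        hA s hs]

theorem chainLift_chainClass (A : Set X) (φ : H1 X x₀ →* G) {n : ℕ} (v : LiftedSimplex x₀ n → N)
    (hv) (hA) (s : LiftedSimplex x₀ n) : chainLift A φ n v hv hA (chainClass A φ s) = v s := by
  refine (Submodule.liftQ_apply _ _ _).trans ?_
  rw [Finsupp.linearCombination_single, one_smul]

end Lift

end TwistedChains

/-! ## Lifted paths -/

section LiftedPaths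

variable {X : Type*} [TopologicalSpace X] {x₀ : X}

theorem LiftedSimplex.ext_of_cast {n : ℕ} {s s' : LiftedSimplex x₀ n}
    (h : s.simplex = s'.simplex) (hs : s.start = s'.start.cast rfl (by rw [h])) : s = s' := by
  obtain ⟨σ, γ⟩ := s
  obtain ⟨σ', γ'⟩ := s'
  obtain rfl : σ = σ' := h
  simp only [Path.Homotopic.Quotient.cast_rfl_rfl] at hs
  rw [hs]

theorem cast_trans_cast {a b c b' c' : X} (p : Path.Homotopic.Quotient a b)
    (q : Path.Homotopic.Quotient b c) (hb : b' = b) (hc : c' = c) :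
    (p.cast rfl hb).trans (q.cast hb hc) = (p.trans q).cast rfl hc := by
  subst hb hc
  simp only [Path.Homotopic.Quotient.cast_rfl_rfl]

theorem trans_cast {a b c c' : X} (p : Path.Homotopic.Quotient a b)
    (q : Path.Homotopic.Quotient b c) (h : c' = c) :
    (p.trans q).cast rfl h = p.trans (q.cast rfl h) := by
  subst h
  simp only [Path.Homotopic.Quotient.cast_rfl_rfl]

/-- The point of the universal cover given by a path class from the base point, as a lifted
`0`-simplex. -/
def liftPoint {a : X} (γ : Path.Homotopic.Quotient x₀ a) : LiftedSimplex x₀ 0 where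
  simplex := ContinuousMap.const _ a
  start := γ

/-- The lift of a path `p` to the universal cover that starts at the point given by `γ`, as a
lifted `1`-simplex. -/
def liftPath {a b : X} (γ : Path.Homotopic.Quotient x₀ a) (p : Path a b) : LiftedSimplex x₀ 1 where
  simplex := pathSimplex p
  start := γ.cast rfl (pathSimplex_vertex_zero p)

theorem liftPath_trans_left {a b : X} (l : Path.Homotopic.Quotient x₀ x₀)
    (γ : Path.Homotopic.Quotient x₀ a) (p : Path a b) :
    liftPath (l.trans γ) p = (liftPath γ p).translate (FundamentalGroup.fromPath l) :=
  congrArg (LiftedSimplex.mk (pathSimplex p))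
    (trans_cast l γ (pathSimplex_vertex_zero p))

/-- The image under `σ` of the edge of the simplex from the vertex `i` to the vertex `j`. -/
def edgePath {n : ℕ} (σ : C(Simplex n, X)) (i j : Fin (n + 1)) :
    Path (σ (stdSimplex.vertex i)) (σ (stdSimplex.vertex j)) :=
  (vertexPath i j).map σ.continuous

theorem edgePath_apply {n : ℕ} (σ : C(Simplex n, X)) (i j : Fin (n + 1)) (t : Simplex 1) :
    edgePath σ i j (stdSimplexHomeomorphUnitInterval t) = σ (stdSimplex.map ![i, j] t) := by
  change σ (stdSimplex.map ![i, j] (stdSimplexHomeomorphUnitInterval.symm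
    (stdSimplexHomeomorphUnitInterval t))) = _
  rw [Homeomorph.symm_apply_apply]

theorem edgePath_self {n : ℕ} (σ : C(Simplex n, X)) (i : Fin (n + 1)) :
    edgePath σ i i = Path.refl _ := by
  ext t
  refine congrArg σ (?_ : stdSimplex.map ![i, i] _ = _)
  have h : (![i, i] : Fin 2 → Fin (n + 1)) = (fun _ => i) ∘ fun _ => (0 : Fin 1) := by
    ext k; fin_cases k <;> rfl
  rw [h]
  exact (stdSimplex.map_comp_apply (fun _ : Fin 2 => (0 : Fin 1)) (fun _ => i) _).symm.trans
    ((congrArg _ (Subsingleton.elim _ (stdSimplex.vertex 0))).trans (stdSimplex.map_vertex _ _))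

instance (n : ℕ) : ContractibleSpace (Simplex n) :=
  (convex_stdSimplex ℝ (Fin (n + 1))).contractibleSpace ⟨_, (stdSimplex.vertex (S := ℝ) 0).2⟩

theorem mk_edgePath_trans {n : ℕ} (σ : C(Simplex n, X)) (i j k : Fin (n + 1)) :
    (Path.Homotopic.Quotient.mk (edgePath σ i j)).trans (.mk (edgePath σ j k)) =
      .mk (edgePath σ i k) := by
  rw [← Path.Homotopic.Quotient.mk_trans, edgePath, edgePath, ← Path.map_trans]
  exact Path.Homotopic.Quotient.eq.2 ((SimplyConnectedSpace.paths_homotopic _ _).map σ)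

theorem map_zero_one (t : Simplex 1) : stdSimplex.map ![0, 1] t = t := by
  have h : (![0, 1] : Fin 2 → Fin 2) = id := by ext i; fin_cases i <;> rfl
  rw [h, stdSimplex.map_id_apply]

theorem LiftedSimplex.eq_liftPath (s : LiftedSimplex x₀ 1) :
    s = liftPath s.start (edgePath s.simplex 0 1) := by
  refine ext_of_cast ?_ (.symm <| (Path.Homotopic.Quotient.cast_cast _ _ _ _ _).trans
    (Path.Homotopic.Quotient.cast_rfl_rfl _))
  ext t
  exact ((edgePath_apply s.simplex 0 1 t).trans (congrArg s.simplex (map_zero_one t))).symm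

theorem LiftedSimplex.face_zero_eq_liftPoint (s : LiftedSimplex x₀ 1) :
    s.face 0 = liftPoint (s.start.trans (.mk (edgePath s.simplex 0 1))) := by
  refine ext_of_cast ?_ rfl
  ext t
  obtain rfl : t = stdSimplex.vertex 0 := Subsingleton.elim _ _
  exact congrArg s.simplex (stdSimplex.map_vertex _ _)

theorem LiftedSimplex.face_one_eq_liftPoint (s : LiftedSimplex x₀ 1) :
    s.face 1 = liftPoint s.start := by
  have h : s.start = s.start.trans (.mk (edgePath s.simplex 0 0)) := by
    rw [edgePath_self, Path.Homotopic.Quotient.mk_refl, Path.Homotopic.Quotient.trans_refl]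
  rw [h]
  refine ext_of_cast ?_ rfl
  ext t
  obtain rfl : t = stdSimplex.vertex 0 := Subsingleton.elim _ _
  exact congrArg s.simplex (stdSimplex.map_vertex _ _)

theorem LiftedSimplex.face_eq_liftPath (s : LiftedSimplex x₀ 2) {i a b : Fin 3}
    (h : i.succAbove = ![a, b]) :
    s.face i =
      liftPath (s.start.trans (.mk (edgePath s.simplex 0 a))) (edgePath s.simplex a b) := by
  obtain rfl : i.succAbove 0 = a := congrFun h 0
  refine ext_of_cast ?_ (Path.Homotopic.Quotient.cast_cast _ _ _ _ _).symm
  ext t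
  refine Eq.trans ?_ (edgePath_apply s.simplex _ b t).symm
  rw [← h]
  rfl

theorem edgePath_pathSimplex {a b : X} (p : Path a b) :
    edgePath (pathSimplex p) 0 1 =
      p.cast (pathSimplex_vertex_zero p) (pathSimplex_vertex_one p) := by
  ext t
  change p (stdSimplexHomeomorphUnitInterval (stdSimplex.map ![0, 1]
    (stdSimplexHomeomorphUnitInterval.symm t))) = p t
  rw [map_zero_one, Homeomorph.apply_symm_apply]

theorem liftPath_start_trans {a b : X} (γ : Path.Homotopic.Quotient x₀ a) (p : Path a b) :
    (liftPath γ p).start.trans (.mk (edgePath (liftPath γ p).simplex 0 1)) =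
      (γ.trans (.mk p)).cast rfl (pathSimplex_vertex_one p) := by
  rw [← cast_trans_cast _ _ (pathSimplex_vertex_zero p) (pathSimplex_vertex_one p),
    ← Path.Homotopic.Quotient.mk_cast, ← edgePath_pathSimplex]
  rfl

end LiftedPaths

/-! ## The edge calculus -/

section Edges

variable {X : Type*} [TopologicalSpace X] {x₀ : X} {R : Type*} [CommRing R] {G : Subgroup Rˣ}

theorem boundary_chainClass_one (A : Set X) (φ : H1 X x₀ →* G) (s : LiftedSimplex x₀ 1) :
    boundary A φ 0 (chainClass A φ s) =
      chainClass A φ (liftPoint (s.start.trans (.mk (edgePath s.simplex 0 1)))) -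
        chainClass A φ (liftPoint s.start) := by
  rw [boundary_chainClass, Fin.sum_univ_two, s.face_zero_eq_liftPoint, s.face_one_eq_liftPoint]
  simp [sub_eq_add_neg]

theorem boundary_chainClass_two (A : Set X) (φ : H1 X x₀ →* G) (s : LiftedSimplex x₀ 2) :
    boundary A φ 1 (chainClass A φ s) =
      chainClass A φ (liftPath (s.start.trans (.mk (edgePath s.simplex 0 1)))
          (edgePath s.simplex 1 2)) -
        chainClass A φ (liftPath s.start (edgePath s.simplex 0 2)) +
        chainClass A φ (liftPath s.start (edgePath s.simplex 0 1)) := by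
  have h : s.start.trans (.mk (edgePath s.simplex 0 0)) = s.start := by
    rw [edgePath_self, Path.Homotopic.Quotient.mk_refl, Path.Homotopic.Quotient.trans_refl]
  rw [boundary_chainClass, Fin.sum_univ_three,
    s.face_eq_liftPath (i := 0) (a := 1) (b := 2) (by ext i; fin_cases i <;> rfl),
    s.face_eq_liftPath (i := 1) (a := 0) (b := 2) (by ext i; fin_cases i <;> rfl),
    s.face_eq_liftPath (i := 2) (a := 0) (b := 1) (by ext i; fin_cases i <;> rfl), h]
  simp [sub_eq_add_neg]

/-- The twisted `1`-chains modulo the boundaries of the `2`-chains. The twisted homology is a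
submodule of it, and paths that are not loops still have a class in it. -/
abbrev ChainModBoundaries (A : Set X) (φ : H1 X x₀ →* G) : Type _ :=
  Chain A φ 1 ⧸ LinearMap.range (boundary A φ 1)

/-- The class modulo boundaries of the lift of the path `p` that starts at the point given
by `γ`. -/
def edge (A : Set X) (φ : H1 X x₀ →* G) {a b : X} (γ : Path.Homotopic.Quotient x₀ a)
    (p : Path a b) : ChainModBoundaries A φ :=
  Submodule.Quotient.mk (chainClass A φ (liftPath γ p))

theorem edge_edgePath (A : Set X) (φ : H1 X x₀ →* G) (σ : C(Simplex 2, X))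
    (γ : Path.Homotopic.Quotient x₀ (σ (stdSimplex.vertex 0))) :
    edge A φ γ (edgePath σ 0 1) + edge A φ (γ.trans (.mk (edgePath σ 0 1))) (edgePath σ 1 2) =
      edge A φ γ (edgePath σ 0 2) := by
  have h : (Submodule.Quotient.mk (boundary A φ 1 (chainClass A φ ⟨σ, γ⟩)) :
      ChainModBoundaries A φ) = 0 := (Submodule.Quotient.mk_eq_zero _).2 ⟨_, rfl⟩
  rw [boundary_chainClass_two, Submodule.Quotient.mk_add, Submodule.Quotient.mk_sub] at h
  rw [← sub_eq_zero, ← h]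
  simp only [edge]
  abel

theorem edge_triangle (A : Set X) (φ : H1 X x₀ →* G) (σ : C(Simplex 2, X)) {a b c : X}
    (γ : Path.Homotopic.Quotient x₀ a) (p : Path a b) (q : Path b c) (r : Path a c)
    (hp : ∀ t : Simplex 1, p (stdSimplexHomeomorphUnitInterval t) = σ (stdSimplex.map ![0, 1] t))
    (hq : ∀ t : Simplex 1, q (stdSimplexHomeomorphUnitInterval t) = σ (stdSimplex.map ![1, 2] t))
    (hr : ∀ t : Simplex 1, r (stdSimplexHomeomorphUnitInterval t) = σ (stdSimplex.map ![0, 2] t)) :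
    edge A φ γ p + edge A φ (γ.trans (.mk p)) q = edge A φ γ r := by
  have eq_edgePath : ∀ {u v : X} (s : Path u v) (i j : Fin 3),
      (∀ t : Simplex 1, s (stdSimplexHomeomorphUnitInterval t) = σ (stdSimplex.map ![i, j] t)) →
      ∀ t, s t = edgePath σ i j t := by
    intro u v s i j h t
    rw [← stdSimplexHomeomorphUnitInterval.apply_symm_apply t, h, edgePath_apply]
  have hp := eq_edgePath p 0 1 hp
  have hq := eq_edgePath q 1 2 hq
  have hr := eq_edgePath r 0 2 hr
  obtain rfl : a = σ (stdSimplex.vertex 0) := by rw [← p.source, hp, Path.source]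
  obtain rfl : b = σ (stdSimplex.vertex 1) := by rw [← p.target, hp, Path.target]
  obtain rfl : c = σ (stdSimplex.vertex 2) := by rw [← q.target, hq, Path.target]
  obtain rfl : p = edgePath σ 0 1 := Path.ext (funext hp)
  obtain rfl : q = edgePath σ 1 2 := Path.ext (funext hq)
  obtain rfl : r = edgePath σ 0 2 := Path.ext (funext hr)
  exact edge_edgePath A φ σ γ

theorem edge_refl (A : Set X) (φ : H1 X x₀ →* G) {a : X} (γ : Path.Homotopic.Quotient x₀ a) :
    edge A φ γ (Path.refl a) = 0 := by
  have h := edge_triangle A φ (ContinuousMap.const _ a) γ (Path.refl a) (Path.refl a) (Path.refl a)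
    (fun _ => rfl) (fun _ => rfl) (fun _ => rfl)
  rw [Path.Homotopic.Quotient.mk_refl, Path.Homotopic.Quotient.trans_refl] at h
  exact add_eq_left.1 h

/-- The map `Δ² → ℝ` that is affine with the values `0`, `u`, `v` at the vertices. -/
def affineOnTriangle (u v : ℝ) : C(Simplex 2, ℝ) where
  toFun x := u * x 1 + v * x 2
  continuous_toFun := by
    have h (i : Fin 3) : Continuous fun x : Simplex 2 => x i :=
      (continuous_apply i).comp continuous_subtype_val
    exact (continuous_const.mul (h 1)).add (continuous_const.mul (h 2))

theorem affineOnTriangle_map (u v : ℝ) (i j : Fin 3) (t : Simplex 1) :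
    affineOnTriangle u v (stdSimplex.map ![i, j] t) =
      ![0, u, v] i * (1 - (stdSimplexHomeomorphUnitInterval t : ℝ)) +
        ![0, u, v] j * (stdSimplexHomeomorphUnitInterval t : ℝ) := by
  have hsum : t 0 + t 1 = 1 := stdSimplex.add_eq_one t
  have ht : (stdSimplexHomeomorphUnitInterval t : ℝ) = t 1 := rfl
  rw [ht, ← hsum, add_sub_cancel_right]
  change u * (stdSimplex.map ![i, j] t : Fin 3 → ℝ) 1 +
    v * (stdSimplex.map ![i, j] t : Fin 3 → ℝ) 2 = _
  simp only [stdSimplex.map_coe, FunOnFinite.linearMap_apply_apply, Finset.sum_filter,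
    Fin.sum_univ_two]
  fin_cases i <;> fin_cases j <;> simp <;> ring_nf

theorem edge_trans (A : Set X) (φ : H1 X x₀ →* G) {a b c : X}
    (γ : Path.Homotopic.Quotient x₀ a) (p : Path a b) (q : Path b c) :
    edge A φ γ (p.trans q) = edge A φ γ p + edge A φ (γ.trans (.mk p)) q := by
  refine (edge_triangle A φ ((⟨(p.trans q).extend, (p.trans q).continuous_extend⟩ : C(ℝ, X)).comp
    (affineOnTriangle (1 / 2) 1)) γ p q (p.trans q) ?_ ?_ ?_).symm
  all_goals
    intro t
    simp only [ContinuousMap.comp_apply, ContinuousMap.coe_mk, affineOnTriangle_map]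
    generalize stdSimplexHomeomorphUnitInterval t = s
    have h0 := s.2.1
    have h1 := s.2.2
    simp only [Matrix.cons_val]
  · rw [Path.extend_apply _ (by constructor <;> linarith), Path.trans_apply,
      dif_pos (by simp; linarith)]
    congr 1
    ext
    simp
  · rcases eq_or_lt_of_le h0 with h | h
    · obtain rfl : s = 0 := Subtype.ext h.symm
      rw [q.source, Path.extend_apply _ (by norm_num), Path.trans_apply, dif_pos (by norm_num)]
      convert p.target.symm using 2
      ext
      norm_num
    rw [Path.extend_apply _ (by constructor <;> linarith), Path.trans_apply,
      dif_neg (by simp; linarith)]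
    congr 1
    ext
    simp
    ring
  · rw [← Path.extend_extends' (p.trans q)]
    congr 1
    ring

theorem edge_homotopic (A : Set X) (φ : H1 X x₀ →* G) {a b : X}
    (γ : Path.Homotopic.Quotient x₀ a) {p q : Path a b} (h : p.Homotopic q) :
    edge A φ γ p = edge A φ γ q := by
  obtain ⟨F⟩ := h
  -- Cut the square along its diagonal; two of the four remaining sides are constant.
  let square : C(ℝ × ℝ, X) := F.toContinuousMap.comp
    ⟨fun x => (projIcc 0 1 zero_le_one x.1, projIcc 0 1 zero_le_one x.2), by fun_prop⟩
  let diagonal : Path a b :=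
    { toFun t := F (t, t)
      continuous_toFun := by fun_prop
      source' := by simp
      target' := by simp }
  have square_apply (s t : ℝ) :
      square (s, t) = F (projIcc 0 1 zero_le_one s, projIcc 0 1 zero_le_one t) := rfl
  have below := edge_triangle A φ
    (square.comp ((affineOnTriangle 0 1).prodMk (affineOnTriangle 1 1)))
    γ p (Path.refl b) diagonal
  have above := edge_triangle A φ
    (square.comp ((affineOnTriangle 1 1).prodMk (affineOnTriangle 0 1)))
    γ (Path.refl a) q diagonal
  simp only [ContinuousMap.comp_apply, ContinuousMap.prod_eval, square_apply, affineOnTriangle_map,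
    Matrix.cons_val] at below above
  rw [edge_refl, add_zero] at below
  rw [edge_refl, zero_add, Path.Homotopic.Quotient.mk_refl,
    Path.Homotopic.Quotient.trans_refl] at above
  rw [below, above]
  all_goals
    intro t
    generalize stdSimplexHomeomorphUnitInterval t = s
    simp [diagonal]

theorem edge_translate (A : Set X) (φ : H1 X x₀ →* G) {a b : X}
    (l : Path.Homotopic.Quotient x₀ x₀) (γ : Path.Homotopic.Quotient x₀ a) (p : Path a b) :
    edge A φ (l.trans γ) p = weight φ l • edge A φ γ p := by
  rw [edge, liftPath_trans_left, chainClass_translate, Submodule.Quotient.mk_smul]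
  rfl

theorem edge_symm (A : Set X) (φ : H1 X x₀ →* G) {a b : X}
    (γ : Path.Homotopic.Quotient x₀ a) (p : Path b a) :
    edge A φ γ p.symm = -edge A φ (γ.trans (.mk p.symm)) p := by
  have h := edge_trans A φ γ p.symm p
  rw [edge_homotopic A φ γ (Path.Homotopic.symm_trans p), edge_refl] at h
  exact eq_neg_of_add_eq_zero_left h.symm

/-- The inclusion of the twisted homology into the chains modulo boundaries. -/
def homologyToChains (A : Set X) (φ : H1 X x₀ →* G) :
    TwistedH1 A φ →ₗ[R] ChainModBoundaries A φ :=
  Submodule.mapQ _ _ (LinearMap.ker (boundary A φ 0)).subtype fun _ h => h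

theorem homologyToChains_injective (A : Set X) (φ : H1 X x₀ →* G) :
    Function.Injective (homologyToChains A φ) := by
  rw [← LinearMap.ker_eq_bot, LinearMap.ker_eq_bot']
  intro x
  induction x using Submodule.Quotient.induction_on with
  | H c =>
    intro h
    exact (Submodule.Quotient.mk_eq_zero _).2
      ((Submodule.Quotient.mk_eq_zero (LinearMap.range (boundary A φ 1)) (x := c.1)).1 h)

theorem homologyToChains_loopClass (φ : H1 X x₀ →* G) (p : Path x₀ x₀) :
    homologyToChains {x₀} φ (loopClass φ p) = edge {x₀} φ (.refl x₀) p := rfl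

theorem loopClass_homotopic (φ : H1 X x₀ →* G) {p q : Path x₀ x₀} (h : p.Homotopic q) :
    loopClass φ p = loopClass φ q :=
  homologyToChains_injective _ _ (edge_homotopic _ φ _ h)

theorem loopClass_trans (φ : H1 X x₀ →* G) (p q : Path x₀ x₀) :
    loopClass φ (p.trans q) = loopClass φ p + weight φ (.mk p) • loopClass φ q := by
  apply homologyToChains_injective
  rw [map_add, map_smul]
  simp only [homologyToChains_loopClass]
  rw [edge_trans, ← edge_translate, Path.Homotopic.Quotient.trans_refl,
    Path.Homotopic.Quotient.refl_trans]

theorem loopClass_refl (φ : H1 X x₀ →* G) : loopClass φ (Path.refl x₀) = 0 := by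
  apply homologyToChains_injective
  rw [map_zero]
  exact edge_refl _ _ _

theorem loopClass_symm (φ : H1 X x₀ →* G) (p : Path x₀ x₀) :
    loopClass φ p.symm = -(weight φ (.mk p.symm) • loopClass φ p) := by
  have h := loopClass_trans φ p.symm p
  rw [loopClass_homotopic φ (Path.Homotopic.symm_trans p), loopClass_refl] at h
  exact eq_neg_of_add_eq_zero_left h.symm

variable {Y : Type*} [TopologicalSpace Y] {y₀ : Y}

theorem LiftedSimplex.map_liftLoop (f : C(X, Y)) (w : Path y₀ (f x₀)) (p : Path x₀ x₀) :
    (liftLoop p).map f w = liftPath (.mk w) (p.map f.continuous) := by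
  refine ext_of_cast rfl ?_
  have map_cast : ∀ {c : X} (h : c = x₀) (h' : f c = f x₀), (Path.Homotopic.Quotient.mk w).trans
      (((Path.Homotopic.Quotient.refl x₀).cast rfl h).map f) =
      (Path.Homotopic.Quotient.mk w).cast rfl h' := by
    rintro _ rfl h'
    simp only [Path.Homotopic.Quotient.cast_rfl_rfl]
    exact Path.Homotopic.Quotient.trans_refl _
  exact (map_cast (pathSimplex_vertex_zero p) (congrArg f (pathSimplex_vertex_zero p))).trans
    (Path.Homotopic.Quotient.cast_cast _ _ _ _ _).symm

theorem homologyToChains_map_loopClass {B : Set Y} (φ : H1 Y y₀ →* G) (f : C(X, Y))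
    (w : Path y₀ (f x₀)) (hf : MapsTo f {x₀} B) (p : Path x₀ x₀) :
    homologyToChains B φ (TwistedH1.map φ f w hf (loopClass _ p)) =
      edge B φ (.mk w) (p.map f.continuous) := by
  change Submodule.Quotient.mk (Submodule.Quotient.mk
    (freeMap R f w 1 (Finsupp.single (liftLoop p) 1))) = _
  rw [freeMap, Finsupp.lmapDomain_apply, Finsupp.mapDomain_single, LiftedSimplex.map_liftLoop]
  rfl

end Edges

/-! ## Generation by loops -/

section LoopGeneration

variable {X : Type*} [TopologicalSpace X] {x₀ : X} {R : Type*} [CommRing R] {G : Subgroup Rˣ}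

/-- The contraction of the `0`-chains relative to the base point along a choice of paths from the
base point to all points. -/
def coneMap (φ : H1 X x₀ →* G) (w : ∀ x : X, Path x₀ x) (hw : w x₀ = Path.refl x₀) :
    Chain {x₀} φ 0 →ₗ[R] ChainModBoundaries {x₀} φ :=
  chainLift {x₀} φ 0 (fun s => edge {x₀} φ
      (s.start.trans (.symm (.mk (w (s.simplex (stdSimplex.vertex 0))))))
      (w (s.simplex (stdSimplex.vertex 0))))
    (fun l s => by
      rw [← edge_translate, ← Path.Homotopic.Quotient.trans_assoc]
      rfl)
    (fun s hs => by
      have h : ∀ x, x = x₀ → ∀ γ, edge {x₀} φ γ (w x) = 0 := by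
        rintro _ rfl γ
        rw [hw, edge_refl]
      exact h _ (hs ⟨_, rfl⟩) _)

theorem coneMap_liftPoint (φ : H1 X x₀ →* G) (w : ∀ x : X, Path x₀ x) (hw : w x₀ = Path.refl x₀)
    {a : X} (γ : Path.Homotopic.Quotient x₀ a) :
    coneMap φ w hw (chainClass {x₀} φ (liftPoint γ)) =
      edge {x₀} φ (γ.trans (.symm (.mk (w a)))) (w a) :=
  chainLift_chainClass _ _ _ _ _ _

theorem edge_eq_smul_loopClass_add (φ : H1 X x₀ →* G) (w : ∀ x : X, Path x₀ x) {a b : X}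
    (γ : Path.Homotopic.Quotient x₀ a) (p : Path a b) :
    edge {x₀} φ γ p =
      weight φ (γ.trans (.symm (.mk (w a)))) •
          homologyToChains {x₀} φ (loopClass φ (((w a).trans p).trans (w b).symm)) +
        (edge {x₀} φ ((γ.trans (.mk p)).trans (.symm (.mk (w b)))) (w b) -
          edge {x₀} φ (γ.trans (.symm (.mk (w a)))) (w a)) := by
  rw [homologyToChains_loopClass, ← edge_translate, edge_trans, edge_trans, edge_symm]
  simp only [Path.Homotopic.Quotient.mk_trans, Path.Homotopic.Quotient.mk_symm,
    Path.Homotopic.Quotient.trans_assoc, Path.Homotopic.Quotient.trans_refl, symm_trans_cancel,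
    Path.Homotopic.Quotient.symm_trans]
  abel

theorem mkQ_sub_coneMap_boundary_mem (φ : H1 X x₀ →* G) (w : ∀ x : X, Path x₀ x)
    (hw : w x₀ = Path.refl x₀) (c : Chain {x₀} φ 1) :
    (LinearMap.range (boundary {x₀} φ 1)).mkQ c - coneMap φ w hw (boundary {x₀} φ 0 c) ∈
      (Submodule.span R (range (loopClass φ))).map (homologyToChains {x₀} φ) := by
  let D := (LinearMap.range (boundary {x₀} φ 1)).mkQ - coneMap φ w hw ∘ₗ boundary {x₀} φ 0
  change D c ∈ _
  rw [← Submodule.mem_comap]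
  suffices h : Submodule.span R (range (chainClass {x₀} φ (n := 1))) ≤
      Submodule.comap D ((Submodule.span R (range (loopClass φ))).map (homologyToChains {x₀} φ)) by
    rw [span_chainClass] at h
    exact h Submodule.mem_top
  refine Submodule.span_le.2 ?_
  rintro _ ⟨s, rfl⟩
  have hD : D (chainClass {x₀} φ s) = weight φ (s.start.trans (.symm (.mk (w _)))) •
      homologyToChains {x₀} φ
        (loopClass φ (((w _).trans (edgePath s.simplex 0 1)).trans (w _).symm)) := by
    have hs : (LinearMap.range (boundary {x₀} φ 1)).mkQ (chainClass {x₀} φ s) =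
        edge {x₀} φ s.start (edgePath s.simplex 0 1) :=
      congrArg (fun s => Submodule.Quotient.mk (chainClass {x₀} φ s)) s.eq_liftPath
    rw [LinearMap.sub_apply, LinearMap.comp_apply, boundary_chainClass_one, map_sub,
      coneMap_liftPoint, coneMap_liftPoint, hs, edge_eq_smul_loopClass_add φ w,
      add_sub_cancel_right]
  rw [SetLike.mem_coe, Submodule.mem_comap, hD, ← map_smul]
  exact Submodule.mem_map_of_mem (Submodule.smul_mem _ _ (Submodule.subset_span ⟨_, rfl⟩))

theorem span_loopClass_eq_top [PathConnectedSpace X] (φ : H1 X x₀ →* G) :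
    Submodule.span R (range (loopClass φ)) = ⊤ := by
  classical
  obtain ⟨w, hw⟩ : ∃ w : ∀ x : X, Path x₀ x, w x₀ = Path.refl x₀ :=
    ⟨Function.update (fun x => PathConnectedSpace.somePath x₀ x) x₀ (Path.refl x₀), by simp⟩
  refine eq_top_iff.2 fun x _ => ?_
  induction x using Submodule.Quotient.induction_on with
  | H c =>
    obtain ⟨y, hy, hyc⟩ := mkQ_sub_coneMap_boundary_mem φ w hw c.1
    rw [LinearMap.mem_ker.1 c.2, map_zero, sub_zero] at hyc
    rwa [← homologyToChains_injective _ _ (a₂ := Submodule.Quotient.mk c) hyc]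

end LoopGeneration

/-! ## Linear forms from affine potentials -/

section AffinePotential

variable {X : Type*} [TopologicalSpace X] {x₀ : X} {R : Type*} [CommRing R] {G : Subgroup Rˣ}

/-- A function on the universal cover that is constant along the lifts of paths in `A` and on which
a deck transformation `l` acts by `τ (l γ) = τ l + φ(l) τ γ`, so that its increments along lifted
paths are equivariant. -/
structure AffinePotential (A : Set X) (φ : H1 X x₀ →* G) (N : Type*) [AddCommGroup N]
    [Module R N] where
  toFun : ∀ {x : X}, Path.Homotopic.Quotient x₀ x → N
  map_translate : ∀ (l : Path.Homotopic.Quotient x₀ x₀) {x : X}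
    (γ : Path.Homotopic.Quotient x₀ x), toFun (l.trans γ) = toFun l + weight φ l • toFun γ
  map_trans_of_mem : ∀ {a b : X} (γ : Path.Homotopic.Quotient x₀ a) (p : Path a b),
    (∀ t, p t ∈ A) → toFun (γ.trans (.mk p)) = toFun γ

namespace AffinePotential

variable {A : Set X} {φ : H1 X x₀ →* G} {N : Type*} [AddCommGroup N] [Module R N]
  (τ : AffinePotential A φ N)

theorem toFun_cast {a a' : X} (γ : Path.Homotopic.Quotient x₀ a) (h : a' = a) :
    τ.toFun (γ.cast rfl h) = τ.toFun γ := by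
  subst h
  rw [Path.Homotopic.Quotient.cast_rfl_rfl]

/-- The increment of the potential along lifted `1`-simplices. -/
def increment : Chain A φ 1 →ₗ[R] N :=
  chainLift A φ 1
    (fun s => τ.toFun (s.start.trans (.mk (edgePath s.simplex 0 1))) - τ.toFun s.start)
    (fun l s => by
      have h := trans_assoc' l s.start (.mk (edgePath s.simplex 0 1))
      refine (congrArg (fun γ => τ.toFun γ - τ.toFun (l.trans s.start)) h).trans ?_
      rw [τ.map_translate, τ.map_translate, smul_sub, add_sub_add_left_eq_sub])
    (fun s hs => sub_eq_zero.2 (τ.map_trans_of_mem _ _ fun _ => hs ⟨_, rfl⟩))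

theorem increment_liftPath {a b : X} (γ : Path.Homotopic.Quotient x₀ a) (p : Path a b) :
    τ.increment (chainClass A φ (liftPath γ p)) = τ.toFun (γ.trans (.mk p)) - τ.toFun γ := by
  refine (chainLift_chainClass _ _ _ _ _ _).trans ?_
  exact congrArg₂ (· - ·)
    ((congrArg τ.toFun (liftPath_start_trans γ p)).trans (τ.toFun_cast _ _)) (τ.toFun_cast γ _)

theorem increment_boundary (c : Chain A φ 2) : τ.increment (boundary A φ 1 c) = 0 := by
  suffices h : Submodule.span R (range (chainClass A φ (n := 2))) ≤
      LinearMap.ker (τ.increment ∘ₗ boundary A φ 1) by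
    rw [span_chainClass] at h
    exact h Submodule.mem_top
  refine Submodule.span_le.2 ?_
  rintro _ ⟨s, rfl⟩
  rw [SetLike.mem_coe, LinearMap.mem_ker, LinearMap.comp_apply, boundary_chainClass_two, map_add,
    map_sub, increment_liftPath, increment_liftPath, increment_liftPath,
    Path.Homotopic.Quotient.trans_assoc, mk_edgePath_trans]
  abel

/-- The increment of the potential, as a linear map on chains modulo boundaries. -/
def form : ChainModBoundaries A φ →ₗ[R] N :=
  Submodule.liftQ _ τ.increment <| by
    rintro _ ⟨c, rfl⟩
    exact τ.increment_boundary c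

theorem form_edge {a b : X} (γ : Path.Homotopic.Quotient x₀ a) (p : Path a b) :
    τ.form (edge A φ γ p) = τ.toFun (γ.trans (.mk p)) - τ.toFun γ :=
  τ.increment_liftPath γ p

end AffinePotential

end AffinePotential

/-! ## Subdivision of paths -/

section Subdivision

open unitInterval

variable {Y Z : Type*} [TopologicalSpace Y] [TopologicalSpace Z]

theorem mk_eq_mk_of_factor [SimplyConnectedSpace Z] (c : C(Z, Y)) {a b : Y} (p p' : Path a b)
    (u u' : C(I, Z)) (hp : ∀ t, p t = c (u t)) (hp' : ∀ t, p' t = c (u' t)) (h0 : u 0 = u' 0)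
    (h1 : u 1 = u' 1) : Path.Homotopic.Quotient.mk p = .mk p' := by
  obtain rfl : a = c (u 0) := by rw [← p.source, hp]
  obtain rfl : b = c (u 1) := by rw [← p.target, hp]
  let γ : Path (u 0) (u 1) := ⟨u, rfl, rfl⟩
  let γ' : Path (u 0) (u 1) := ⟨u', h0.symm, h1.symm⟩
  obtain rfl : p = γ.map c.continuous := Path.ext (funext hp)
  obtain rfl : p' = γ'.map c.continuous := Path.ext (funext hp')
  exact Path.Homotopic.Quotient.eq.2 ((SimplyConnectedSpace.paths_homotopic γ γ').map c)

theorem exists_subpath_apply_eq {a b : Y} (p : Path a b) {s t : I} (h : s ≤ t) (r : I) :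
    ∃ u ∈ Icc s t, p.subpath s t r = p u := by
  have hr : p.subpath s t r ∈ range (p.subpath s t) := ⟨r, rfl⟩
  rw [Path.range_subpath_of_le _ _ _ h] at hr
  obtain ⟨u, hu, hur⟩ := hr
  exact ⟨u, hu, hur.symm⟩

theorem homotopic_cast {a b a' b' : Y} {p q : Path a b} (h : p.Homotopic q) (ha : a' = a)
    (hb : b' = b) : (p.cast ha hb).Homotopic (q.cast ha hb) := by
  subst ha hb
  exact h

theorem mk_eq_trans_subpath {a b : Y} (p : Path a b) (s t : I) :
    Path.Homotopic.Quotient.mk p =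
      ((Path.Homotopic.Quotient.mk ((p.subpath 0 s).cast p.source.symm rfl)).trans
        (.mk (p.subpath s t))).trans (.mk ((p.subpath t 1).cast rfl p.target.symm)) := by
  rw [← Path.Homotopic.Quotient.mk_trans, ← Path.Homotopic.Quotient.mk_trans]
  have h : (p.subpath 0 1).Homotopic
      (((p.subpath 0 s).trans (p.subpath s t)).trans (p.subpath t 1)) :=
    (Path.Homotopic.hcomp ⟨Path.Homotopy.subpathTransSubpath p 0 s t⟩ (.refl _)).trans
      ⟨Path.Homotopy.subpathTransSubpath p 0 t 1⟩ |>.symm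
  rw [Path.subpath_zero_one] at h
  exact Path.Homotopic.Quotient.eq.2 (homotopic_cast h p.source.symm p.target.symm)

theorem mk_eq_trans_cast_subpath {a b y z : Y} (p : Path a b) {s t : I} (hy : y = p s)
    (hz : z = p t) : Path.Homotopic.Quotient.mk p =
      ((Path.Homotopic.Quotient.mk ((p.subpath 0 s).cast p.source.symm hy)).trans
        (.mk ((p.subpath s t).cast hy hz))).trans
          (.mk ((p.subpath t 1).cast hz p.target.symm)) := by
  subst hy hz
  exact mk_eq_trans_subpath p s t

/-- The parameter `1 / 4`. -/
def quarter : I := ⟨1 / 4, by norm_num, by norm_num⟩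

/-- The parameter `3 / 4`. -/
def threeQuarters : I := ⟨3 / 4, by norm_num, by norm_num⟩

theorem quarter_le_threeQuarters : quarter ≤ threeQuarters :=
  Subtype.mk_le_mk.2 (by norm_num)

theorem cos_nonneg_of_le_quarter {s : I} (hs : s ≤ quarter) : 0 ≤ Real.cos (2 * Real.pi * s) := by
  have := Real.pi_pos
  have h0 := s.2.1
  have h1 : (s : ℝ) ≤ 1 / 4 := hs
  refine Real.cos_nonneg_of_mem_Icc ⟨?_, ?_⟩ <;> nlinarith

theorem cos_nonneg_of_threeQuarters_le {s : I} (hs : threeQuarters ≤ s) :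
    0 ≤ Real.cos (2 * Real.pi * s) := by
  have := Real.pi_pos
  have h0 : 3 / 4 ≤ (s : ℝ) := hs
  have h1 := s.2.2
  rw [← Real.cos_sub_two_pi]
  refine Real.cos_nonneg_of_mem_Icc ⟨?_, ?_⟩ <;> nlinarith

theorem cos_nonpos_of_mem_middle {s : I} (hs : s ∈ Icc quarter threeQuarters) :
    Real.cos (2 * Real.pi * s) ≤ 0 := by
  have := Real.pi_pos
  have h0 : 1 / 4 ≤ (s : ℝ) := hs.1
  have h1 : (s : ℝ) ≤ 3 / 4 := hs.2
  refine Real.cos_nonpos_of_pi_div_two_le_of_le ?_ ?_ <;> nlinarith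

theorem sin_quarter : Real.sin (2 * Real.pi * quarter) = 1 := by
  rw [← Real.sin_pi_div_two]
  congr 1
  simp only [quarter]
  ring

theorem sin_threeQuarters : Real.sin (2 * Real.pi * threeQuarters) = -1 := by
  rw [← Real.sin_pi_div_two, ← Real.sin_add_pi]
  congr 1
  simp only [threeQuarters]
  ring

end Subdivision

/-! ## Holonomy of flat bundles -/

section Holonomy

open Topology unitInterval

variable {Y : Type*} [TopologicalSpace Y]

theorem path_induction_openCover {κ : Type*} (U : κ → Set Y) (hU : ∀ k, IsOpen (U k))
    (hcov : ∀ y, ∃ k, y ∈ U k) (P : ∀ {a b : Y}, Path a b → Prop)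
    (homotopic : ∀ {a b : Y} (p q : Path a b), p.Homotopic q → P p → P q)
    (trans : ∀ {a b c : Y} (p : Path a b) (q : Path b c), P p → P q → P (p.trans q))
    (mem : ∀ k {a b : Y} (p : Path a b), (∀ t, p t ∈ U k) → P p)
    {a b : Y} (p : Path a b) : P p := by
  obtain ⟨t, ht0, htm, ⟨N, hN⟩, ht⟩ := exists_monotone_Icc_subset_open_cover_unitInterval
    (c := fun k => p ⁻¹' U k) (fun k => (hU k).preimage p.continuous)
    (fun s _ => mem_iUnion.2 (hcov (p s)))
  have key : ∀ n, P (p.subpath (t 0) (t n)) := by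
    intro n
    induction n with
    | zero =>
      obtain ⟨k, hk⟩ := hcov (p (t 0))
      refine mem k _ fun s => ?_
      rw [Path.subpath_self]
      exact hk
    | succ n ih =>
      obtain ⟨k, hk⟩ := ht n
      refine homotopic _ _ ⟨Path.Homotopy.subpathTransSubpath p (t 0) (t n) (t (n + 1))⟩
        (trans _ _ ih (mem k _ fun s => ?_))
      obtain ⟨r, hr, hrs⟩ := exists_subpath_apply_eq p (htm n.le_succ) s
      rw [hrs]
      exact hk hr
  have cast : ∀ {a b a' b' : Y} (q : Path a b) (ha : a' = a) (hb : b' = b),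
      P (q.cast ha hb) → P q := by
    rintro a b _ _ q rfl rfl h
    exact h
  have h := key N
  rw [ht0, hN N le_rfl, Path.subpath_zero_one] at h
  exact cast _ _ _ h

/-- A homomorphism from the fundamental groupoid of `Y` to the group `Γ`. -/
structure Holonomy (Y Γ : Type*) [TopologicalSpace Y] [Group Γ] where
  toFun : ∀ {a b : Y}, Path.Homotopic.Quotient a b → Γ
  map_trans : ∀ {a b c : Y} (p : Path.Homotopic.Quotient a b) (q : Path.Homotopic.Quotient b c),
    toFun (p.trans q) = toFun p * toFun q

namespace Holonomy

variable {Γ : Type*} [Group Γ]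

instance : CoeFun (Holonomy Y Γ) fun _ => ∀ {a b : Y}, Path.Homotopic.Quotient a b → Γ :=
  ⟨Holonomy.toFun⟩

theorem map_refl (h : Holonomy Y Γ) (y : Y) : h (.refl y) = 1 := by
  have := h.map_trans (.refl y) (.refl y)
  rwa [Path.Homotopic.Quotient.refl_trans, left_eq_mul] at this

theorem map_symm (h : Holonomy Y Γ) {a b : Y} (p : Path.Homotopic.Quotient a b) :
    h p.symm = (h p)⁻¹ := by
  rw [← mul_eq_one_iff_eq_inv', ← h.map_trans, Path.Homotopic.Quotient.trans_symm, h.map_refl]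

/-- The pullback of a holonomy along a continuous map. -/
def comap {Z : Type*} [TopologicalSpace Z] (h : Holonomy Z Γ) (f : C(Y, Z)) : Holonomy Y Γ where
  toFun p := h (p.map f)
  map_trans p q := by rw [map_trans', h.map_trans]

end Holonomy

/-- An open cover with a `Γ`-valued function on each member, such that any two of these functions
differ by a locally constant factor: a flat principal `Γ`-bundle with a (discontinuous) section. -/
structure FlatGauge (κ Y Γ : Type*) [TopologicalSpace Y] [Group Γ] where
  cover : κ → Set Y
  isOpen_cover : ∀ k, IsOpen (cover k)
  exists_mem_cover : ∀ y, ∃ k, y ∈ cover k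
  gauge : κ → Y → Γ
  eventually_eq : ∀ i j, ∀ x ∈ cover i ∩ cover j,
    ∀ᶠ y in 𝓝 x, (gauge i y)⁻¹ * gauge j y = (gauge i x)⁻¹ * gauge j x

namespace FlatGauge

variable {κ Γ : Type*} [Group Γ] (w : FlatGauge κ Y Γ)

/-- The index of a chart at a point. -/
def indexAt (y : Y) : κ :=
  (w.exists_mem_cover y).choose

section Bundle

variable [TopologicalSpace Γ] [DiscreteTopology Γ]

/-- The bundle of a flat gauge, with fibre the discrete group `Γ`. -/
def bundleCore : FiberBundleCore κ Y Γ where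
  baseSet := w.cover
  isOpen_baseSet := w.isOpen_cover
  indexAt := w.indexAt
  mem_baseSet_at y := (w.exists_mem_cover y).choose_spec
  coordChange i j x v := v * ((w.gauge i x)⁻¹ * w.gauge j x)
  coordChange_self i x _ v := by rw [inv_mul_cancel, mul_one]
  continuousOn_coordChange i j := by
    rintro ⟨x, v⟩ ⟨hx, -⟩
    refine ContinuousAt.continuousWithinAt (continuousAt_prod_of_discrete_right.2 ?_)
    refine (continuousAt_const (y := v * ((w.gauge i x)⁻¹ * w.gauge j x))).congr ?_
    filter_upwards [w.eventually_eq i j x hx] with y hy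
    exact congrArg (v * ·) hy.symm
  coordChange_comp i j k x _ v := by group

theorem isCoveringMap_bundleCore : IsCoveringMap w.bundleCore.proj :=
  FiberBundle.isCoveringMap

theorem monodromy_mk_of_mem (k : κ) {a b : Y} (p : Path a b) (hp : ∀ t, p t ∈ w.cover k) (v : Γ) :
    w.isCoveringMap_bundleCore.monodromy (.mk p) ⟨⟨a, v⟩, rfl⟩ =
      ⟨⟨b, v * ((w.gauge (w.indexAt a) a)⁻¹ * w.gauge k a) *
        ((w.gauge k b)⁻¹ * w.gauge (w.indexAt b) b)⟩, rfl⟩ := by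
  let u : Γ := v * ((w.gauge (w.indexAt a) a)⁻¹ * w.gauge k a)
  let f : I → w.bundleCore.TotalSpace := fun t =>
    (w.bundleCore.localTriv k).toOpenPartialHomeomorph.symm (p t, u)
  have hf : Continuous f :=
    (w.bundleCore.localTriv k).toOpenPartialHomeomorph.continuousOn_symm.comp_continuous
      (p.continuous.prodMk continuous_const)
      fun t => (w.bundleCore.mem_localTriv_target k _).2 (hp t)
  have hval : ∀ t x, p t = x →
      f t = ⟨x, u * ((w.gauge k x)⁻¹ * w.gauge (w.indexAt x) x)⟩ := by
    rintro t _ rfl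
    rfl
  have hu : u * ((w.gauge k a)⁻¹ * w.gauge (w.indexAt a) a) = v := by
    simp only [u]
    group
  let lift : Path (⟨a, v⟩ : w.bundleCore.TotalSpace)
      (⟨b, u * ((w.gauge k b)⁻¹ * w.gauge (w.indexAt b) b)⟩ : w.bundleCore.TotalSpace) :=
    { toFun := f
      continuous_toFun := hf
      source' := by
        rw [hval 0 a p.source, hu]
      target' := hval 1 b p.target }
  exact w.isCoveringMap_bundleCore.monodromy_map (.mk lift)

theorem exists_monodromy_eq_mul {a b : Y} (p : Path.Homotopic.Quotient a b) :
    ∃ m : Γ, ∀ v : Γ, w.isCoveringMap_bundleCore.monodromy p ⟨⟨a, v⟩, rfl⟩ =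
      ⟨⟨b, v * m⟩, rfl⟩ := by
  induction p using Path.Homotopic.Quotient.ind with
  | mk p =>
    refine path_induction_openCover w.cover w.isOpen_cover w.exists_mem_cover
      (fun {a b} p => ∃ m : Γ, ∀ v : Γ,
        w.isCoveringMap_bundleCore.monodromy (.mk p) ⟨⟨a, v⟩, rfl⟩ = ⟨⟨b, v * m⟩, rfl⟩) ?_ ?_ ?_ p
    · intro a b p q h hp
      rwa [← Path.Homotopic.Quotient.eq.2 h]
    · rintro a b c p q ⟨m, hm⟩ ⟨m', hm'⟩
      refine ⟨m * m', fun v => ?_⟩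
      rw [Path.Homotopic.Quotient.mk_trans, w.isCoveringMap_bundleCore.monodromy_trans_apply, hm,
        hm', mul_assoc]
    · intro k a b p hp
      exact ⟨_, fun v => (w.monodromy_mk_of_mem k p hp v).trans (by rw [mul_assoc])⟩

end Bundle

theorem exists_holonomy :
    ∃ h : Holonomy Y Γ, ∀ (k : κ) {a b : Y} (p : Path a b), (∀ t, p t ∈ w.cover k) →
      h (.mk p) = w.gauge k a * (w.gauge k b)⁻¹ := by
  let _ : TopologicalSpace Γ := ⊥
  have _ : DiscreteTopology Γ := ⟨rfl⟩
  choose m hm using @exists_monodromy_eq_mul _ _ _ _ _ w _ _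
  have m_eq : ∀ {a b : Y} (p : Path.Homotopic.Quotient a b) (n : Γ),
      w.isCoveringMap_bundleCore.monodromy p ⟨⟨a, (1 : Γ)⟩, rfl⟩ = ⟨⟨b, n⟩, rfl⟩ → m p = n := by
    intro a b p n h
    rw [hm p 1, one_mul] at h
    exact eq_of_heq (Bundle.TotalSpace.mk.inj (congrArg Subtype.val h)).2
  have m_trans : ∀ {a b c : Y} (p : Path.Homotopic.Quotient a b)
      (q : Path.Homotopic.Quotient b c), m (p.trans q) = m p * m q := fun p q =>
    m_eq _ _ (by rw [w.isCoveringMap_bundleCore.monodromy_trans_apply, hm p, hm q, one_mul])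
  -- Conjugating by the gauge at the endpoints removes the dependence on the chosen charts.
  refine ⟨⟨fun {a b} p => w.gauge (w.indexAt a) a * m p * (w.gauge (w.indexAt b) b)⁻¹,
    fun p q => by rw [m_trans]; group⟩, fun k a b p hp => ?_⟩
  change _ * m _ * _ = _
  rw [m_eq _ _ (w.monodromy_mk_of_mem k p hp 1)]
  group

end FlatGauge

end Holonomy

/-! ## Wedges of circles -/

section Wedge

open Topology unitInterval

variable {ι : Type*}

/-- The wedge of circles indexed by `ι`, inside the product. -/
def Wedge (ι : Type*) : Type _ :=
  {θ : ι → Circle // ∀ i j, i ≠ j → θ i = 1 ∨ θ j = 1}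

namespace Wedge

instance : TopologicalSpace (Wedge ι) := instTopologicalSpaceSubtype

instance : One (Wedge ι) := ⟨⟨fun _ => 1, fun _ _ _ => Or.inl rfl⟩⟩

theorem continuous_coord (i : ι) : Continuous fun θ : Wedge ι => θ.1 i :=
  (continuous_apply i).comp continuous_subtype_val

/-- The inclusion of the `i`-th circle of the wedge. -/
def incl [DecidableEq ι] (i : ι) : C(Circle, Wedge ι) where
  toFun u := ⟨Pi.mulSingle (M := fun _ => Circle) i u, fun j k hjk => by
    by_cases h : j = i
    · right
      rw [Pi.mulSingle_eq_of_ne (by rintro rfl; exact hjk h)]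
    · left
      rw [Pi.mulSingle_eq_of_ne h]⟩
  continuous_toFun := Continuous.subtype_mk (continuous_mulSingle (A := fun _ => Circle) i) _

theorem incl_one [DecidableEq ι] (i : ι) : incl i 1 = 1 :=
  Subtype.ext (Pi.mulSingle_one (M := fun _ => Circle) i)

theorem incl_same [DecidableEq ι] (i : ι) (u : Circle) : (incl i u).1 i = u :=
  Pi.mulSingle_eq_same (M := fun _ => Circle) i u

theorem incl_of_ne [DecidableEq ι] {i j : ι} (h : j ≠ i) (u : Circle) : (incl i u).1 j = 1 :=
  Pi.mulSingle_eq_of_ne (M := fun _ => Circle) h u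

end Wedge

theorem circle_im_ne_zero {z : Circle} (h : z ≠ 1) (h' : z ≠ -1) : (z : ℂ).im ≠ 0 := by
  intro h0
  have hz : Complex.normSq z = 1 := by rw [Complex.normSq_eq_norm_sq, Circle.norm_coe, one_pow]
  rw [Complex.normSq_apply, h0, mul_zero, add_zero, mul_self_eq_one_iff] at hz
  rcases hz with hz | hz
  · exact h (Circle.ext (Complex.ext (by simp [hz]) (by simp [h0])))
  · exact h' (Circle.ext (Complex.ext (by simp [hz]) (by simp [h0])))

theorem circle_one_ne_neg_one : (1 : Circle) ≠ -1 :=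
  (Circle.neg_ne_self 1).symm

theorem circle_ne_neg_one_of_re_nonneg {z : Circle} (h : 0 ≤ (z : ℂ).re) : z ≠ -1 := by
  rintro rfl
  norm_num at h

theorem circle_ne_one_of_re_nonpos {z : Circle} (h : (z : ℂ).re ≤ 0) : z ≠ 1 := by
  rintro rfl
  norm_num at h

variable {Γ : Type*} [Group Γ]

/-- The function on the `i`-th circle which jumps at the point `-1`. -/
def lowerHalfValue (γ : ι → Γ) (i : ι) (θ : Wedge ι) : Γ :=
  if (θ.1 i : ℂ).im < 0 then (γ i)⁻¹ else 1

theorem eventually_lowerHalfValue_eq (γ : ι → Γ) {i : ι} {θ : Wedge ι} (h : θ.1 i ≠ 1)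
    (h' : θ.1 i ≠ -1) : ∀ᶠ y in 𝓝 θ, lowerHalfValue γ i y = lowerHalfValue γ i θ := by
  have hc : Continuous fun θ : Wedge ι => (θ.1 i : ℂ).im :=
    Complex.continuous_im.comp (continuous_subtype_val.comp (Wedge.continuous_coord i))
  rcases (circle_im_ne_zero h h').lt_or_gt with h0 | h0
  · filter_upwards [(isOpen_lt hc continuous_const).mem_nhds h0] with y hy
    exact (if_pos hy).trans (if_pos h0).symm
  · filter_upwards [(isOpen_lt continuous_const hc).mem_nhds h0] with y hy
    exact (if_neg (lt_asymm hy)).trans (if_neg (lt_asymm h0)).symm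

/-- The flat bundle on a wedge of circles with monodromy `γ i` around the `i`-th circle, trivialized
away from the antipodes of the wedge point and on each circle minus the wedge point. -/
def wedgeGauge [Finite ι] (γ : ι → Γ) : FlatGauge (Option ι) (Wedge ι) Γ where
  cover
    | none => {θ | ∀ i, θ.1 i ≠ -1}
    | some i => {θ | θ.1 i ≠ 1}
  isOpen_cover
    | none => by
      simp only [ofPred_forall]
      exact isOpen_iInter_of_finite fun i =>
        isOpen_ne_fun (Wedge.continuous_coord i) continuous_const
    | some i => isOpen_ne_fun (Wedge.continuous_coord i) continuous_const
  exists_mem_cover θ := by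
    by_cases h : ∃ i, θ.1 i ≠ 1
    · obtain ⟨i, hi⟩ := h
      exact ⟨some i, hi⟩
    · push Not at h
      exact ⟨none, fun i => (h i).trans_ne circle_one_ne_neg_one⟩
  gauge
    | none => 1
    | some i => lowerHalfValue γ i
  eventually_eq
    | none, none => fun _ _ => .of_forall fun _ => rfl
    | none, some i => by
      rintro θ ⟨h, h'⟩
      filter_upwards [eventually_lowerHalfValue_eq γ h' (h i)] with y hy
      rw [hy]
      rfl
    | some i, none => by
      rintro θ ⟨h, h'⟩
      filter_upwards [eventually_lowerHalfValue_eq γ h (h' i)] with y hy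
      rw [hy]
      rfl
    | some i, some j => by
      rintro θ ⟨h, h'⟩
      obtain rfl : i = j := by
        by_contra hij
        exact (θ.2 i j hij).elim h h'
      simp only [inv_mul_cancel, Filter.eventually_true]

theorem exists_wedge_holonomy [Finite ι] [DecidableEq ι] (γ : ι → Γ) :
    ∃ h : Holonomy (Wedge ι) Γ, (∀ {a b : Wedge ι} (p : Path a b), (∀ t, p t = 1) → h (.mk p) = 1) ∧
      ∀ {a b : Wedge ι} (p : Path a b) (i : ι),
        (∀ t : I, p t = Wedge.incl i (Circle.exp (2 * Real.pi * t))) → h (.mk p) = γ i := by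
  obtain ⟨h, hh⟩ := (wedgeGauge γ).exists_holonomy
  have h_one : ∀ {a b : Wedge ι} (p : Path a b), (∀ t i, (p t).1 i ≠ -1) → h (.mk p) = 1 :=
    fun p hp => (hh none p hp).trans (mul_inv_cancel _)
  refine ⟨h, fun p hp => h_one p fun t i => ?_, fun {a b} p i hp => ?_⟩
  · rw [hp]
    exact circle_one_ne_neg_one
  have hre : ∀ t, ((p t).1 i : ℂ).re = Real.cos (2 * Real.pi * t) := fun t => by
    rw [hp, Wedge.incl_same, Circle.coe_exp, Complex.exp_ofReal_mul_I_re]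
  have him : ∀ t, ((p t).1 i : ℂ).im = Real.sin (2 * Real.pi * t) := fun t => by
    rw [hp, Wedge.incl_same, Circle.coe_exp, Complex.exp_ofReal_mul_I_im]
  have near_one : ∀ t : I, 0 ≤ Real.cos (2 * Real.pi * t) → ∀ j, (p t).1 j ≠ -1 := by
    intro t ht j
    by_cases hj : j = i
    · subst hj
      exact circle_ne_neg_one_of_re_nonneg ((hre t).symm ▸ ht)
    · rw [hp, Wedge.incl_of_ne hj]
      exact circle_one_ne_neg_one
  have first : h (.mk ((p.subpath 0 quarter).cast p.source.symm rfl)) = 1 := by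
    refine h_one _ fun t => ?_
    obtain ⟨u, hu, hut⟩ := exists_subpath_apply_eq p (s := 0) (t := quarter) quarter.2.1 t
    exact fun j => hut.symm ▸ near_one u (cos_nonneg_of_le_quarter hu.2) j
  have last : h (.mk ((p.subpath threeQuarters 1).cast rfl p.target.symm)) = 1 := by
    refine h_one _ fun t => ?_
    obtain ⟨u, hu, hut⟩ :=
      exists_subpath_apply_eq p (s := threeQuarters) (t := 1) threeQuarters.2.2 t
    exact fun j => hut.symm ▸ near_one u (cos_nonneg_of_threeQuarters_le hu.1) j
  have middle : h (.mk (p.subpath quarter threeQuarters)) = γ i := by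
    refine (hh (some i) _ fun t => ?_).trans ?_
    · obtain ⟨u, hu, hut⟩ := exists_subpath_apply_eq p quarter_le_threeQuarters t
      exact hut.symm ▸ circle_ne_one_of_re_nonpos ((hre u).trans_le (cos_nonpos_of_mem_middle hu))
    · change lowerHalfValue γ i (p quarter) * (lowerHalfValue γ i (p threeQuarters))⁻¹ = γ i
      rw [lowerHalfValue, lowerHalfValue, him, him, sin_quarter, sin_threeQuarters,
        if_neg (by norm_num), if_pos (by norm_num), inv_inv, one_mul]
  rw [mk_eq_trans_subpath p quarter threeQuarters, h.map_trans, h.map_trans, first, middle, last,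
    one_mul, mul_one]

end Wedge

/-! ## Attaching handles -/

section Square

open unitInterval

variable {Y Z : Type*} [TopologicalSpace Y] [TopologicalSpace Z]

theorem trans_apply_of_factor (c : Z → Y) {y₀ y₁ y₂ : Y} (p : Path y₀ y₁) (q : Path y₁ y₂)
    {z₀ z₁ z₂ : Z} (u : Path z₀ z₁) (v : Path z₁ z₂) (hp : ∀ t, p t = c (u t))
    (hq : ∀ t, q t = c (v t)) (t : I) : (p.trans q) t = c ((u.trans v) t) := by
  simp only [Path.trans_apply]
  split_ifs
  · exact hp _
  · exact hq _

instance : ContractibleSpace I := (convex_Icc (0 : ℝ) 1).contractibleSpace ⟨0, by simp⟩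

theorem mk_trans_eq_of_square (F : C(I × I, Y)) {a b c d : Y} (p : Path a b) (v : Path b d)
    (u : Path a c) (q : Path c d) (hp : ∀ t, p t = F (0, t)) (hv : ∀ s, v s = F (s, 1))
    (hu : ∀ s, u s = F (s, 0)) (hq : ∀ t, q t = F (1, t)) :
    (Path.Homotopic.Quotient.mk p).trans (.mk v) =
      (Path.Homotopic.Quotient.mk u).trans (.mk q) := by
  let x : Path (0 : I) 1 := ⟨ContinuousMap.id _, rfl, rfl⟩
  let γ := ((Path.refl (0 : I)).prod x).trans (x.prod (Path.refl (1 : I)))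
  let γ' := (x.prod (Path.refl (0 : I))).trans ((Path.refl (1 : I)).prod x)
  rw [← Path.Homotopic.Quotient.mk_trans, ← Path.Homotopic.Quotient.mk_trans]
  exact mk_eq_mk_of_factor F _ _ γ.toContinuousMap γ'.toContinuousMap
    (trans_apply_of_factor F p v _ _ hp hv) (trans_apply_of_factor F u q _ _ hu hq)
    (γ.source.trans γ'.source.symm) (γ.target.trans γ'.target.symm)

end Square

section Handles

open Topology unitInterval Metric

section Ball

variable {E T : Type*} [NormedAddCommGroup E] [TopologicalSpace T]

/-- The inclusion of the attaching region `∂D × T` of a handle `D × T`, where `D` is the unit ball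
of `E`. -/
def rim : C(sphere (0 : E) 1 × T, closedBall (0 : E) 1 × T) where
  toFun u := (⟨u.1, sphere_subset_closedBall u.1.2⟩, u.2)

theorem exists_rim_eq {z : closedBall (0 : E) 1 × T} (hz : ‖(z.1 : E)‖ = 1) : ∃ u, rim u = z :=
  ⟨(⟨z.1, mem_sphere_zero_iff_norm.2 hz⟩, z.2), rfl⟩

theorem norm_rim (u : sphere (0 : E) 1 × T) : ‖((rim u).1 : E)‖ = 1 :=
  mem_sphere_zero_iff_norm.1 u.1.2

variable [NormedSpace ℝ E]

instance : ContractibleSpace (closedBall (0 : E) 1) :=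
  (convex_closedBall (0 : E) 1).contractibleSpace ⟨0, by simp⟩

/-- The radial projection of the punctured unit ball to the unit sphere. -/
def toSphere (z : closedBall (0 : E) 1) (hz : ‖(z : E)‖ ≠ 0) : sphere (0 : E) 1 :=
  ⟨‖(z : E)‖⁻¹ • (z : E), by simp [norm_smul, hz]⟩

/-- The radial push of the unit ball that is the radial retraction outside of the ball of
radius `1 / 2` at time `1`. -/
def push : C(I × closedBall (0 : E) 1, closedBall (0 : E) 1) where
  toFun x := ⟨(max ‖(x.2 : E)‖ (1 + (x.1 : ℝ))⁻¹)⁻¹ • (x.2 : E), by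
    have h0 : 0 < (1 + (x.1 : ℝ))⁻¹ := inv_pos.2 (by linarith [x.1.2.1])
    rw [mem_closedBall_zero_iff, norm_smul, norm_inv, Real.norm_of_nonneg (by positivity),
      inv_mul_le_one₀ (lt_max_of_lt_right h0)]
    exact le_max_left _ _⟩
  continuous_toFun := by
    refine Continuous.subtype_mk (Continuous.smul (Continuous.inv₀ (Continuous.max (by fun_prop)
      (Continuous.inv₀ (by fun_prop) fun x => ?_)) fun x => ?_) (by fun_prop)) _
    · have := x.1.2.1
      positivity
    · have : 0 < (1 + (x.1 : ℝ))⁻¹ := inv_pos.2 (by linarith [x.1.2.1])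
      positivity

theorem push_zero (z : closedBall (0 : E) 1) : push (0, z) = z := by
  ext
  have := mem_closedBall_zero_iff.1 z.2
  simp [push, this]

theorem push_of_norm_eq_one (s : I) (z : closedBall (0 : E) 1) (hz : ‖(z : E)‖ = 1) :
    push (s, z) = z := by
  ext
  have : (1 + (s : ℝ))⁻¹ ≤ 1 := inv_le_one_of_one_le₀ (by linarith [s.2.1])
  simp [push, hz, this]

theorem push_one (z : closedBall (0 : E) 1) (hz : 1 / 2 ≤ ‖(z : E)‖) (hz' : ‖(z : E)‖ ≠ 0) :
    (push (1, z) : E) = toSphere z hz' := by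
  have : (1 + ((1 : I) : ℝ))⁻¹ ≤ ‖(z : E)‖ := by norm_num at hz ⊢; exact hz
  simp only [push, toSphere, ContinuousMap.coe_mk]
  rw [max_eq_left this]

end Ball

variable {X Y ι E T : Type*} [TopologicalSpace X] [TopologicalSpace Y] [TopologicalSpace ι]
  [NormedAddCommGroup E] [TopologicalSpace T]

/-- `Y` is obtained from `X` by attaching the handles `{i} × D × T`, where `D` is the unit ball of
`E`, along the maps `f` from `{i} × ∂D × T` to `X`. -/
structure IsHandleAttachment (j : C(X, Y)) (k : C(ι × closedBall (0 : E) 1 × T, Y))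
    (f : C(ι × sphere (0 : E) 1 × T, X)) : Prop where
  isQuotientMap : IsQuotientMap (Sum.elim j k)
  glue : ∀ i u, k (i, rim u) = j (f (i, u))
  injective : Function.Injective j
  norm_eq_one : ∀ x z, k z = j x → ‖(z.2.1 : E)‖ = 1
  injective_of_norm_lt : ∀ z z', ‖(z.2.1 : E)‖ < 1 → k z = k z' → z = z'

namespace IsHandleAttachment

variable {j : C(X, Y)} {k : C(ι × closedBall (0 : E) 1 × T, Y)}
  {f : C(ι × sphere (0 : E) 1 × T, X)}

theorem surj (h : IsHandleAttachment j k f) (y : Y) : (∃ x, j x = y) ∨ ∃ z, k z = y := by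
  obtain ⟨x | z, rfl⟩ := h.isQuotientMap.surjective y
  exacts [Or.inl ⟨x, rfl⟩, Or.inr ⟨z, rfl⟩]

theorem exists_eq_of_handle_eq (h : IsHandleAttachment j k f) {i : ι}
    {z : closedBall (0 : E) 1 × T} {x : X} (hzx : k (i, z) = j x) :
    ∃ u, rim u = z ∧ f (i, u) = x := by
  obtain ⟨u, rfl⟩ := exists_rim_eq (h.norm_eq_one x (i, z) hzx)
  exact ⟨u, rfl, h.injective ((h.glue i u).symm.trans hzx)⟩

theorem factorsThrough (h : IsHandleAttachment j k f) {Z : Type*} {G₀ : X → Z}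
    {G₁ : ι × closedBall (0 : E) 1 × T → Z} (hG : ∀ i u, G₁ (i, rim u) = G₀ (f (i, u))) :
    (Sum.elim G₀ G₁).FactorsThrough (Sum.elim j k) := by
  have overlap : ∀ z x, k z = j x → G₁ z = G₀ x := by
    rintro ⟨i, z⟩ x hzx
    obtain ⟨u, rfl, rfl⟩ := h.exists_eq_of_handle_eq hzx
    exact hG i u
  rintro (x | z) (x' | ⟨i, z'⟩) hq
  · rw [h.injective hq]
  · exact (overlap _ x hq.symm).symm
  · exact overlap z x' hq
  · have hq' : k z = k (i, z') := hq
    rcases lt_or_eq_of_le (mem_closedBall_zero_iff.1 z.2.1.2) with hz | hz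
    · rw [h.injective_of_norm_lt z _ hz hq']
    · obtain ⟨i', z⟩ := z
      obtain ⟨u, rfl⟩ := exists_rim_eq hz
      have hz' : k (i, z') = j (f (i', u)) := hq'.symm.trans (h.glue i' u)
      exact (hG i' u).trans (overlap _ _ hz').symm

/-- The map on `Y` glued from maps on `X` and on the handles; it is meaningful when these agree on
the attaching regions. -/
def lift (h : IsHandleAttachment j k f) {Z : Type*} (G₀ : X → Z)
    (G₁ : ι × closedBall (0 : E) 1 × T → Z) (y : Y) : Z :=
  Sum.elim G₀ G₁ (Function.surjInv h.isQuotientMap.surjective y)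

theorem lift_base (h : IsHandleAttachment j k f) {Z : Type*} {G₀ : X → Z}
    {G₁ : ι × closedBall (0 : E) 1 × T → Z} (hG : ∀ i u, G₁ (i, rim u) = G₀ (f (i, u))) (x : X) :
    h.lift G₀ G₁ (j x) = G₀ x :=
  h.factorsThrough hG (b := .inl x) (Function.surjInv_eq h.isQuotientMap.surjective (j x))

theorem lift_handle (h : IsHandleAttachment j k f) {Z : Type*} {G₀ : X → Z}
    {G₁ : ι × closedBall (0 : E) 1 × T → Z} (hG : ∀ i u, G₁ (i, rim u) = G₀ (f (i, u)))
    (z : ι × closedBall (0 : E) 1 × T) : h.lift G₀ G₁ (k z) = G₁ z :=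
  h.factorsThrough hG (b := .inr z) (Function.surjInv_eq h.isQuotientMap.surjective (k z))

theorem continuousOn (h : IsHandleAttachment j k f) {Z : Type*} [TopologicalSpace Z] {G : Y → Z}
    {s : Set Y} (hs : IsOpen s)
    (h₀ : ContinuousOn (fun x => G (j x)) (j ⁻¹' s))
    (h₁ : ContinuousOn (fun z => G (k z)) (k ⁻¹' s)) : ContinuousOn G s := by
  rw [h.isQuotientMap.continuousOn_isOpen_iff hs]
  rintro (x | z) hx
  · exact (IsOpenEmbedding.inl.continuousAt_iff.1
      (h₀.continuousAt ((hs.preimage j.continuous).mem_nhds hx))).continuousWithinAt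
  · exact (IsOpenEmbedding.inr.continuousAt_iff.1
      (h₁.continuousAt ((hs.preimage k.continuous).mem_nhds hx))).continuousWithinAt

theorem continuous (h : IsHandleAttachment j k f) {Z : Type*} [TopologicalSpace Z] {G : Y → Z}
    (h₀ : Continuous fun x => G (j x)) (h₁ : Continuous fun z => G (k z)) : Continuous G := by
  rw [h.isQuotientMap.continuous_iff]
  exact continuous_sum_dom.2 ⟨h₀, h₁⟩

/-- The distance to the center of the handle, extended by `1` to `X`. -/
def radius (h : IsHandleAttachment j k f) : Y → ℝ :=
  h.lift (fun _ => 1) fun z => ‖(z.2.1 : E)‖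

theorem radius_base (h : IsHandleAttachment j k f) (x : X) : h.radius (j x) = 1 :=
  h.lift_base (fun _ u => norm_rim u) x

theorem radius_handle (h : IsHandleAttachment j k f) (z : ι × closedBall (0 : E) 1 × T) :
    h.radius (k z) = ‖(z.2.1 : E)‖ :=
  h.lift_handle (fun _ u => norm_rim u) z

theorem continuous_radius (h : IsHandleAttachment j k f) : Continuous h.radius :=
  h.continuous (by simp only [h.radius_base]; fun_prop) (by simp only [h.radius_handle]; fun_prop)

theorem exists_handle_eq_of_radius_lt (h : IsHandleAttachment j k f) {y : Y}
    (hy : h.radius y < 1) : ∃ z, k z = y := by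
  rcases h.surj y with ⟨x, rfl⟩ | hz
  · exact absurd hy (h.radius_base x).not_lt
  · exact hz

theorem exists_handle_lift (h : IsHandleAttachment j k f) {a b : Y} (p : Path a b)
    (hp : ∀ t, h.radius (p t) < 1) : ∃ q : C(I, ι × closedBall (0 : E) 1 × T), ∀ t,
      p t = k (q t) := by
  classical
  obtain ⟨z₀, -⟩ := h.exists_handle_eq_of_radius_lt (hp 0)
  let κ := h.lift (fun _ => z₀) fun z => if ‖(z.2.1 : E)‖ < 1 then z else z₀
  have κ_rim : ∀ (i : ι) (u : sphere (0 : E) 1 × T),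
      (if ‖((rim u).1 : E)‖ < 1 then (i, rim u) else z₀) = z₀ := fun i u =>
    if_neg (norm_rim u).not_lt
  have κ_handle : ∀ z, h.radius (k z) < 1 → κ (k z) = z := fun z hz =>
    (h.lift_handle κ_rim z).trans (if_pos (h.radius_handle z ▸ hz))
  have hκ : ContinuousOn κ {y | h.radius y < 1} := by
    refine h.continuousOn (isOpen_lt h.continuous_radius continuous_const) ?_
      (continuousOn_id.congr κ_handle)
    exact continuousOn_const.congr fun x _ => h.lift_base κ_rim x
  refine ⟨⟨fun t => κ (p t), hκ.comp_continuous p.continuous hp⟩, fun t => ?_⟩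
  obtain ⟨z, hz⟩ := h.exists_handle_eq_of_radius_lt (hp t)
  change p t = k (κ (p t))
  rw [← hz, κ_handle z (hz ▸ hp t)]

variable [NormedSpace ℝ E]

/-- The radial push of a handle. -/
def pushHandle (z : ι × closedBall (0 : E) 1 × T) : C(I, ι × closedBall (0 : E) 1 × T) where
  toFun s := (z.1, push (s, z.2.1), z.2.2)

/-- The deformation of `Y` that pushes the handles radially outwards. -/
def deformation (h : IsHandleAttachment j k f) : Y → C(I, Y) :=
  h.lift (fun x => ContinuousMap.const I (j x)) fun z => k.comp (pushHandle z)

theorem comp_pushHandle_rim (h : IsHandleAttachment j k f) (i : ι) (u : sphere (0 : E) 1 × T) :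
    k.comp (pushHandle (i, rim u)) = ContinuousMap.const I (j (f (i, u))) := by
  ext s
  rw [ContinuousMap.const_apply, ← h.glue, ContinuousMap.comp_apply]
  exact congrArg (fun z => k (i, z, u.2)) (push_of_norm_eq_one s (rim u).1 (norm_rim u))

theorem deformation_base (h : IsHandleAttachment j k f) (x : X) :
    h.deformation (j x) = ContinuousMap.const I (j x) :=
  h.lift_base h.comp_pushHandle_rim x

theorem deformation_handle (h : IsHandleAttachment j k f) (z : ι × closedBall (0 : E) 1 × T) :
    h.deformation (k z) = k.comp (pushHandle z) :=
  h.lift_handle h.comp_pushHandle_rim z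

theorem continuous_deformation (h : IsHandleAttachment j k f) : Continuous h.deformation := by
  refine h.continuous ?_ ?_
  · simp only [h.deformation_base]
    exact ContinuousMap.continuous_const'.comp j.continuous
  · simp only [h.deformation_handle]
    refine ContinuousMap.continuous_of_continuous_uncurry _ ?_
    simp only [Function.uncurry_def, ContinuousMap.comp_apply, pushHandle, ContinuousMap.coe_mk]
    fun_prop

theorem deformation_zero (h : IsHandleAttachment j k f) (y : Y) : h.deformation y 0 = y := by
  rcases h.surj y with ⟨x, rfl⟩ | ⟨z, rfl⟩
  · rw [h.deformation_base, ContinuousMap.const_apply]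
  · rw [h.deformation_handle, ContinuousMap.comp_apply]
    exact congrArg (fun w => k (z.1, w, z.2.2)) (push_zero z.2.1)

open Classical in
/-- The radial retraction to `X` of the complement of the centers of the handles, with an arbitrary
value at the centers. -/
def retraction [Nonempty X] (h : IsHandleAttachment j k f) : Y → X :=
  h.lift (fun x => x) fun z => if hz : ‖(z.2.1 : E)‖ = 0 then Classical.arbitrary X else
    f (z.1, toSphere z.2.1 hz, z.2.2)

section Retraction

variable [Nonempty X]

theorem retraction_compatible (f : C(ι × sphere (0 : E) 1 × T, X)) (i : ι)
    (u : sphere (0 : E) 1 × T) [Decidable (‖((rim u).1 : E)‖ = 0)] :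
    (if hz : ‖((rim u).1 : E)‖ = 0 then Classical.arbitrary X else
      f (i, toSphere (rim u).1 hz, (rim u).2)) = f (i, u) := by
  rw [dif_neg (by rw [norm_rim]; exact one_ne_zero)]
  congr 2
  refine Prod.ext (Subtype.ext ?_) rfl
  change ‖((rim u).1 : E)‖⁻¹ • ((rim u).1 : E) = u.1
  rw [norm_rim, inv_one, one_smul]
  rfl

theorem retraction_base (h : IsHandleAttachment j k f) (x : X) : h.retraction (j x) = x := by
  classical exact h.lift_base (fun i u => retraction_compatible f i u) x

theorem retraction_handle (h : IsHandleAttachment j k f) (z : ι × closedBall (0 : E) 1 × T)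
    (hz : ‖(z.2.1 : E)‖ ≠ 0) : h.retraction (k z) = f (z.1, toSphere z.2.1 hz, z.2.2) := by
  classical exact (h.lift_handle (fun i u => retraction_compatible f i u) z).trans (dif_neg hz)

theorem continuousOn_retraction (h : IsHandleAttachment j k f) :
    ContinuousOn h.retraction {y | 1 / 2 < h.radius y} := by
  refine h.continuousOn (isOpen_lt continuous_const h.continuous_radius) ?_ ?_
  · simp only [h.retraction_base]
    exact continuousOn_id
  · rw [continuousOn_iff_continuous_domRestrict]
    have norm_ne_zero : ∀ z : k ⁻¹' {y | 1 / 2 < h.radius y}, ‖(z.1.2.1 : E)‖ ≠ 0 := fun z =>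
      ((by norm_num : (0 : ℝ) < 1 / 2).trans ((h.radius_handle z.1) ▸ z.2)).ne'
    have heq : (k ⁻¹' {y | 1 / 2 < h.radius y}).domRestrict (fun z => h.retraction (k z)) =
        fun z => f (z.1.1, toSphere z.1.2.1 (norm_ne_zero z), z.1.2.2) :=
      funext fun z => h.retraction_handle z.1 (norm_ne_zero z)
    rw [heq]
    exact f.continuous.comp (Continuous.prodMk (by fun_prop) (Continuous.prodMk
      (Continuous.subtype_mk (Continuous.smul (Continuous.inv₀ (by fun_prop) norm_ne_zero)
        (by fun_prop)) _) (by fun_prop)))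

theorem deformation_one (h : IsHandleAttachment j k f) {y : Y} (hy : 1 / 2 < h.radius y) :
    h.deformation y 1 = j (h.retraction y) := by
  rcases h.surj y with ⟨x, rfl⟩ | ⟨z, rfl⟩
  · rw [h.deformation_base, h.retraction_base, ContinuousMap.const_apply]
  · rw [h.radius_handle] at hy
    have hz : ‖(z.2.1 : E)‖ ≠ 0 := (one_half_pos.trans hy).ne'
    rw [h.deformation_handle, h.retraction_handle z hz, ← h.glue, ContinuousMap.comp_apply]
    exact congrArg (fun w => k (z.1, w, z.2.2)) (Subtype.ext (push_one z.2.1 hy.le hz))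

/-- The path along which the deformation moves a point outside of the centers of the handles. -/
def deformationPath (h : IsHandleAttachment j k f) {y : Y} (hy : 1 / 2 < h.radius y) :
    Path y (j (h.retraction y)) :=
  ⟨h.deformation y, h.deformation_zero y, h.deformation_one hy⟩

/-- The image under the retraction of a path outside of the centers of the handles. -/
def retractPath (h : IsHandleAttachment j k f) {a b : Y} (p : Path a b)
    (hp : ∀ t, 1 / 2 < h.radius (p t)) : Path (h.retraction a) (h.retraction b) where
  toFun t := h.retraction (p t)
  continuous_toFun := h.continuousOn_retraction.comp_continuous p.continuous hp
  source' := congrArg h.retraction p.source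
  target' := congrArg h.retraction p.target

theorem mk_eq_trans_retractPath (h : IsHandleAttachment j k f) {a b : Y} (p : Path a b)
    (hp : ∀ t, 1 / 2 < h.radius (p t)) (ha : 1 / 2 < h.radius a) (hb : 1 / 2 < h.radius b) :
    Path.Homotopic.Quotient.mk p = .mk (((h.deformationPath ha).trans
      ((h.retractPath p hp).map j.continuous)).trans (h.deformationPath hb).symm) := by
  let F : C(I × I, Y) := ⟨fun x => h.deformation (p x.2) x.1,
    (ContinuousMap.continuous_uncurry_of_continuous
      ⟨fun t => h.deformation (p t), h.continuous_deformation.comp p.continuous⟩).comp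
        continuous_swap⟩
  have square := mk_trans_eq_of_square F p (h.deformationPath hb) (h.deformationPath ha)
    ((h.retractPath p hp).map j.continuous) (fun t => (h.deformation_zero _).symm)
    (fun s => congrArg (fun y => h.deformation y s) p.target.symm)
    (fun s => congrArg (fun y => h.deformation y s) p.source.symm)
    (fun t => (h.deformation_one (hp t)).symm)
  rw [Path.Homotopic.Quotient.mk_trans, Path.Homotopic.Quotient.mk_trans, ← square,
    Path.Homotopic.Quotient.mk_symm, Path.Homotopic.Quotient.trans_assoc,
    Path.Homotopic.Quotient.trans_symm, Path.Homotopic.Quotient.trans_refl]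

end Retraction

theorem path_induction [Nonempty X] (h : IsHandleAttachment j k f)
    (P : ∀ {a b : Y}, Path a b → Prop)
    (homotopic : ∀ {a b : Y} (p q : Path a b), p.Homotopic q → P p → P q)
    (trans : ∀ {a b c : Y} (p : Path a b) (q : Path b c), P p → P q → P (p.trans q))
    (base : ∀ {a b : Y} (p : Path a b) (q : C(I, X)), (∀ t, p t = j (q t)) → P p)
    (handle : ∀ {a b : Y} (p : Path a b) (q : C(I, ι × closedBall (0 : E) 1 × T)),
      (∀ t, p t = k (q t)) → P p)
    {a b : Y} (p : Path a b) : P p := by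
  have of_deformation : ∀ (y : Y) (τ : C(I, I)) {a b : Y} (w : Path a b),
      (∀ s, w s = h.deformation y (τ s)) → P w := by
    intro y τ a b w hw
    rcases h.surj y with ⟨x, rfl⟩ | ⟨z, rfl⟩
    · exact base w (ContinuousMap.const I x) fun s => by rw [hw, h.deformation_base]; rfl
    · exact handle w ((pushHandle z).comp τ) fun s => by rw [hw, h.deformation_handle]; rfl
  refine path_induction_openCover
    (fun i : Bool => cond i {y | 1 / 2 < h.radius y} {y | h.radius y < 1}) ?_ ?_ P
    homotopic trans ?_ p
  · rintro (_ | _)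
    · exact isOpen_lt h.continuous_radius continuous_const
    · exact isOpen_lt continuous_const h.continuous_radius
  · intro y
    rcases lt_or_ge (h.radius y) 1 with hy | hy
    · exact ⟨false, hy⟩
    · exact ⟨true, (by norm_num : (1 / 2 : ℝ) < 1).trans_le hy⟩
  · rintro (_ | _) a b p hp
    · obtain ⟨q, hq⟩ := h.exists_handle_lift p hp
      exact handle p q hq
    · have ha : 1 / 2 < h.radius a := p.source ▸ hp 0
      have hb : 1 / 2 < h.radius b := p.target ▸ hp 1
      refine homotopic _ p
        (Path.Homotopic.Quotient.eq.1 (h.mk_eq_trans_retractPath p hp ha hb).symm)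
        (trans _ _ (trans _ _ (of_deformation a (ContinuousMap.id I) _ fun _ => rfl)
          (base _ (h.retractPath p hp).toContinuousMap fun _ => rfl))
          (of_deformation b ⟨unitInterval.symm, continuous_symm⟩ _ fun _ => rfl))

end IsHandleAttachment

end Handles

/-! ## Generation of the fundamental group after attaching handles -/

section Cosets

variable {Y : Type*} [TopologicalSpace Y] {y₀ : Y}

theorem symm_quotient_trans {a b c : Y} (p : Path.Homotopic.Quotient a b)
    (q : Path.Homotopic.Quotient b c) : (p.trans q).symm = q.symm.trans p.symm := by
  induction p using Path.Homotopic.Quotient.ind with | mk p =>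
  induction q using Path.Homotopic.Quotient.ind with | mk q =>
  simp only [← Path.Homotopic.Quotient.mk_symm, ← Path.Homotopic.Quotient.mk_trans,
    Path.trans_symm]

theorem symm_quotient_symm {a b : Y} (p : Path.Homotopic.Quotient a b) : p.symm.symm = p := by
  induction p using Path.Homotopic.Quotient.ind with | mk p =>
  simp only [← Path.Homotopic.Quotient.mk_symm, Path.symm_symm]

theorem trans_symm_cancel {a b c : Y} (p : Path.Homotopic.Quotient a b)
    (q : Path.Homotopic.Quotient a c) : p.trans (p.symm.trans q) = q := by
  rw [← Path.Homotopic.Quotient.trans_assoc, Path.Homotopic.Quotient.trans_symm,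
    Path.Homotopic.Quotient.refl_trans]

/-- Two classes of paths from `y₀` to the same point differ by an element of the subgroup `S` of the
fundamental group. -/
def SameCoset (S : Subgroup (FundamentalGroup Y y₀)) {y : Y}
    (α β : Path.Homotopic.Quotient y₀ y) : Prop :=
  FundamentalGroup.fromPath (α.trans β.symm) ∈ S

namespace SameCoset

variable {S : Subgroup (FundamentalGroup Y y₀)} {y : Y} {α β γ : Path.Homotopic.Quotient y₀ y}

theorem refl (α : Path.Homotopic.Quotient y₀ y) : SameCoset S α α := by
  rw [SameCoset, Path.Homotopic.Quotient.trans_symm]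
  exact S.one_mem

theorem symm (h : SameCoset S α β) : SameCoset S β α := by
  have hinv : FundamentalGroup.fromPath (β.trans α.symm) =
      (FundamentalGroup.fromPath (α.trans β.symm))⁻¹ := by
    change β.trans α.symm = (α.trans β.symm).symm
    rw [symm_quotient_trans, symm_quotient_symm]
  rw [SameCoset, hinv]
  exact S.inv_mem h

theorem trans (h : SameCoset S α β) (h' : SameCoset S β γ) : SameCoset S α γ := by
  have hmul : FundamentalGroup.fromPath (α.trans γ.symm) =
      FundamentalGroup.fromPath (β.trans γ.symm) * FundamentalGroup.fromPath (α.trans β.symm) := by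
    change α.trans γ.symm = (α.trans β.symm).trans (β.trans γ.symm)
    simp only [Path.Homotopic.Quotient.trans_assoc, symm_trans_cancel]
  rw [SameCoset, hmul]
  exact S.mul_mem h' h

theorem trans_right (h : SameCoset S α β) {y' : Y} (p : Path.Homotopic.Quotient y y') :
    SameCoset S (α.trans p) (β.trans p) := by
  have heq : (α.trans p).trans (β.trans p).symm = α.trans β.symm := by
    rw [symm_quotient_trans, Path.Homotopic.Quotient.trans_assoc, trans_symm_cancel]
  rw [SameCoset, heq]
  exact h

end SameCoset

end Cosets

section Generation

open Topology unitInterval Metric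

variable {X Y ι E T : Type*} [TopologicalSpace X] [TopologicalSpace Y] [TopologicalSpace ι]
  [NormedAddCommGroup E] [TopologicalSpace T] {j : C(X, Y)}
  {k : C(ι × closedBall (0 : E) 1 × T, Y)} {f : C(ι × sphere (0 : E) 1 × T, X)} {y₀ : Y}
  {S : Subgroup (FundamentalGroup Y y₀)}

/-- Paths from `y₀` to the points of `X` that the paths in `X` permute up to `S`, and base points
`foot i` of the attaching regions, such that each component of the `i`-th attaching region contains
the end point of a path in the handle that starts at `foot i` and permutes them up to `S`. -/
structure ReferenceSystem (j : C(X, Y)) (k : C(ι × closedBall (0 : E) 1 × T, Y))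
    (f : C(ι × sphere (0 : E) 1 × T, X)) (S : Subgroup (FundamentalGroup Y y₀)) where
  path : ∀ x, Path.Homotopic.Quotient y₀ (j x)
  foot : ι → sphere (0 : E) 1 × T
  base : ∀ {x x' : X} (q : Path x x'),
    SameCoset S ((path x).trans (.mk (q.map j.continuous))) (path x')
  handle : ∀ i u, ∃ u', Joined u' u ∧
    ∃ (p : Path (j (f (i, foot i))) (j (f (i, u')))) (c : Path (rim (foot i)) (rim u')),
      (∀ t, p t = k (i, c t)) ∧ SameCoset S ((path _).trans (.mk p)) (path _)

/-- The reference paths to the points of `X`, extended by paths in the handles. -/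
inductive ReferenceSystem.IsReferencePath (w : ReferenceSystem j k f S) :
    ∀ y, Path.Homotopic.Quotient y₀ y → Prop
  | base (x : X) : w.IsReferencePath (j x) (w.path x)
  | handle (i : ι) {y : Y} (p : Path (j (f (i, w.foot i))) y) {z : closedBall (0 : E) 1 × T}
      (c : Path (rim (w.foot i)) z) (hp : ∀ t, p t = k (i, c t)) :
      w.IsReferencePath y ((w.path _).trans (.mk p))

namespace IsHandleAttachment

variable [NormedSpace ℝ E]

theorem mk_eq_mk_of_handle [ContractibleSpace T] (i : ι) {a b : Y} (p p' : Path a b)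
    {z z' : closedBall (0 : E) 1 × T} (c c' : Path z z') (hp : ∀ t, p t = k (i, c t))
    (hp' : ∀ t, p' t = k (i, c' t)) : Path.Homotopic.Quotient.mk p = .mk p' :=
  mk_eq_mk_of_factor (k.comp ((ContinuousMap.const _ i).prodMk (ContinuousMap.id _))) p p'
    c.toContinuousMap c'.toContinuousMap hp hp' (c.source.trans c'.source.symm)
    (c.target.trans c'.target.symm)

theorem sameCoset_path_of_handle [ContractibleSpace T] (h : IsHandleAttachment j k f)
    (w : ReferenceSystem j k f S) {i : ι} {x : X} (p : Path (j (f (i, w.foot i))) (j x))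
    {z : closedBall (0 : E) 1 × T} (c : Path (rim (w.foot i)) z) (hp : ∀ t, p t = k (i, c t)) :
    SameCoset S ((w.path _).trans (.mk p)) (w.path x) := by
  have hz : k (i, z) = j x := by rw [← c.target, ← hp, p.target]
  obtain ⟨u, rfl, rfl⟩ := h.exists_eq_of_handle_eq hz
  obtain ⟨u', ⟨d⟩, p', c', hp', hS⟩ := w.handle i u
  let δ : Path (f (i, u')) (f (i, u)) := d.map (f := fun v => f (i, v)) (by fun_prop)
  have hpp : Path.Homotopic.Quotient.mk p =
      (Path.Homotopic.Quotient.mk p').trans (.mk (δ.map j.continuous)) := by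
    rw [← Path.Homotopic.Quotient.mk_trans]
    exact mk_eq_mk_of_handle i p _ c (c'.trans (d.map rim.continuous)) hp
      (trans_apply_of_factor (fun z => k (i, z)) p' _ c' _ hp' fun t => (h.glue i (d t)).symm)
  rw [hpp, ← Path.Homotopic.Quotient.trans_assoc]
  exact (hS.trans_right _).trans (w.base δ)

theorem sameCoset_path [ContractibleSpace T] (h : IsHandleAttachment j k f)
    (w : ReferenceSystem j k f S) {y : Y} {α : Path.Homotopic.Quotient y₀ y}
    (hα : w.IsReferencePath y α) {x : X} (hx : y = j x) :
    SameCoset S α ((w.path x).cast rfl hx) := by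
  cases hα with
  | base x' =>
    obtain rfl := h.injective hx
    rw [Path.Homotopic.Quotient.cast_rfl_rfl]
    exact .refl _
  | handle i p c hp =>
    subst hx
    rw [Path.Homotopic.Quotient.cast_rfl_rfl]
    exact h.sameCoset_path_of_handle w p c hp

theorem sameCoset_of_isReferencePath [ContractibleSpace T] (h : IsHandleAttachment j k f)
    (w : ReferenceSystem j k f S) {y : Y} {α β : Path.Homotopic.Quotient y₀ y}
    (hα : w.IsReferencePath y α) (hβ : w.IsReferencePath y β) : SameCoset S α β := by
  by_cases hy : ∃ x, y = j x
  · obtain ⟨x, hx⟩ := hy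
    exact (h.sameCoset_path w hα hx).trans (h.sameCoset_path w hβ hx).symm
  · cases hα with
    | base x => exact absurd ⟨x, rfl⟩ hy
    | @handle i _ p z c hp =>
      cases hβ with
      | base x => exact absurd ⟨x, rfl⟩ hy
      | @handle i' _ p' z' c' hp' =>
        have hkz : k (i, z) = y := by rw [← c.target, ← hp, p.target]
        have hkz' : k (i', z') = y := by rw [← c'.target, ← hp', p'.target]
        have hz : ‖(z.1 : E)‖ < 1 := by
          refine lt_of_le_of_ne (mem_closedBall_zero_iff.1 z.1.2) fun hz => hy ?_
          obtain ⟨u, rfl⟩ := exists_rim_eq hz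
          exact ⟨_, hkz.symm.trans (h.glue i u)⟩
        obtain ⟨rfl, rfl⟩ := Prod.ext_iff.1
          (h.injective_of_norm_lt (i, z) (i', z') hz (hkz.trans hkz'.symm))
        rw [mk_eq_mk_of_handle i p p' c c' hp hp']
        exact .refl _

theorem exists_path_in_handle [PathConnectedSpace T] (h : IsHandleAttachment j k f) (i : ι)
    (v : sphere (0 : E) 1 × T) (z : closedBall (0 : E) 1 × T) :
    ∃ (p : Path (j (f (i, v))) (k (i, z))) (c : Path (rim v) z), ∀ t, p t = k (i, c t) := by
  let c := PathConnectedSpace.somePath (rim v) z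
  exact ⟨⟨⟨fun t => k (i, c t), by fun_prop⟩,
    (congrArg (fun z => k (i, z)) c.source).trans (h.glue i v),
    congrArg (fun z => k (i, z)) c.target⟩, c, fun _ => rfl⟩

theorem exists_sameCoset_of_handle [DiscreteTopology ι] [ContractibleSpace T]
    (h : IsHandleAttachment j k f) (w : ReferenceSystem j k f S) {a b : Y} (p : Path a b)
    (q : C(I, ι × closedBall (0 : E) 1 × T)) (hq : ∀ t, p t = k (q t)) :
    ∃ α β, w.IsReferencePath a α ∧ w.IsReferencePath b β ∧ SameCoset S (α.trans (.mk p)) β := by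
  have const : ∀ t, (q t).1 = (q 0).1 := fun t =>
    PreconnectedSpace.constant inferInstance (f := fun t => (q t).1) (by fun_prop)
  have hq' : ∀ t, p t = k ((q 0).1, (q t).2) := fun t => by rw [hq, ← const t]
  obtain rfl : a = k ((q 0).1, (q 0).2) := by rw [← p.source, hq']
  obtain ⟨p₀, c₀, hc₀⟩ := h.exists_path_in_handle (q 0).1 (w.foot (q 0).1) (q 0).2
  let c : Path (q 0).2 (q 1).2 := ⟨⟨fun t => (q t).2, by fun_prop⟩, rfl, rfl⟩
  refine ⟨_, _, .handle _ p₀ c₀ hc₀, .handle _ (p₀.trans p) (c₀.trans c)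
    (trans_apply_of_factor (fun z => k ((q 0).1, z)) p₀ p c₀ c hc₀ hq'), ?_⟩
  rw [Path.Homotopic.Quotient.mk_trans, ← Path.Homotopic.Quotient.trans_assoc]
  exact .refl _

theorem exists_sameCoset [Nonempty X] [DiscreteTopology ι] [ContractibleSpace T]
    (h : IsHandleAttachment j k f) (w : ReferenceSystem j k f S) {a b : Y} (p : Path a b) :
    ∃ α β, w.IsReferencePath a α ∧ w.IsReferencePath b β ∧
      SameCoset S (α.trans (.mk p)) β := by
  refine h.path_induction (fun {a b} p => ∃ α β, w.IsReferencePath a α ∧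
    w.IsReferencePath b β ∧ SameCoset S (α.trans (.mk p)) β) ?_ ?_ ?_
    (h.exists_sameCoset_of_handle w) p
  · intro a b p q hpq hP
    rwa [← Path.Homotopic.Quotient.eq.2 hpq]
  · rintro a b c p q ⟨α, β, hα, hβ, hp⟩ ⟨β', γ, hβ', hγ, hq⟩
    refine ⟨α, γ, hα, hγ, ?_⟩
    rw [Path.Homotopic.Quotient.mk_trans, ← Path.Homotopic.Quotient.trans_assoc]
    exact ((hp.trans (h.sameCoset_of_isReferencePath w hβ hβ')).trans_right _).trans hq
  · intro a b p q hq
    obtain rfl : a = j (q 0) := by rw [← p.source, hq]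
    obtain rfl : b = j (q 1) := by rw [← p.target, hq]
    let q' : Path (q 0) (q 1) := ⟨q, rfl, rfl⟩
    obtain rfl : p = q'.map j.continuous := Path.ext (funext hq)
    exact ⟨_, _, .base (q 0), .base (q 1), w.base q'⟩

theorem sameCoset_trans_path [DiscreteTopology ι] [ContractibleSpace T]
    (h : IsHandleAttachment j k f) (w : ReferenceSystem j k f S) {x x' : X}
    (p : Path (j x) (j x')) : SameCoset S ((w.path x).trans (.mk p)) (w.path x') := by
  have : Nonempty X := ⟨x⟩
  obtain ⟨α, β, hα, hβ, hp⟩ := h.exists_sameCoset w p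
  exact ((h.sameCoset_of_isReferencePath w (.base x) hα).trans_right _).trans
    (hp.trans (h.sameCoset_of_isReferencePath w hβ (.base x')))

end IsHandleAttachment

end Generation

/-! ## The surface as a rectangle with one-handles -/

section SurfaceHandles

open Topology unitInterval Metric

/-- The rectangle in `F_g`. -/
def Base (g : ℕ) : Type := {p : ℂ × ℝ // InBase g p}

instance (g : ℕ) : TopologicalSpace (Base g) := instTopologicalSpaceSubtype

/-- The inclusion of the rectangle in `F_g`. -/
def baseIncl (g : ℕ) : C(Base g, Surface g) where
  toFun p := ⟨p.1, Or.inl p.2⟩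
  continuous_toFun := Continuous.subtype_mk continuous_subtype_val _

instance (g : ℕ) : CompactSpace (Base g) := by
  have h : {p : ℂ × ℝ | InBase g p} =
      (Icc (0 : ℝ) (16 * (g + 1)) ×ℂ Icc (-10 : ℝ) 0) ×ˢ ({0} : Set ℝ) := by
    ext p
    simp only [InBase, mem_ofPred_eq, mem_prod, Complex.mem_reProdIm, mem_Icc, mem_singleton_iff]
    tauto
  refine isCompact_iff_compactSpace.1 ?_
  change IsCompact {p : ℂ × ℝ | InBase g p}
  rw [h]
  exact (isCompact_Icc.reProdIm isCompact_Icc).prod isCompact_singleton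

instance (g : ℕ) : ContractibleSpace (Base g) :=
  (convex_inBase g).contractibleSpace ⟨_, inBase_star g⟩

instance (g : ℕ) : T2Space (Surface g) := inferInstanceAs (T2Space (Subtype _))

/-- The index set of the bands: `inl i` is the `i`-th band of the first kind and `inr i` is the
`i`-th band of the second kind. -/
abbrev BandIndex (g : ℕ) : Type := Fin g ⊕ Fin g

/-- The centre of a band. -/
def bandCenter {g : ℕ} : BandIndex g → ℝ
  | .inl i => centerA i
  | .inr i => centerB i

/-- The stretching factor of a band in the `y`-direction. -/
def bandStretch {g : ℕ} : BandIndex g → ℝ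
  | .inl _ => 1
  | .inr _ => 2

/-- The stretching factor of a band in the vertical direction. -/
def bandHeight {g : ℕ} : BandIndex g → ℝ
  | .inl _ => 0
  | .inr _ => 2

/-- The point of a band with polar coordinates `(t, (z, w))`, where `z ^ 2 + w ^ 2 = 1`. -/
def bandPoint {g : ℕ} (b : BandIndex g) (z w t : ℝ) : ℂ × ℝ :=
  (⟨bandCenter b + t * z, bandStretch b * (t * w)⟩, bandHeight b * (t * w))

theorem norm_polar {z w t : ℝ} (h : z ^ 2 + w ^ 2 = 1) (ht : 0 ≤ t) :
    ‖(⟨t * z, t * w⟩ : ℂ)‖ = t := by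
  rw [← sq_eq_sq₀ (norm_nonneg _) ht, Complex.sq_norm, Complex.normSq_mk]
  linear_combination t ^ 2 * h

theorem bandPoint_mem {g : ℕ} (b : BandIndex g) {z w t : ℝ} (h : z ^ 2 + w ^ 2 = 1) (hw : 0 ≤ w)
    (ht : t ∈ Icc (2 : ℝ) 4) :
    InBase g (bandPoint b z w t) ∨ ∃ i : Fin g, InBandA i (bandPoint b z w t) ∨
      InBandB i (bandPoint b z w t) := by
  have ht0 : 0 ≤ t := by linarith [ht.1]
  right
  rcases b with i | i
  · have hn : ‖(bandPoint (Sum.inl i) z w t).1 - centerA i‖ = t := by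
      refine Eq.trans (congrArg _ ?_) (norm_polar h ht0)
      apply Complex.ext <;> simp [bandPoint, bandCenter, bandStretch]
    refine ⟨i, Or.inl ⟨?_, ?_, ?_, ?_⟩⟩
    · simp only [bandPoint, bandStretch]
      positivity
    · simp [bandPoint, bandHeight]
    · rw [hn]; exact ht.1
    · rw [hn]; exact ht.2
  · have hn : ‖squash ((bandPoint (Sum.inr i) z w t).1 - centerB i)‖ = t := by
      refine Eq.trans (congrArg _ ?_) (norm_polar h ht0)
      apply Complex.ext <;> simp [bandPoint, bandCenter, bandStretch, squash]
    refine ⟨i, Or.inr ⟨?_, ?_, ?_, ?_⟩⟩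
    · simp only [bandPoint, bandStretch]
      positivity
    · simp [bandPoint, bandHeight, bandStretch]
    · rw [hn]; exact ht.1
    · rw [hn]; exact ht.2

theorem sq_add_sqrt_sq {z : ℝ} (hz : z ∈ closedBall (0 : ℝ) 1) : z ^ 2 + √(1 - z ^ 2) ^ 2 = 1 := by
  have h := mem_closedBall_zero_iff.1 hz
  have : z ^ 2 ≤ 1 := by rw [← sq_abs, sq_le_one_iff₀ (abs_nonneg z)]; exact h
  rw [Real.sq_sqrt (by linarith)]
  ring

theorem sq_eq_one_of_mem_sphere {u : ℝ} (hu : u ∈ sphere (0 : ℝ) 1) : u ^ 2 = 1 := by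
  rw [← sq_abs, ← Real.norm_eq_abs, mem_sphere_zero_iff_norm.1 hu, one_pow]

theorem abs_le_one_of_sq_add_sq {z w : ℝ} (h : z ^ 2 + w ^ 2 = 1) : |z| ≤ 1 :=
  abs_le_one_iff_mul_self_le_one.2 (by nlinarith)

/-- The parametrization of the bands. -/
def bandMap (g : ℕ) : C(BandIndex g × closedBall (0 : ℝ) 1 × Icc (2 : ℝ) 4, Surface g) where
  toFun x := ⟨bandPoint x.1 x.2.1 √(1 - (x.2.1 : ℝ) ^ 2) x.2.2,
    bandPoint_mem x.1 (sq_add_sqrt_sq x.2.1.2) (Real.sqrt_nonneg _) x.2.2.2⟩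
  continuous_toFun := by
    refine Continuous.subtype_mk ?_ _
    have h : ∀ F : BandIndex g → ℝ, Continuous F := fun F => continuous_of_discreteTopology
    have hmk : Continuous fun p : ℝ × ℝ => (⟨p.1, p.2⟩ : ℂ) :=
      Complex.equivRealProdCLM.symm.continuous
    have h1 := h bandCenter
    have h2 := h bandStretch
    have h3 := h bandHeight
    unfold bandPoint
    refine Continuous.prodMk (hmk.comp (Continuous.prodMk ?_ ?_)) ?_ <;> fun_prop

theorem bandCenter_bounds {g : ℕ} (b : BandIndex g) :
    8 ≤ bandCenter b ∧ bandCenter b + 5 ≤ 16 * g := by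
  rcases b with i | i
  all_goals
    have hi : ((i : ℕ) : ℝ) + 1 ≤ g := by exact_mod_cast i.2
    have := Nat.cast_nonneg (α := ℝ) (i : ℕ)
    simp only [bandCenter, centerA, centerB]
    constructor <;> linarith

theorem inBase_bandPoint {g : ℕ} (b : BandIndex g) {z w t : ℝ} (h : z ^ 2 + w ^ 2 = 1)
    (hw : w ≤ 0) (ht : t ∈ Icc (2 : ℝ) 4) :
    InBase g (⟨bandCenter b + t * z, bandStretch b * (t * w)⟩, 0) := by
  obtain ⟨h1, h2⟩ := bandCenter_bounds b
  have hz := abs_le.1 (abs_le_one_of_sq_add_sq h)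
  have hw' := abs_le.1 (abs_le_one_of_sq_add_sq ((add_comm _ _).trans h))
  have ht1 := ht.1
  have ht2 := ht.2
  have hs : 0 ≤ bandStretch b ∧ bandStretch b ≤ 2 := by
    rcases b with _ | _ <;> simp [bandStretch]
  refine ⟨?_, ?_, ?_, ?_, rfl⟩
  · change 0 ≤ bandCenter b + t * z
    nlinarith
  · change bandCenter b + t * z ≤ 16 * (g + 1)
    nlinarith
  · change -10 ≤ bandStretch b * (t * w)
    nlinarith [mul_nonneg hs.1 (by linarith : (0 : ℝ) ≤ t)]
  · change bandStretch b * (t * w) ≤ 0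
    exact mul_nonpos_of_nonneg_of_nonpos hs.1 (mul_nonpos_of_nonneg_of_nonpos (by linarith) hw)

/-- The attaching map of the bands. -/
def bandFoot (g : ℕ) : C(BandIndex g × sphere (0 : ℝ) 1 × Icc (2 : ℝ) 4, Base g) where
  toFun x := ⟨(⟨bandCenter x.1 + x.2.2 * x.2.1, bandStretch x.1 * (x.2.2 * 0)⟩, 0),
    inBase_bandPoint x.1 (by rw [sq_eq_one_of_mem_sphere x.2.1.2, sq, zero_mul, add_zero]) le_rfl
      x.2.2.2⟩
  continuous_toFun := by
    refine Continuous.subtype_mk ?_ _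
    have h : ∀ F : BandIndex g → ℝ, Continuous F := fun F => continuous_of_discreteTopology
    have hmk : Continuous fun p : ℝ × ℝ => (⟨p.1, p.2⟩ : ℂ) :=
      Complex.equivRealProdCLM.symm.continuous
    have h1 := h bandCenter
    have h2 := h bandStretch
    refine Continuous.prodMk (hmk.comp (Continuous.prodMk ?_ ?_)) ?_ <;> fun_prop

theorem bandStretch_pos {g : ℕ} (b : BandIndex g) : 0 < bandStretch b := by
  rcases b with _ | _ <;> simp [bandStretch]

theorem eq_of_mul_add_eq {g : ℕ} {i i' : Fin g} {x x' : ℝ} (hx : |x| ≤ 4) (hx' : |x'| ≤ 4)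
    (h : (16 * (i : ℕ) : ℝ) + x = 16 * (i' : ℕ) + x') : i = i' := by
  rw [abs_le] at hx hx'
  have h1 : ((i : ℕ) : ℝ) < (i' : ℕ) + 1 := by linarith
  have h2 : ((i' : ℕ) : ℝ) < (i : ℕ) + 1 := by linarith
  have h3 : (i : ℕ) < i' + 1 := by exact_mod_cast h1
  have h4 : (i' : ℕ) < i + 1 := by exact_mod_cast h2
  ext
  omega

theorem abs_mul_le_four {z w t : ℝ} (h : z ^ 2 + w ^ 2 = 1) (ht : t ∈ Icc (2 : ℝ) 4) :
    |t * z| ≤ 4 := by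
  have hz := abs_le_one_of_sq_add_sq h
  rw [abs_mul, abs_of_nonneg (by linarith [ht.1] : 0 ≤ t)]
  nlinarith [ht.1, ht.2, abs_nonneg z]

theorem bandIndex_eq_of_bandPoint_eq {g : ℕ} {b b' : BandIndex g} {z w t z' w' t' : ℝ}
    (h : z ^ 2 + w ^ 2 = 1) (hw : 0 < w) (ht : t ∈ Icc (2 : ℝ) 4)
    (h' : z' ^ 2 + w' ^ 2 = 1) (ht' : t' ∈ Icc (2 : ℝ) 4)
    (heq : bandPoint b z w t = bandPoint b' z' w' t') : b = b' := by
  have hx : bandCenter b + t * z = bandCenter b' + t' * z' :=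
    congrArg (fun p : ℂ × ℝ => p.1.re) heq
  have hy : bandStretch b * (t * w) = bandStretch b' * (t' * w') :=
    congrArg (fun p : ℂ × ℝ => p.1.im) heq
  have hh : bandHeight b * (t * w) = bandHeight b' * (t' * w') := congrArg Prod.snd heq
  have hpos : 0 < t * w := mul_pos (by linarith [ht.1]) hw
  have hz := abs_mul_le_four h ht
  have hz' := abs_mul_le_four h' ht'
  rcases b with i | i <;> rcases b' with i' | i' <;>
    simp only [bandCenter, centerA, centerB, bandStretch, bandHeight] at hx hy hh
  · rw [eq_of_mul_add_eq (i := i) (i' := i') hz hz' (by linarith)]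
  · linarith
  · linarith
  · rw [eq_of_mul_add_eq (i := i) (i' := i') hz hz' (by linarith)]

theorem bandPoint_injective {g : ℕ} {b b' : BandIndex g} {z w t z' w' t' : ℝ}
    (h : z ^ 2 + w ^ 2 = 1) (hw : 0 < w) (ht : t ∈ Icc (2 : ℝ) 4)
    (h' : z' ^ 2 + w' ^ 2 = 1) (ht' : t' ∈ Icc (2 : ℝ) 4)
    (heq : bandPoint b z w t = bandPoint b' z' w' t') : b = b' ∧ z = z' ∧ t = t' := by
  obtain rfl := bandIndex_eq_of_bandPoint_eq h hw ht h' ht' heq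
  have hz : t * z = t' * z' := add_left_cancel (congrArg (fun p : ℂ × ℝ => p.1.re) heq)
  have hw : t * w = t' * w' :=
    mul_left_cancel₀ (bandStretch_pos b).ne' (congrArg (fun p : ℂ × ℝ => p.1.im) heq)
  have ht1 := ht.1
  have ht1' := ht'.1
  obtain rfl : t = t' := by
    rw [← norm_polar h (by linarith : 0 ≤ t), ← norm_polar h' (by linarith : 0 ≤ t'), hz, hw]
  exact ⟨rfl, mul_left_cancel₀ (by linarith : t ≠ 0) hz, rfl⟩

theorem exists_bandMap_eq {g : ℕ} (b : BandIndex g) {v : ℂ} (h2 : 2 ≤ ‖v‖) (h4 : ‖v‖ ≤ 4)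
    (him : 0 ≤ v.im) : ∃ z : closedBall (0 : ℝ) 1, ∃ t : Icc (2 : ℝ) 4,
      (bandMap g (b, z, t)).1 =
        (⟨bandCenter b + v.re, bandStretch b * v.im⟩, bandHeight b * v.im) := by
  have h0 : 0 < ‖v‖ := by linarith
  have hz : v.re / ‖v‖ ∈ closedBall (0 : ℝ) 1 := by
    rw [mem_closedBall_zero_iff, Real.norm_eq_abs, abs_div, abs_norm, div_le_one h0]
    exact Complex.abs_re_le_norm v
  have hw : √(1 - (v.re / ‖v‖) ^ 2) = v.im / ‖v‖ := by
    have h1 := Complex.sq_norm v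
    rw [Complex.normSq_apply] at h1
    have h3 : 1 - (v.re / ‖v‖) ^ 2 = (v.im / ‖v‖) ^ 2 := by
      field_simp
      linarith
    rw [h3, Real.sqrt_sq (by positivity)]
  refine ⟨⟨_, hz⟩, ⟨‖v‖, h2, h4⟩, ?_⟩
  change bandPoint b (v.re / ‖v‖) √(1 - (v.re / ‖v‖) ^ 2) ‖v‖ = _
  rw [hw, bandPoint, mul_div_cancel₀ _ h0.ne', mul_div_cancel₀ _ h0.ne']

theorem surjective_elim_bandMap (g : ℕ) :
    Function.Surjective (Sum.elim (baseIncl g) (bandMap g)) := by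
  rintro ⟨p, hp | ⟨i, ⟨him, hh, h2, h4⟩ | ⟨him, hh, h2, h4⟩⟩⟩
  · exact ⟨Sum.inl ⟨p, hp⟩, rfl⟩
  · obtain ⟨z, t, hzt⟩ := exists_bandMap_eq (g := g) (Sum.inl i) h2 h4 (by simpa using him)
    refine ⟨Sum.inr (Sum.inl i, z, t), Subtype.ext (hzt.trans ?_)⟩
    refine Prod.ext (Complex.ext ?_ ?_) ?_ <;> simp [bandCenter, bandStretch, bandHeight, hh]
  · obtain ⟨z, t, hzt⟩ := exists_bandMap_eq (g := g) (Sum.inr i) h2 h4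
      (by simp only [squash, Complex.sub_im, Complex.ofReal_im]; linarith)
    refine ⟨Sum.inr (Sum.inr i, z, t), Subtype.ext (hzt.trans ?_)⟩
    refine Prod.ext (Complex.ext ?_ ?_) ?_ <;>
      simp [bandCenter, bandStretch, bandHeight, hh, squash] <;> ring

theorem norm_eq_one_of_inBase_bandPoint {g : ℕ} (b : BandIndex g) {z t : ℝ}
    (hz : z ∈ closedBall (0 : ℝ) 1) (ht : t ∈ Icc (2 : ℝ) 4)
    (h : InBase g (bandPoint b z √(1 - z ^ 2) t)) : ‖z‖ = 1 := by
  have him : bandStretch b * (t * √(1 - z ^ 2)) ≤ 0 := h.2.2.2.1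
  have hsqrt : √(1 - z ^ 2) ≤ 0 :=
    nonpos_of_mul_nonpos_right (nonpos_of_mul_nonpos_right him (bandStretch_pos b))
      (by linarith [ht.1] : (0 : ℝ) < t)
  have hsq := Real.sqrt_eq_zero'.1 (le_antisymm hsqrt (Real.sqrt_nonneg _))
  refine le_antisymm (mem_closedBall_zero_iff.1 hz) ?_
  rw [Real.norm_eq_abs, ← one_le_sq_iff_one_le_abs]
  linarith

theorem isHandleAttachment_surface (g : ℕ) :
    IsHandleAttachment (baseIncl g) (bandMap g) (bandFoot g) where
  isQuotientMap := by
    have hc : Continuous (Sum.elim (baseIncl g) (bandMap g)) :=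
      continuous_sum_dom.2 ⟨(baseIncl g).continuous, (bandMap g).continuous⟩
    exact hc.isClosedMap.isQuotientMap hc (surjective_elim_bandMap g)
  glue := by
    rintro b ⟨u, t⟩
    apply Subtype.ext
    change bandPoint b u √(1 - (u : ℝ) ^ 2) t =
      ((⟨bandCenter b + t * u, bandStretch b * (t * 0)⟩, 0) : ℂ × ℝ)
    rw [sq_eq_one_of_mem_sphere u.2]
    simp [bandPoint]
  injective x y hxy := Subtype.ext (congrArg (fun p : Surface g => p.1) hxy)
  norm_eq_one := by
    rintro x ⟨b, z, t⟩ hxz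
    have hval : bandPoint b z √(1 - (z : ℝ) ^ 2) t = x.1 :=
      congrArg (fun p : Surface g => p.1) hxz
    exact norm_eq_one_of_inBase_bandPoint b z.2 t.2 (hval ▸ x.2)
  injective_of_norm_lt := by
    rintro ⟨b, z, t⟩ ⟨b', z', t'⟩ hz heq
    have hw : 0 < √(1 - (z : ℝ) ^ 2) := by
      rw [Real.norm_eq_abs, ← sq_lt_one_iff_abs_lt_one] at hz
      exact Real.sqrt_pos.2 (by linarith)
    obtain ⟨rfl, h2, h3⟩ := bandPoint_injective (sq_add_sqrt_sq z.2) hw t.2 (sq_add_sqrt_sq z'.2)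
      t'.2 (congrArg (fun p : Surface g => p.1) heq)
    rw [Subtype.ext h2, Subtype.ext h3]

end SurfaceHandles

section SurfaceLoops

open Topology unitInterval Metric

variable {g : ℕ}

instance : ContractibleSpace (Icc (2 : ℝ) 4) :=
  (convex_Icc (2 : ℝ) 4).contractibleSpace ⟨2, by norm_num⟩

/-- The annuli around the meridians and the parallels. -/
def bandAnnulus (g : ℕ) : BandIndex g → C(Circle × J, Surface g)
  | .inl i => annulusA g i
  | .inr i => annulusB g i

theorem bandAnnulus_val (b : BandIndex g) (u : Circle) (t : J) :
    (bandAnnulus g b (u, t)).1 =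
      (⟨bandCenter b + (3 + (t : ℝ) / 2) * (u : ℂ).re,
        bandStretch b * ((3 + (t : ℝ) / 2) * (u : ℂ).im)⟩,
        bandHeight b * max 0 ((3 + (t : ℝ) / 2) * (u : ℂ).im)) := by
  rcases b with i | i
  · change (((centerA i : ℂ) + ((3 + (t : ℝ) / 2 : ℝ) : ℂ) * u, 0) : ℂ × ℝ) = _
    refine Prod.ext (Complex.ext ?_ ?_) ?_
    · rw [Complex.add_re, Complex.ofReal_re, Complex.re_ofReal_mul]; rfl
    · rw [Complex.add_im, Complex.ofReal_im, Complex.im_ofReal_mul]; simp [bandStretch]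
    · simp [bandHeight]
  · change (((centerB i : ℂ) + stretch (((3 + (t : ℝ) / 2 : ℝ) : ℂ) * u),
      max 0 (stretch (((3 + (t : ℝ) / 2 : ℝ) : ℂ) * u)).im) : ℂ × ℝ) = _
    refine Prod.ext (Complex.ext ?_ ?_) ?_
    · simp only [Complex.add_re, Complex.ofReal_re, stretch, Complex.re_ofReal_mul]; rfl
    · simp only [Complex.add_im, Complex.ofReal_im, stretch, Complex.im_ofReal_mul, zero_add]; rfl
    · simp only [stretch, Complex.im_ofReal_mul, bandHeight]
      rw [mul_max_of_nonneg _ _ (by norm_num : (0 : ℝ) ≤ 2), mul_zero]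

theorem circle_re_sq_add_im_sq (u : Circle) : (u : ℂ).re ^ 2 + (u : ℂ).im ^ 2 = 1 := by
  have h : Complex.normSq u = 1 := by rw [Complex.normSq_eq_norm_sq, Circle.norm_coe, one_pow]
  rw [Complex.normSq_apply] at h
  linarith

theorem radius_mem (t : J) : 3 + (t : ℝ) / 2 ∈ Icc (2 : ℝ) 4 := by
  have h1 := t.2.1
  have h2 := t.2.2
  constructor <;> linarith

theorem radius_pos (t : J) : 0 < 3 + (t : ℝ) / 2 := by linarith [(radius_mem t).1]

theorem inBase_bandAnnulus (b : BandIndex g) {u : Circle} (t : J) (h : (u : ℂ).im ≤ 0) :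
    InBase g (bandAnnulus g b (u, t)).1 := by
  rw [bandAnnulus_val, max_eq_left (mul_nonpos_of_nonneg_of_nonpos (radius_pos t).le h), mul_zero]
  exact inBase_bandPoint b (circle_re_sq_add_im_sq u) h (radius_mem t)

theorem re_mem_closedBall (u : Circle) : (u : ℂ).re ∈ closedBall (0 : ℝ) 1 := by
  rw [mem_closedBall_zero_iff, Real.norm_eq_abs, ← Circle.norm_coe u]
  exact Complex.abs_re_le_norm _

theorem bandAnnulus_eq_bandMap (b : BandIndex g) {u : Circle} (t : J) (h : 0 ≤ (u : ℂ).im) :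
    bandAnnulus g b (u, t) = bandMap g (b, ⟨_, re_mem_closedBall u⟩, ⟨_, radius_mem t⟩) := by
  apply Subtype.ext
  rw [bandAnnulus_val, max_eq_right (mul_nonneg (radius_pos t).le h)]
  change _ = bandPoint b (u : ℂ).re √(1 - (u : ℂ).re ^ 2) (3 + (t : ℝ) / 2)
  have hs : 1 - (u : ℂ).re ^ 2 = (u : ℂ).im ^ 2 := by linarith [circle_re_sq_add_im_sq u]
  rw [hs, Real.sqrt_sq h]
  rfl

theorem mk_eq_mk_of_inBase {a b : Surface g} (p q : Path a b) (hp : ∀ t, InBase g (p t).1)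
    (hq : ∀ t, InBase g (q t).1) : Path.Homotopic.Quotient.mk p = .mk q := by
  refine mk_eq_mk_of_factor (baseIncl g) p q ⟨fun t => ⟨(p t).1, hp t⟩, ?_⟩
    ⟨fun t => ⟨(q t).1, hq t⟩, ?_⟩ (fun _ => rfl) (fun _ => rfl)
    (Subtype.ext (congrArg (fun x : Surface g => x.1) (p.source.trans q.source.symm)))
    (Subtype.ext (congrArg (fun x : Surface g => x.1) (p.target.trans q.target.symm)))
  · exact Continuous.subtype_mk (continuous_subtype_val.comp p.continuous) _
  · exact Continuous.subtype_mk (continuous_subtype_val.comp q.continuous) _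

theorem inBase_trans {x y z : Surface g} (p : Path x y) (q : Path y z) (hp : ∀ t, InBase g (p t).1)
    (hq : ∀ t, InBase g (q t).1) (t : I) : InBase g ((p.trans q) t).1 := by
  rw [Path.trans_apply]
  split_ifs
  exacts [hp _, hq _]

/-- The class of the segment from `⋆` to a point of the rectangle. -/
def baseClass (x : Base g) : Path.Homotopic.Quotient (star g) (baseIncl g x) :=
  .mk (baseSegment _ _ (inBase_star g) x.2)

theorem inBase_baseSegment {p q : Surface g} (hp : InBase g p.1) (hq : InBase g q.1) (t : I) :
    InBase g (baseSegment p q hp hq t).1 :=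
  (convex_inBase g).lineMap_mem hp hq t.2

/-- The left end point of the core of a handle. -/
def leftFoot : sphere (0 : ℝ) 1 × Icc (2 : ℝ) 4 := (⟨-1, by simp⟩, ⟨3, by norm_num⟩)

/-- The right end point of the core of a handle. -/
def rightFoot : sphere (0 : ℝ) 1 × Icc (2 : ℝ) 4 := (⟨1, by simp⟩, ⟨3, by norm_num⟩)

/-- The core of a handle. -/
def handleCore : Path (rim leftFoot) (rim rightFoot) where
  toFun r := (⟨2 * (r : ℝ) - 1, by
    have h1 := r.2.1
    have h2 := r.2.2
    rw [mem_closedBall_zero_iff, Real.norm_eq_abs, abs_le]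
    constructor <;> linarith⟩, ⟨3, by norm_num⟩)
  continuous_toFun := by
    refine Continuous.prodMk (Continuous.subtype_mk ?_ _) continuous_const
    fun_prop
  source' := Prod.ext (Subtype.ext (by simp [rim, leftFoot])) rfl
  target' := Prod.ext (Subtype.ext (by simp [rim, rightFoot]; norm_num)) rfl

/-- The core of a band. -/
def bandPath (b : BandIndex g) :
    Path (baseIncl g (bandFoot g (b, leftFoot))) (baseIncl g (bandFoot g (b, rightFoot))) where
  toFun r := bandMap g (b, handleCore r)
  continuous_toFun := by fun_prop
  source' := by rw [handleCore.source, (isHandleAttachment_surface g).glue]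
  target' := by rw [handleCore.target, (isHandleAttachment_surface g).glue]

/-- The class of the loop that runs through a band. -/
def bandLoop (b : BandIndex g) : Path.Homotopic.Quotient (star g) (star g) :=
  ((baseClass _).trans (.mk (bandPath b))).trans (baseClass _).symm

/-- The circle around a band, run clockwise from its lowest point. -/
def bandCircle (b : BandIndex g) :
    Path (bandAnnulus g b (Circle.exp (-(Real.pi / 2)), jMid))
      (bandAnnulus g b (Circle.exp (-(Real.pi / 2)), jMid)) where
  toFun s := bandAnnulus g b (Circle.exp (-(Real.pi / 2) - 2 * Real.pi * s), jMid)
  continuous_toFun := by fun_prop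
  source' := by simp
  target' := by simp

theorem bottom_re (s : ℝ) : (Circle.exp (-(Real.pi / 2) - 2 * Real.pi * s) : ℂ).re =
    -Real.sin (2 * Real.pi * s) := by
  rw [Circle.coe_exp, Complex.exp_ofReal_mul_I_re, ← Real.cos_neg, neg_sub, sub_neg_eq_add,
    Real.cos_add_pi_div_two]

theorem bottom_im (s : ℝ) : (Circle.exp (-(Real.pi / 2) - 2 * Real.pi * s) : ℂ).im =
    -Real.cos (2 * Real.pi * s) := by
  rw [Circle.coe_exp, Complex.exp_ofReal_mul_I_im, ← neg_neg (Real.sin _), ← Real.sin_neg, neg_sub,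
    sub_neg_eq_add, Real.sin_add_pi_div_two]

theorem inBase_bandCircle (b : BandIndex g) {s : I} (h : 0 ≤ Real.cos (2 * Real.pi * s)) :
    InBase g (bandCircle b s).1 :=
  inBase_bandAnnulus b _ (by rw [bottom_im]; linarith)

theorem inBase_subpath {x y : Surface g} (p : Path x y) {s t : I} (hst : s ≤ t)
    (h : ∀ r ∈ Icc s t, InBase g (p r).1) (r : I) : InBase g (p.subpath s t r).1 := by
  obtain ⟨u, hu, hru⟩ := exists_subpath_apply_eq p hst r
  exact hru ▸ h u hu

/-- The coordinates in the handle of the point of the circle around a band at time `s`, for those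
`s` at which this point lies in the band. -/
def handleCircle (s : I) : closedBall (0 : ℝ) 1 × Icc (2 : ℝ) 4 :=
  (⟨_, re_mem_closedBall (Circle.exp (-(Real.pi / 2) - 2 * Real.pi * s))⟩, leftFoot.2)

theorem continuous_handleCircle : Continuous handleCircle := by
  refine Continuous.prodMk (Continuous.subtype_mk ?_ _) continuous_const
  fun_prop

theorem handleCircle_quarter : handleCircle quarter = rim leftFoot := by
  refine Prod.ext (Subtype.ext ?_) rfl
  change (Circle.exp (-(Real.pi / 2) - 2 * Real.pi * quarter) : ℂ).re = -1
  rw [bottom_re, sin_quarter]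

theorem handleCircle_threeQuarters : handleCircle threeQuarters = rim rightFoot := by
  refine Prod.ext (Subtype.ext ?_) rfl
  change (Circle.exp (-(Real.pi / 2) - 2 * Real.pi * threeQuarters) : ℂ).re = 1
  rw [bottom_re, sin_threeQuarters, neg_neg]

theorem bandCircle_eq_bandMap (b : BandIndex g) {s : I} (hs : s ∈ Icc quarter threeQuarters) :
    bandCircle b s = bandMap g (b, handleCircle s) := by
  refine (bandAnnulus_eq_bandMap b jMid ?_).trans ?_
  · rw [bottom_im]
    linarith [cos_nonpos_of_mem_middle hs]
  · congr 3
    exact Subtype.ext (by simp [leftFoot, jMid])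

theorem bandCircle_quarter (b : BandIndex g) :
    baseIncl g (bandFoot g (b, leftFoot)) = bandCircle b quarter := by
  rw [bandCircle_eq_bandMap b ⟨le_rfl, quarter_le_threeQuarters⟩, handleCircle_quarter,
    (isHandleAttachment_surface g).glue]

theorem bandCircle_threeQuarters (b : BandIndex g) :
    baseIncl g (bandFoot g (b, rightFoot)) = bandCircle b threeQuarters := by
  rw [bandCircle_eq_bandMap b ⟨quarter_le_threeQuarters, le_rfl⟩, handleCircle_threeQuarters,
    (isHandleAttachment_surface g).glue]

theorem mk_subpath_bandCircle (b : BandIndex g) :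
    Path.Homotopic.Quotient.mk (((bandCircle b).subpath quarter threeQuarters).cast
      (bandCircle_quarter b) (bandCircle_threeQuarters b)) = .mk (bandPath b) := by
  let c : Path (handleCircle 0) (handleCircle 1) := ⟨⟨_, continuous_handleCircle⟩, rfl, rfl⟩
  refine IsHandleAttachment.mk_eq_mk_of_handle (k := bandMap g) b _ _
    ((c.subpath quarter threeQuarters).cast handleCircle_quarter.symm
      handleCircle_threeQuarters.symm) handleCore (fun t => ?_) fun _ => rfl
  exact bandCircle_eq_bandMap b
    ⟨Icc.le_convexComb quarter_le_threeQuarters t, Icc.convexComb_le quarter_le_threeQuarters t⟩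

/-- The times `1 / 4` and `3 / 4` cut the circle into an arc in the band and two arcs in the
rectangle, where paths with the same end points are homotopic. -/
theorem mk_eq_bandLoop (b : BandIndex g)
    (w : Path (star g) (bandAnnulus g b (Circle.exp (-(Real.pi / 2)), jMid)))
    (hw : ∀ t, InBase g (w t).1) :
    ((Path.Homotopic.Quotient.mk w).trans (.mk (bandCircle b))).trans
      (Path.Homotopic.Quotient.mk w).symm = bandLoop b := by
  have first : (Path.Homotopic.Quotient.mk w).trans (.mk (((bandCircle b).subpath 0 quarter).cast
      (bandCircle b).source.symm (bandCircle_quarter b))) = baseClass _ := by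
    rw [← Path.Homotopic.Quotient.mk_trans]
    exact mk_eq_mk_of_inBase _ _ (inBase_trans _ _ hw (inBase_subpath _ quarter.2.1 fun _ hr =>
      inBase_bandCircle b (cos_nonneg_of_le_quarter hr.2))) (inBase_baseSegment _ _)
  have last : (Path.Homotopic.Quotient.mk (((bandCircle b).subpath threeQuarters 1).cast
      (bandCircle_threeQuarters b) (bandCircle b).target.symm)).trans
        (Path.Homotopic.Quotient.mk w).symm = (baseClass (bandFoot g (b, rightFoot))).symm := by
    change Path.Homotopic.Quotient.trans _ (.mk w.symm) = .mk _
    rw [← Path.Homotopic.Quotient.mk_trans]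
    exact mk_eq_mk_of_inBase _ _
      (inBase_trans _ _ (inBase_subpath _ threeQuarters.2.2 fun _ hr =>
        inBase_bandCircle b (cos_nonneg_of_threeQuarters_le hr.1)) fun _ => hw _)
      fun _ => inBase_baseSegment (inBase_star g) (bandFoot g (b, rightFoot)).2 _
  rw [bandLoop, ← first, ← last, ← mk_subpath_bandCircle, mk_eq_trans_cast_subpath (bandCircle b)
    (bandCircle_quarter b) (bandCircle_threeQuarters b)]
  simp only [Path.Homotopic.Quotient.trans_assoc]

theorem mk_loopA (i : Fin g) : Path.Homotopic.Quotient.mk (loopA g i) = bandLoop (Sum.inl i) :=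
  mk_eq_bandLoop (Sum.inl i) (baseSegment _ _ (inBase_star g) (inBase_coreA g i))
    (inBase_baseSegment _ _)

theorem coreB_symm (i : Fin g) : (coreB g i).symm = bandCircle (Sum.inr i) := by
  refine Path.ext (funext fun t => ?_)
  change annulusB g i (Circle.exp (-(Real.pi / 2) + 2 * Real.pi * (σ t : I)), jMid) =
    annulusB g i (Circle.exp (-(Real.pi / 2) - 2 * Real.pi * t), jMid)
  congr 2
  rw [unitInterval.coe_symm_eq, ← Circle.exp_sub_two_pi]
  congr 1
  ring

theorem mk_loopB_symm (i : Fin g) :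
    Path.Homotopic.Quotient.mk (loopB g i).symm = bandLoop (Sum.inr i) := by
  rw [← mk_eq_bandLoop (Sum.inr i) (baseSegment _ _ (inBase_star g) (inBase_coreB g i))
    (inBase_baseSegment _ _), loopB, Path.trans_symm, Path.trans_symm, Path.symm_symm,
    Path.Homotopic.Quotient.mk_trans, Path.Homotopic.Quotient.mk_trans, ← coreB_symm,
    Path.Homotopic.Quotient.trans_assoc]
  rfl

theorem baseClass_trans {x x' : Base g} (q : Path x x') :
    (baseClass x).trans (.mk (q.map (baseIncl g).continuous)) = baseClass x' := by
  rw [baseClass, baseClass, ← Path.Homotopic.Quotient.mk_trans]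
  exact mk_eq_mk_of_inBase _ _ (inBase_trans _ _ (inBase_baseSegment _ _) fun t => (q t).2)
    (inBase_baseSegment _ _)

theorem baseClass_star : baseClass ⟨_, inBase_star g⟩ = .refl (star g) :=
  mk_eq_mk_of_inBase (baseSegment _ _ (inBase_star g) (inBase_star g)) (Path.refl (star g))
    (inBase_baseSegment _ _) fun _ => inBase_star g

/-- The segments from `⋆` as reference paths for the bands. -/
def bandReferenceSystem (g : ℕ) : ReferenceSystem (baseIncl g) (bandMap g) (bandFoot g)
    (Subgroup.closure (range fun b : BandIndex g => FundamentalGroup.fromPath (bandLoop b))) where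
  path := baseClass
  foot _ := leftFoot
  base q := by
    rw [baseClass_trans]
    exact .refl _
  handle := by
    rintro b ⟨⟨u, hu⟩, t⟩
    have hj (v : sphere (0 : ℝ) 1) : Joined (v, leftFoot.2) (v, t) :=
      ⟨(Path.refl v).prod (PathConnectedSpace.somePath _ _)⟩
    rcases eq_or_eq_neg_of_sq_eq_sq u 1
      ((sq_eq_one_of_mem_sphere hu).trans (one_pow 2).symm) with rfl | rfl
    · exact ⟨rightFoot, hj _, bandPath b, handleCore, fun _ => rfl,
        Subgroup.subset_closure ⟨b, rfl⟩⟩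
    · refine ⟨leftFoot, hj _, Path.refl _, Path.refl _,
        fun _ => ((isHandleAttachment_surface g).glue b _).symm, ?_⟩
      rw [Path.Homotopic.Quotient.mk_refl, Path.Homotopic.Quotient.trans_refl]
      exact .refl _

theorem sameCoset_baseClass_trans {x x' : Base g} (p : Path (baseIncl g x) (baseIncl g x')) :
    SameCoset (Subgroup.closure
        (range fun b : BandIndex g => FundamentalGroup.fromPath (bandLoop b)))
      ((baseClass x).trans (.mk p)) (baseClass x') :=
  (isHandleAttachment_surface g).sameCoset_trans_path (bandReferenceSystem g) p

theorem closure_bandLoop_eq_top (g : ℕ) :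
    Subgroup.closure (range fun b : BandIndex g => FundamentalGroup.fromPath (bandLoop b)) = ⊤ := by
  refine eq_top_iff.2 fun l _ => ?_
  obtain ⟨p, rfl⟩ := Path.Homotopic.Quotient.mk_surjective l
  have key := sameCoset_baseClass_trans (x := ⟨_, inBase_star g⟩) (x' := ⟨_, inBase_star g⟩) p
  rw [baseClass_star] at key
  have h : ((Path.Homotopic.Quotient.refl (star g)).trans (.mk p)).trans
      (Path.Homotopic.Quotient.refl (star g)).symm = .mk p := by
    rw [Path.Homotopic.Quotient.refl_trans]
    exact Path.Homotopic.Quotient.trans_refl _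
  exact h ▸ key

instance (g : ℕ) : PathConnectedSpace (Surface g) where
  nonempty := ⟨star g⟩
  joined := by
    have hstar (x) : Joined (star g) x := by
      rcases (isHandleAttachment_surface g).surj x with ⟨y, rfl⟩ | ⟨⟨b, z⟩, rfl⟩
      · exact ⟨baseSegment _ _ (inBase_star g) y.2⟩
      · have hfoot : Joined (star g) (bandMap g (b, rim leftFoot)) := by
          rw [(isHandleAttachment_surface g).glue]
          exact ⟨baseSegment _ _ (inBase_star g) (bandFoot g (b, leftFoot)).2⟩
        exact hfoot.trans ⟨(PathConnectedSpace.somePath (rim leftFoot) z).map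
          (f := fun z => bandMap g (b, z)) (by fun_prop)⟩
    exact fun x y => (hstar x).symm.trans (hstar y)

end SurfaceLoops

/-! ## Linear forms on twisted homology -/

section WedgeForms

open Topology unitInterval

variable {Y : Type*} [TopologicalSpace Y] {y₀ : Y} {ι : Type*}
variable {R : Type*} [CommRing R] {G : Subgroup Rˣ} {N : Type*} [AddCommGroup N] [Module R N]

/-- The potential of a holonomy in affine transformations with linear part `φ`: the point to which
the origin is transported. -/
def AffinePotential.ofHolonomy (A : Set Y) (φ : H1 Y y₀ →* G) (h : Holonomy Y (N ≃ᵃ[R] N))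
    (hφ : ∀ l : Path.Homotopic.Quotient y₀ y₀, ∀ v, (h l).linear v = weight φ l • v)
    (hA : ∀ {a b : Y} (p : Path a b), (∀ t, p t ∈ A) → h (.mk p) = 1) :
    AffinePotential A φ N where
  toFun γ := h γ 0
  map_translate l x γ := by
    have key := (h l).map_vadd 0 (h γ 0)
    rw [vadd_eq_add, vadd_eq_add, add_zero, hφ] at key
    rw [h.map_trans, AffineEquiv.coe_mul, Function.comp_apply, key, add_comm]
  map_trans_of_mem γ p hp := by rw [h.map_trans, hA p hp, mul_one]

namespace AffinePotential

variable {A : Set Y} {φ : H1 Y y₀ →* G} (τ : AffinePotential A φ N)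

theorem toFun_refl : τ.toFun (.refl y₀) = 0 := by
  have h := τ.map_translate (.refl y₀) (.refl y₀)
  rwa [Path.Homotopic.Quotient.refl_trans, weight_refl, one_smul, left_eq_add] at h

theorem form_edge_conj {a : Y} (w : Path y₀ a) (p : Path a a)
    (hw : τ.toFun (.mk w) = 0)
    (hw' : ∀ γ : Path.Homotopic.Quotient y₀ a, τ.toFun (γ.trans (.mk w.symm)) = τ.toFun γ) :
    τ.form (edge A φ (.mk w) p) =
      τ.toFun (((Path.Homotopic.Quotient.mk w).trans (.mk p)).trans (.mk w.symm)) := by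
  rw [form_edge, hw, sub_zero, hw']

end AffinePotential

/-- The class `l` is represented by a loop which `θ` maps to the loop that runs once through the
`i`-th circle of the wedge, up to constant paths. -/
def IsWedgeLoop [DecidableEq ι] (θ : C(Y, Wedge ι)) (i : ι)
    (l : Path.Homotopic.Quotient y₀ y₀) : Prop :=
  ∃ (a b : Y) (u : Path y₀ a) (p : Path a b) (v : Path b y₀),
    l = ((Path.Homotopic.Quotient.mk u).trans (.mk p)).trans (.mk v) ∧ (∀ t, θ (u t) = 1) ∧
      (∀ t : I, θ (p t) = Wedge.incl i (Circle.exp (2 * Real.pi * t))) ∧ ∀ t, θ (v t) = 1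

theorem exists_holonomy_of_isWedgeLoop {Γ : Type*} [Group Γ] [Finite ι] [DecidableEq ι]
    (θ : C(Y, Wedge ι)) (m : ι → Path.Homotopic.Quotient y₀ y₀) (hθ : ∀ i, IsWedgeLoop θ i (m i))
    (γ : ι → Γ) :
    ∃ h : Holonomy Y Γ, (∀ {a b : Y} (p : Path a b), (∀ t, θ (p t) = 1) → h (.mk p) = 1) ∧
      ∀ i, h (m i) = γ i := by
  obtain ⟨h, h_one, h_incl⟩ := exists_wedge_holonomy γ
  have hc : ∀ {a b : Y} (p : Path a b), (∀ t, θ (p t) = 1) → h.comap θ (.mk p) = 1 :=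
    fun p hp => h_one (p.map θ.continuous) hp
  refine ⟨h.comap θ, hc, fun i => ?_⟩
  obtain ⟨a, b, u, p, v, hl, hu, hp, hv⟩ := hθ i
  rw [hl, Holonomy.map_trans, Holonomy.map_trans, hc u hu, hc v hv, one_mul, mul_one]
  exact h_incl (p.map θ.continuous) i hp

theorem Holonomy.linear_eq_weight (h : Holonomy Y (N ≃ᵃ[R] N)) (φ : H1 Y y₀ →* G)
    {m : ι → Path.Homotopic.Quotient y₀ y₀}
    (hm : Subgroup.closure (range fun i => FundamentalGroup.fromPath (m i)) = ⊤)
    (hφ : ∀ i v, (h (m i)).linear v = weight φ (m i) • v)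
    (l : Path.Homotopic.Quotient y₀ y₀) (v : N) : (h l).linear v = weight φ l • v := by
  have hl : FundamentalGroup.fromPath l ∈
      Subgroup.closure (range fun i => FundamentalGroup.fromPath (m i)) := hm ▸ Subgroup.mem_top _
  refine Subgroup.closure_induction
    (p := fun l _ => ∀ v, (h (FundamentalGroup.toPath l)).linear v =
      weight φ (FundamentalGroup.toPath l) • v) ?_ ?_ ?_ ?_ hl v
  · rintro _ ⟨i, rfl⟩
    exact hφ i
  · intro v
    change (h (.refl y₀)).linear v = weight φ (.refl y₀) • v
    rw [h.map_refl, weight_refl, one_smul]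
    rfl
  · intro l l' _ _ hl hl' v
    change (h (Path.Homotopic.Quotient.trans l' l)).linear v =
      weight φ (Path.Homotopic.Quotient.trans l' l) • v
    rw [h.map_trans, weight_trans, mul_smul]
    exact (hl' _).trans (congrArg _ (hl v))
  · intro l _ hl v
    change (h (Path.Homotopic.Quotient.symm l)).linear v =
      weight φ (Path.Homotopic.Quotient.symm l) • v
    rw [h.map_symm]
    refine (h l).linear.injective ?_
    refine ((h l).linear.apply_symm_apply v).trans (.trans ?_ (hl _).symm)
    change v = weight φ l • weight φ (Path.Homotopic.Quotient.symm l) • v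
    rw [smul_smul, ← weight_trans, Path.Homotopic.Quotient.trans_symm, weight_refl, one_smul]

/-- The affine transformations `v ↦ c i + φ(m i) v` prescribe a holonomy on the wedge; since the
`m i` generate, the linear part of the pulled back holonomy is `φ`. -/
theorem exists_affinePotential [Finite ι] [DecidableEq ι] {θ : C(Y, Wedge ι)} {A : Set Y}
    (hA : ∀ x ∈ A, θ x = 1) {m : ι → Path.Homotopic.Quotient y₀ y₀}
    (hm : Subgroup.closure (range fun i => FundamentalGroup.fromPath (m i)) = ⊤)
    (hθ : ∀ i, IsWedgeLoop θ i (m i)) (φ : H1 Y y₀ →* G) (c : ι → N) :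
    ∃ τ : AffinePotential A φ N, (∀ i, τ.toFun (m i) = c i) ∧
      ∀ {a b : Y} (γ : Path.Homotopic.Quotient y₀ a) (p : Path a b), (∀ t, θ (p t) = 1) →
        τ.toFun (γ.trans (.mk p)) = τ.toFun γ := by
  obtain ⟨h, h_one, h_gen⟩ := exists_holonomy_of_isWedgeLoop θ m hθ fun i =>
    AffineEquiv.constVAdd R N (c i) * (LinearEquiv.smulOfUnit
      (φ (Abelianization.of (FundamentalGroup.fromPath (m i))) : Rˣ)).toAffineEquiv
  have hφ := h.linear_eq_weight φ hm fun i v => by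
    rw [h_gen]
    rfl
  refine ⟨.ofHolonomy A φ h hφ fun p hp => h_one p fun t => hA _ (hp t), fun i => ?_,
    fun γ p hp => ?_⟩
  · change h (m i) 0 = c i
    rw [h_gen, AffineEquiv.coe_mul, Function.comp_apply, LinearEquiv.coe_toAffineEquiv, map_zero,
      AffineEquiv.constVAdd_apply, vadd_eq_add, add_zero]
  · change h (γ.trans (.mk p)) 0 = h γ 0
    rw [h.map_trans, h_one p hp, mul_one]

theorem exists_form_edge [Finite ι] [DecidableEq ι] {θ : C(Y, Wedge ι)} {A : Set Y}
    (hA : ∀ x ∈ A, θ x = 1) {m : ι → Path.Homotopic.Quotient y₀ y₀}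
    (hm : Subgroup.closure (range fun i => FundamentalGroup.fromPath (m i)) = ⊤)
    (hθ : ∀ i, IsWedgeLoop θ i (m i)) (φ : H1 Y y₀ →* G) (c : ι → N) :
    ∃ F : ChainModBoundaries A φ →ₗ[R] N, ∀ (i : ι) {a : Y} (w : Path y₀ a) (p : Path a a),
      (∀ t, θ (w t) = 1) →
      ((Path.Homotopic.Quotient.mk w).trans (.mk p)).trans (.mk w.symm) = m i →
      F (edge A φ (.mk w) p) = c i := by
  obtain ⟨τ, τ_gen, τ_trans⟩ := exists_affinePotential hA hm hθ φ c
  refine ⟨τ.form, fun i a w p hw hp => ?_⟩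
  have hw0 : τ.toFun (.mk w) = 0 := by
    rw [← Path.Homotopic.Quotient.refl_trans (.mk w), τ_trans _ w hw, τ.toFun_refl]
  rw [τ.form_edge_conj w p hw0 fun γ => τ_trans γ w.symm fun t => hw _, hp, τ_gen]

end WedgeForms

section Collapse

open Topology unitInterval Metric

variable {g : ℕ}

/-- The sign that relates the orientation of the loop through a band to that of its core. -/
def bandSign : BandIndex g → ℝ
  | .inl _ => 1
  | .inr _ => -1

/-- The meridians and the parallels. -/
def bandRep (g : ℕ) : BandIndex g → Path (star g) (star g)
  | .inl i => loopA g i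
  | .inr i => loopB g i

theorem exp_bandSign_of_mem_sphere (b : BandIndex g) (u : sphere (0 : ℝ) 1) :
    Circle.exp (Real.pi * (1 + bandSign b * u)) = 1 := by
  have h : bandSign b * (u : ℝ) = 1 ∨ bandSign b * (u : ℝ) = -1 := by
    rcases eq_or_eq_neg_of_abs_eq (mem_sphere_zero_iff_norm.1 u.2) with h | h <;>
      rcases b with i | i <;> simp [bandSign, h]
  rcases h with h | h <;> rw [h]
  · rw [one_add_one_eq_two, mul_comm, Circle.exp_two_pi]
  · rw [add_neg_cancel, mul_zero, Circle.exp_zero]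

/-- The map from a handle of `F_g` to the wedge that collapses the direction transverse to the
core. -/
def collapseHandle (g : ℕ) :
    C(BandIndex g × closedBall (0 : ℝ) 1 × Icc (2 : ℝ) 4, Wedge (BandIndex g)) where
  toFun x := Wedge.incl x.1 (Circle.exp (Real.pi * (1 + bandSign x.1 * x.2.1)))
  continuous_toFun := continuous_prod_of_discrete_left.2 fun b => by fun_prop

theorem collapseHandle_rim (b : BandIndex g) (u : sphere (0 : ℝ) 1 × Icc (2 : ℝ) 4) :
    collapseHandle g (b, rim u) = 1 :=
  (congrArg (Wedge.incl b) (exp_bandSign_of_mem_sphere b u.1)).trans (Wedge.incl_one b)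

/-- The map from `F_g` to a wedge of circles that collapses the rectangle and the directions
transverse to the cores of the bands. -/
def collapse (g : ℕ) : C(Surface g, Wedge (BandIndex g)) where
  toFun := (isHandleAttachment_surface g).lift (fun _ => 1) (collapseHandle g)
  continuous_toFun := by
    refine (isHandleAttachment_surface g).continuous ?_ ?_
    · simp only [(isHandleAttachment_surface g).lift_base (G₀ := fun _ => 1) collapseHandle_rim]
      exact continuous_const
    · simp only [(isHandleAttachment_surface g).lift_handle (G₀ := fun _ => 1) collapseHandle_rim]
      exact (collapseHandle g).continuous

theorem collapse_of_inBase {x : Surface g} (hx : InBase g x.1) : collapse g x = 1 :=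
  (isHandleAttachment_surface g).lift_base collapseHandle_rim ⟨x.1, hx⟩

theorem collapse_bandMap (b : BandIndex g) (z : closedBall (0 : ℝ) 1 × Icc (2 : ℝ) 4) :
    collapse g (bandMap g (b, z)) =
      Wedge.incl b (Circle.exp (Real.pi * (1 + bandSign b * z.1))) :=
  (isHandleAttachment_surface g).lift_handle collapseHandle_rim (b, z)

theorem collapse_bandPath (b : BandIndex g) (t : I) : collapse g (bandPath b t) =
    Wedge.incl b (Circle.exp (Real.pi * (1 + bandSign b * (2 * t - 1)))) :=
  collapse_bandMap b (handleCore t)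

theorem exists_bandRep_eq (b : BandIndex g) : ∃ (x y : Base g)
    (p : Path (baseIncl g x) (baseIncl g y)), Path.Homotopic.Quotient.mk (bandRep g b) =
      ((baseClass x).trans (.mk p)).trans (baseClass y).symm ∧
      ∀ t : I, collapse g (p t) = Wedge.incl b (Circle.exp (2 * Real.pi * t)) := by
  rcases b with i | i
  · refine ⟨_, _, bandPath (Sum.inl i), mk_loopA i, fun t => ?_⟩
    rw [collapse_bandPath, bandSign]
    congr 2
    ring
  · refine ⟨_, _, (bandPath (Sum.inr i)).symm, ?_, fun t => ?_⟩
    · have h := congrArg Path.Homotopic.Quotient.symm (mk_loopB_symm i)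
      rw [← Path.Homotopic.Quotient.mk_symm, Path.symm_symm] at h
      refine h.trans ?_
      rw [bandLoop, symm_quotient_trans, symm_quotient_symm, symm_quotient_trans,
        Path.Homotopic.Quotient.mk_symm, Path.Homotopic.Quotient.trans_assoc]
    · rw [Path.symm_apply, Function.comp_apply, collapse_bandPath, bandSign,
        unitInterval.coe_symm_eq]
      congr 2
      ring

theorem closure_bandRep_eq_top (g : ℕ) : Subgroup.closure
    (range fun b => FundamentalGroup.fromPath (.mk (bandRep g b))) = ⊤ := by
  rw [eq_top_iff, ← closure_bandLoop_eq_top, Subgroup.closure_le]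
  rintro _ ⟨i | i, rfl⟩
  · exact Subgroup.subset_closure ⟨Sum.inl i, congrArg FundamentalGroup.fromPath (mk_loopA i)⟩
  · have h : FundamentalGroup.fromPath (bandLoop (Sum.inr i)) =
        (FundamentalGroup.fromPath (.mk (bandRep g (Sum.inr i))))⁻¹ :=
      congrArg FundamentalGroup.fromPath (mk_loopB_symm i).symm
    change FundamentalGroup.fromPath (bandLoop (Sum.inr i)) ∈ Subgroup.closure _
    rw [h]
    exact inv_mem (Subgroup.subset_closure ⟨_, rfl⟩)

theorem isWedgeLoop_bandRep (b : BandIndex g) :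
    IsWedgeLoop (collapse g) b (.mk (bandRep g b)) := by
  obtain ⟨x, y, p, h, hp⟩ := exists_bandRep_eq b
  exact ⟨_, _, baseSegment _ _ (inBase_star g) x.2, p, (baseSegment _ _ (inBase_star g) y.2).symm,
    h, fun t => collapse_of_inBase (inBase_baseSegment (inBase_star g) x.2 t), hp,
    fun t => collapse_of_inBase (inBase_baseSegment (inBase_star g) y.2 (σ t))⟩

end Collapse

section Independence

variable {R : Type*} [CommRing R] {G : Subgroup Rˣ}

theorem linearIndependent_of_forms {H κ : Type*} [AddCommGroup H] [Module R H] [DecidableEq κ]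
    (e : κ → H) (F : κ → H →ₗ[R] R) (hF : ∀ i j, F i (e j) = (Pi.single i 1 : κ → R) j) :
    LinearIndependent R e := by
  refine LinearIndependent.of_comp (LinearMap.pi F) ?_
  have h : LinearMap.pi F ∘ e = fun j => (Pi.single j 1 : κ → R) := by
    ext j i
    simp [hF, Pi.single_apply, eq_comm]
  rw [h]
  exact Pi.linearIndependent_single_one κ R

theorem linearIndependent_bandRep {g : ℕ} (φ : H1 (Surface g) (star g) →* G) :
    LinearIndependent R fun b => loopClass φ (bandRep g b) := by
  have hstar : ∀ x ∈ ({star g} : Set (Surface g)), collapse g x = 1 := by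
    rintro _ rfl
    exact collapse_of_inBase (inBase_star g)
  choose F hF using fun b => exists_form_edge hstar (closure_bandRep_eq_top g)
    isWedgeLoop_bandRep φ (Pi.single b 1 : BandIndex g → R)
  refine linearIndependent_of_forms _ (fun b => F b ∘ₗ homologyToChains {star g} φ) fun b b' => ?_
  rw [LinearMap.comp_apply, homologyToChains_loopClass]
  refine hF b b' (Path.refl _) (bandRep g b') (fun t => hstar _ rfl) ?_
  rw [Path.refl_symm, Path.Homotopic.Quotient.mk_refl, Path.Homotopic.Quotient.refl_trans,
    Path.Homotopic.Quotient.trans_refl]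

theorem loopClass_mem_span {X : Type*} [TopologicalSpace X] {x₀ : X} (φ : H1 X x₀ →* G)
    {ι : Type*} {m : ι → Path x₀ x₀} {p : Path x₀ x₀} (hp : FundamentalGroup.fromPath (.mk p) ∈
      Subgroup.closure (range fun i => FundamentalGroup.fromPath (.mk (m i)))) :
    loopClass φ p ∈ Submodule.span R (range fun i => loopClass φ (m i)) := by
  set N := Submodule.span R (range fun i => loopClass φ (m i))
  suffices h : ∀ q, Path.Homotopic.Quotient.mk q = .mk p → loopClass φ q ∈ N from h p rfl
  refine Subgroup.closure_induction (p := fun l _ => ∀ q : Path x₀ x₀,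
    Path.Homotopic.Quotient.mk q = FundamentalGroup.toPath l → loopClass φ q ∈ N) ?_ ?_ ?_ ?_ hp
  · rintro _ ⟨i, rfl⟩ q hq
    rw [loopClass_homotopic φ (Path.Homotopic.Quotient.eq.1 hq)]
    exact Submodule.subset_span ⟨i, rfl⟩
  · intro q hq
    rw [loopClass_homotopic φ (q := Path.refl _) (Path.Homotopic.Quotient.eq.1 hq), loopClass_refl]
    exact N.zero_mem
  · intro l l' _ _ hl hl' q hq
    obtain ⟨r, rfl⟩ := Path.Homotopic.Quotient.mk_surjective l
    obtain ⟨r', rfl⟩ := Path.Homotopic.Quotient.mk_surjective l'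
    rw [loopClass_homotopic φ (q := r'.trans r) (Path.Homotopic.Quotient.eq.1 hq), loopClass_trans]
    exact N.add_mem (hl' r' rfl) (N.smul_mem _ (hl r rfl))
  · intro l _ hl q hq
    obtain ⟨r, rfl⟩ := Path.Homotopic.Quotient.mk_surjective l
    rw [loopClass_homotopic φ (q := r.symm) (Path.Homotopic.Quotient.eq.1 hq), loopClass_symm]
    exact N.neg_mem (N.smul_mem _ (hl r rfl))

theorem span_bandRep {g : ℕ} (φ : H1 (Surface g) (star g) →* G) :
    Submodule.span R (range fun b => loopClass φ (bandRep g b)) = ⊤ := by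
  rw [eq_top_iff, ← span_loopClass_eq_top φ, Submodule.span_le]
  rintro _ ⟨p, rfl⟩
  exact loopClass_mem_span φ (closure_bandRep_eq_top g ▸ Subgroup.mem_top _)

theorem subsingleton_twistedH1_disk (φ : H1 (Surface 0) (star 0) →* G) :
    Subsingleton (TwistedH1 {star 0} φ) := by
  have h := span_bandRep φ
  rw [range_eq_empty, Submodule.span_empty] at h
  exact (Submodule.subsingleton_iff R).1 (subsingleton_of_bot_eq_top h)

end Independence

/-! ## Fundamental groups of handle attachments -/

section MapAlong

variable {X Y : Type*} [TopologicalSpace X] [TopologicalSpace Y] {x₀ : X} {y₀ : Y}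

/-- The homomorphism of fundamental groups induced by `f`, where the base points are related by a
path from `y₀` to `f x₀`. -/
def mapAlong (f : C(X, Y)) (w : Path y₀ (f x₀)) :
    FundamentalGroup X x₀ →* FundamentalGroup Y y₀ :=
  (FundamentalGroup.fundamentalGroupMulEquivOfPath w).symm.toMonoidHom.comp
    (FundamentalGroup.map f x₀)

theorem mapAlong_fromPath (f : C(X, Y)) (w : Path y₀ (f x₀))
    (l : Path.Homotopic.Quotient x₀ x₀) : mapAlong f w (FundamentalGroup.fromPath l) =
      FundamentalGroup.fromPath
        (((Path.Homotopic.Quotient.mk w).trans (l.map f)).trans (.mk w.symm)) := by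
  rw [Path.Homotopic.Quotient.trans_assoc]
  rfl

theorem mapAlong_eq_one {f : C(X, Y)} (w : Path y₀ (f x₀)) {p : Path x₀ x₀}
    (hp : Path.Homotopic.Quotient.mk (p.map f.continuous) = .refl _) :
    mapAlong f w (FundamentalGroup.fromPath (.mk p)) = 1 := by
  rw [mapAlong_fromPath, ← Path.Homotopic.Quotient.mk_map, hp,
    Path.Homotopic.Quotient.trans_refl, Path.Homotopic.Quotient.mk_symm,
    Path.Homotopic.Quotient.trans_symm]
  rfl

theorem mk_map_conj_eq_refl (f : C(X, Y)) {a b : X} (u : Path a b) {p : Path b b}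
    (hp : Path.Homotopic.Quotient.mk (p.map f.continuous) = .refl _) :
    Path.Homotopic.Quotient.mk (((u.trans p).trans u.symm).map f.continuous) = .refl _ := by
  rw [Path.map_trans, Path.map_trans, Path.Homotopic.Quotient.mk_trans,
    Path.Homotopic.Quotient.mk_trans, hp, Path.Homotopic.Quotient.trans_refl, ← Path.map_symm,
    Path.Homotopic.Quotient.mk_symm, Path.Homotopic.Quotient.trans_symm]

theorem mapAlong_comp {Z : Type*} [TopologicalSpace Z] (f : C(Y, Z)) (f' : C(X, Y)) {z₀ : Z}
    (w : Path z₀ (f (f' x₀))) :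
    mapAlong (f.comp f') w = (mapAlong f w).comp (FundamentalGroup.map f' x₀) := by
  ext l
  obtain ⟨p, rfl⟩ := Path.Homotopic.Quotient.mk_surjective l
  rfl

theorem surjective_map_prodMk_const {T : Type*} [TopologicalSpace T] [SimplyConnectedSpace T]
    (x₀ : X) (t : T) : Function.Surjective
      (FundamentalGroup.map ((ContinuousMap.id X).prodMk (ContinuousMap.const X t)) x₀) := by
  intro l
  obtain ⟨p, hp⟩ : ∃ p : Path (x₀, t) (x₀, t), FundamentalGroup.fromPath (.mk p) = l :=
    Path.Homotopic.Quotient.mk_surjective l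
  have hsnd : Path.Homotopic.Quotient.mk (p.map continuous_snd) = .mk (Path.refl t) :=
    Path.Homotopic.Quotient.eq.2 (SimplyConnectedSpace.paths_homotopic _ _)
  refine ⟨FundamentalGroup.fromPath (.mk (p.map continuous_fst)), ?_⟩
  exact (congrArg (Path.Homotopic.prod (.mk (p.map continuous_fst))) hsnd.symm).trans hp

theorem mk_map_slice_eq_refl {T : Type*} [TopologicalSpace T] [PathConnectedSpace T]
    (F : C(X × T, Y)) {x : X} (p : Path x x) {s : T} (t : T)
    (hs : Path.Homotopic.Quotient.mk (p.map (f := fun x => F (x, s)) (by fun_prop)) = .refl _) :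
    Path.Homotopic.Quotient.mk (p.map (f := fun x => F (x, t)) (by fun_prop)) = .refl _ := by
  let r : Path t s := PathConnectedSpace.somePath t s
  let v : Path (F (x, t)) (F (x, s)) := r.map (f := fun t => F (x, t)) (by fun_prop)
  have square := mk_trans_eq_of_square
    (F.comp ⟨fun y : unitInterval × unitInterval => (p y.2, r y.1), by fun_prop⟩)
    (p.map (f := fun x => F (x, t)) (by fun_prop)) v v
    (p.map (f := fun x => F (x, s)) (by fun_prop))
    (fun _ => by simp) (fun _ => by simp [v]) (fun _ => by simp [v]) (fun _ => by simp)
  rw [hs, Path.Homotopic.Quotient.trans_refl] at square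
  have cancel := congrArg (fun l => l.trans (Path.Homotopic.Quotient.mk v).symm) square
  simpa only [Path.Homotopic.Quotient.trans_assoc, Path.Homotopic.Quotient.trans_symm,
    Path.Homotopic.Quotient.trans_refl] using cancel

theorem closure_range_comp_eq_top {Γ Δ ι κ : Type*} [Group Γ] [Group Δ] {h : Γ →* Δ}
    (hh : Function.Surjective h) {m : ι → Γ} (hm : Subgroup.closure (range m) = ⊤) {f : κ → ι}
    (hf : ∀ i, h (m i) = 1 ∨ i ∈ range f) :
    Subgroup.closure (range fun k => h (m (f k))) = ⊤ := by
  rw [eq_top_iff, ← MonoidHom.range_eq_top.2 hh, MonoidHom.range_eq_map, ← hm,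
    MonoidHom.map_closure, Subgroup.closure_le]
  rintro _ ⟨_, ⟨i, rfl⟩, rfl⟩
  rcases hf i with hi | ⟨k, rfl⟩
  · exact hi ▸ one_mem _
  · exact Subgroup.subset_closure ⟨k, rfl⟩

end MapAlong

namespace IsHandleAttachment

open Metric

variable {X Y ι E T : Type*} [TopologicalSpace X] [TopologicalSpace Y] [TopologicalSpace ι]
  [NormedAddCommGroup E] [TopologicalSpace T] {j : C(X, Y)}
  {k : C(ι × closedBall (0 : E) 1 × T, Y)} {f : C(ι × sphere (0 : E) 1 × T, X)}

/-- The reference paths in `X` for the image of the fundamental group of `X`, when the attaching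
regions are connected. -/
def imageReferenceSystem [PathConnectedSpace X] [PathConnectedSpace (sphere (0 : E) 1 × T)]
    (h : IsHandleAttachment j k f) {x₀ : X} {y₀ : Y} (w : Path y₀ (j x₀)) :
    ReferenceSystem j k f (mapAlong j w).range where
  path x := (Path.Homotopic.Quotient.mk w).trans
    (.mk ((PathConnectedSpace.somePath x₀ x).map j.continuous))
  foot _ := Classical.arbitrary _
  base {x x'} q := by
    let η : ∀ x, Path x₀ x := PathConnectedSpace.somePath x₀
    refine ⟨FundamentalGroup.fromPath (.mk (((η x).trans q).trans (η x').symm)), ?_⟩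
    rw [mapAlong_fromPath]
    rw [← Path.Homotopic.Quotient.mk_map]
    simp only [Path.map_trans, ← Path.map_symm,
      Path.Homotopic.Quotient.mk_trans, Path.Homotopic.Quotient.mk_symm, symm_quotient_trans,
      Path.Homotopic.Quotient.trans_assoc, η]
  handle i u := ⟨_, PathConnectedSpace.joined _ _, Path.refl _, Path.refl _,
    fun _ => (h.glue i _).symm, by
      rw [Path.Homotopic.Quotient.mk_refl, Path.Homotopic.Quotient.trans_refl]
      exact .refl _⟩

variable [NormedSpace ℝ E] [ContractibleSpace T]

theorem surjective_mapAlong [DiscreteTopology ι] [PathConnectedSpace X]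
    [PathConnectedSpace (sphere (0 : E) 1 × T)] (h : IsHandleAttachment j k f) {x₀ : X} {y₀ : Y}
    (w : Path y₀ (j x₀)) : Function.Surjective (mapAlong j w) := by
  intro l
  let α : Path.Homotopic.Quotient y₀ (j x₀) := (h.imageReferenceSystem w).path x₀
  obtain ⟨p, hp⟩ := Path.Homotopic.Quotient.mk_surjective
    ((α.symm.trans (FundamentalGroup.toPath l)).trans α)
  have key : FundamentalGroup.fromPath ((α.trans (.mk p)).trans α.symm) ∈ (mapAlong j w).range :=
    h.sameCoset_trans_path (h.imageReferenceSystem w) (x := x₀) (x' := x₀) p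
  have hl : (α.trans (.mk p)).trans α.symm = FundamentalGroup.toPath l := by
    rw [hp]
    simp only [Path.Homotopic.Quotient.trans_assoc, trans_symm_cancel,
      Path.Homotopic.Quotient.trans_symm, Path.Homotopic.Quotient.trans_refl]
  exact MonoidHom.mem_range.1 (hl.subst (motive := (FundamentalGroup.fromPath · ∈ _)) key)

theorem mk_map_attach_eq_refl (h : IsHandleAttachment j k f) (i : ι)
    {u : sphere (0 : E) 1 × T} (a : Path u u) {x : X} (p : Path x x)
    (hp : ∀ r, p r = f (i, a r)) : Path.Homotopic.Quotient.mk (p.map j.continuous) = .refl _ := by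
  have hx : x = f (i, u) := by rw [← p.source, hp, a.source]
  rw [← Path.Homotopic.Quotient.mk_refl]
  exact mk_eq_mk_of_handle i _ _ (a.map rim.continuous) (Path.refl (rim u))
    (fun r => (congrArg j (hp r)).trans (h.glue i (a r)).symm)
    (fun _ => (congrArg j hx).trans (h.glue i u).symm)

end IsHandleAttachment

/-! ## The handlebodies -/

section HandlebodyTopology

open Topology unitInterval Metric

variable {g : ℕ} (c : Fin g → C(Circle × J, Surface g)) (e : J)

instance : ContractibleSpace J := (convex_Icc (-1 : ℝ) 1).contractibleSpace ⟨0, by norm_num⟩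

/-- The unit sphere of `ℂ`, as the circle group. -/
def sphereToCircle : C(sphere (0 : ℂ) 1, Circle) where
  toFun u := ⟨u.1, u.2⟩
  continuous_toFun := Continuous.subtype_mk continuous_subtype_val _

namespace Handlebody

/-- The handles of a handlebody. -/
def handle : C(Fin g × closedBall (0 : ℂ) 1 × J, Handlebody c e) where
  toFun x := Quot.mk _ (Sum.inr x)
  continuous_toFun := continuous_quot_mk.comp continuous_inr

/-- The attaching map of the handles of a handlebody. -/
def attach : C(Fin g × sphere (0 : ℂ) 1 × J, Surface g × J) where
  toFun x := (c x.1 (sphereToCircle x.2.1, x.2.2), e)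
  continuous_toFun := by
    refine Continuous.prodMk (continuous_prod_of_discrete_left.2 fun i => ?_) continuous_const
    fun_prop

theorem handle_rim (i : Fin g) (u : sphere (0 : ℂ) 1 × J) :
    handle c e (i, rim u) = cyl c e (attach c e (i, u)) :=
  (Quot.sound (HandleRel.glue (c := c) (e := e) i (sphereToCircle u.1) u.2)).symm

open Classical in
/-- The representative of a point of a handlebody in `F_g × [-1, 1]` or in the interior of a
handle. -/
def normalForm : Handlebody c e → (Surface g × J) ⊕ (Fin g × closedBall (0 : ℂ) 1 × J) :=
  Quot.lift
    (Sum.elim Sum.inl fun z => if h : ‖(z.2.1 : ℂ)‖ = 1 then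
      .inl (attach c e (z.1, ⟨z.2.1, mem_sphere_zero_iff_norm.2 h⟩, z.2.2)) else .inr z)
    (by
      rintro _ _ ⟨i, u, t⟩
      simp only [Sum.elim_inl, Sum.elim_inr, Circle.norm_coe, dite_true]
      rfl)

theorem normalForm_cyl (x : Surface g × J) : normalForm c e (cyl c e x) = .inl x := rfl

theorem normalForm_handle {z : Fin g × closedBall (0 : ℂ) 1 × J} (hz : ‖(z.2.1 : ℂ)‖ ≠ 1) :
    normalForm c e (handle c e z) = .inr z :=
  dif_neg hz

theorem isHandleAttachment : IsHandleAttachment (cyl c e) (handle c e) (attach c e) where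
  isQuotientMap := by
    have h : Sum.elim (cyl c e) (handle c e) = Quot.mk (HandleRel c e) := by
      funext x
      rcases x with x | x <;> rfl
    exact h ▸ isQuotientMap_quot_mk
  glue := handle_rim c e
  injective x y hxy := Sum.inl_injective (congrArg (normalForm c e) hxy)
  norm_eq_one x z hxz := by
    by_contra hz
    have h := congrArg (normalForm c e) hxz
    rw [normalForm_handle c e hz, normalForm_cyl] at h
    exact Sum.inr_ne_inl h
  injective_of_norm_lt z z' hz heq := by
    have h := congrArg (normalForm c e) heq
    rw [normalForm_handle c e hz.ne] at h
    by_cases hz' : ‖(z'.2.1 : ℂ)‖ = 1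
    · exact absurd (h.trans (dif_pos hz')) Sum.inr_ne_inl
    · exact Sum.inr_injective (h.trans (normalForm_handle c e hz'))

variable {c e}

theorem surjective_mapAlong_level {t : J} {x : Surface g} {y₀ : Handlebody c e}
    (w : Path y₀ (level c e t x)) : Function.Surjective (mapAlong (level c e t) w) := by
  have : PathConnectedSpace (sphere (0 : ℂ) 1) :=
    isPathConnected_iff_pathConnectedSpace.1 <| isPathConnected_sphere
      (Complex.rank_real_complex ▸ Cardinal.one_lt_two) _ zero_le_one
  exact (mapAlong_comp (cyl c e) ((ContinuousMap.id _).prodMk (.const _ t)) w) ▸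
    ((isHandleAttachment c e).surjective_mapAlong w).comp (surjective_map_prodMk_const x t)

theorem mk_level_eq_refl (i : Fin g) (t : J) {x : Surface g} (p : Path x x) (γ : C(I, Circle))
    (hγ : γ 0 = γ 1) (hp : ∀ r, p r = c i (γ r, jMid)) :
    Path.Homotopic.Quotient.mk (p.map (level c e t).continuous) = .refl _ := by
  let a : C(I, sphere (0 : ℂ) 1 × J) := ⟨fun r => (⟨γ r, (γ r).2⟩, jMid), by fun_prop⟩
  have ha : a 1 = a 0 := 
    congrArg (fun z : Circle => ((⟨z, z.2⟩ : sphere (0 : ℂ) 1), jMid)) hγ.symm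
  refine mk_map_slice_eq_refl (cyl c e) p (s := e) t ?_
  exact (isHandleAttachment c e).mk_map_attach_eq_refl i ⟨a, rfl, ha⟩
    (p.map (f := fun x => (x, e)) (by fun_prop)) fun r => congrArg (·, e) (hp r)

end Handlebody

end HandlebodyTopology

section BandHandlebody

open Topology unitInterval Metric

/-- The map between wedges that forgets the circles that are not indexed by `κ`. -/
def wedgeRestrict {ι κ : Type*} (f : κ → ι) (hf : Function.Injective f) :
    C(Wedge ι, Wedge κ) where
  toFun θ := ⟨fun k => θ.1 (f k), fun _ _ h => θ.2 _ _ (hf.ne h)⟩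
  continuous_toFun :=
    Continuous.subtype_mk (continuous_pi fun k => Wedge.continuous_coord (f k)) _

theorem wedgeRestrict_one {ι κ : Type*} (f : κ → ι) (hf : Function.Injective f) :
    wedgeRestrict f hf 1 = 1 := rfl

theorem wedgeRestrict_incl {ι κ : Type*} [DecidableEq ι] [DecidableEq κ] (f : κ → ι)
    (hf : Function.Injective f) (k : κ) (u : Circle) :
    wedgeRestrict f hf (Wedge.incl (f k) u) = Wedge.incl k u := by
  refine Subtype.ext (funext fun k' => ?_)
  change (Wedge.incl (f k) u).1 (f k') = _
  by_cases h : k' = k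
  · rw [h, Wedge.incl_same, Wedge.incl_same]
  · rw [Wedge.incl_of_ne h, Wedge.incl_of_ne (hf.ne h)]

theorem wedgeRestrict_incl_of_notMem_range {ι κ : Type*} [DecidableEq ι] (f : κ → ι)
    (hf : Function.Injective f) {i : ι} (hi : i ∉ range f) (u : Circle) :
    wedgeRestrict f hf (Wedge.incl i u) = 1 :=
  Subtype.ext (funext fun k => Wedge.incl_of_ne (fun h => hi ⟨k, h⟩) u)

namespace IsWedgeLoop

variable {X Y : Type*} [TopologicalSpace X] [TopologicalSpace Y] {x₀ : X} {y₀ : Y} {ι : Type*}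
  [DecidableEq ι]

theorem restrict {κ : Type*} [DecidableEq κ] {θ : C(Y, Wedge ι)} {f : κ → ι}
    (hf : Function.Injective f) {k : κ} {l : Path.Homotopic.Quotient y₀ y₀}
    (h : IsWedgeLoop θ (f k) l) : IsWedgeLoop ((wedgeRestrict f hf).comp θ) k l := by
  obtain ⟨a, b, u, p, v, hl, hu, hp, hv⟩ := h
  exact ⟨a, b, u, p, v, hl, fun t => congrArg (wedgeRestrict f hf) (hu t),
    fun t => (congrArg (wedgeRestrict f hf) (hp t)).trans (wedgeRestrict_incl f hf k _),
    fun t => congrArg (wedgeRestrict f hf) (hv t)⟩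

theorem map_conj {f : C(X, Y)} {θ : C(Y, Wedge ι)} {i : ι}
    {l : Path.Homotopic.Quotient x₀ x₀} (h : IsWedgeLoop (θ.comp f) i l) (w : Path y₀ (f x₀))
    (hw : ∀ t, θ (w t) = 1) :
    IsWedgeLoop θ i (((Path.Homotopic.Quotient.mk w).trans (l.map f)).trans (.mk w.symm)) := by
  obtain ⟨a, b, u, p, v, rfl, hu, hp, hv⟩ := h
  have trans_eq_one : ∀ {a b c : Y} (p : Path a b) (q : Path b c), (∀ t, θ (p t) = 1) →
      (∀ t, θ (q t) = 1) → ∀ t, θ ((p.trans q) t) = 1 := fun p q hp hq t => by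
    rw [Path.trans_apply]
    split_ifs
    exacts [hp _, hq _]
  refine ⟨f a, f b, w.trans (u.map f.continuous), p.map f.continuous,
    (v.map f.continuous).trans w.symm, ?_, trans_eq_one _ _ hw hu, hp,
    trans_eq_one _ _ hv fun t => hw _⟩
  simp only [← Path.Homotopic.Quotient.mk_trans, ← Path.Homotopic.Quotient.mk_map, Path.map_trans]
  simp only [Path.Homotopic.Quotient.mk_trans, Path.Homotopic.Quotient.trans_assoc]

end IsWedgeLoop

/-- The space obtained from `F_g × [-1, 1]` by attaching the `i`-th handle along the annulus
`S¹ × [-1, 1]` that runs through the band `kill i`, at height `e`; this covers the lower and the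
upper handlebody. -/
abbrev BandHandlebody {g : ℕ} (kill : Fin g → BandIndex g) (e : J) : Type :=
  Handlebody (fun i => bandAnnulus g (kill i)) e

namespace BandHandlebody

variable {g : ℕ} {kill : Fin g → BandIndex g} {e t : J} {κ : Type*} {keep : κ → BandIndex g}

/-- The inclusion of `F_g` at height `t`. -/
abbrev level (kill : Fin g → BandIndex g) (e t : J) : C(Surface g, BandHandlebody kill e) :=
  Handlebody.level _ e t

theorem mk_bandRep_eq_refl (i : Fin g) (t : J) : Path.Homotopic.Quotient.mk
    ((bandRep g (kill i)).map (level kill e t).continuous) = .refl _ := by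
  suffices h : ∀ b, b = kill i → Path.Homotopic.Quotient.mk
      ((bandRep g b).map (level kill e t).continuous) = .refl _ from h _ rfl
  rintro (k | k) hk
  · refine mk_map_conj_eq_refl _ _ (Handlebody.mk_level_eq_refl i t (coreA g k)
      ⟨fun r => Circle.exp (-(Real.pi / 2) - 2 * Real.pi * r), by fun_prop⟩ (by simp) fun r => ?_)
    rw [← hk]
    rfl
  · refine mk_map_conj_eq_refl _ _ (Handlebody.mk_level_eq_refl i t (coreB g k)
      ⟨fun r => Circle.exp (-(Real.pi / 2) + 2 * Real.pi * r), by fun_prop⟩ (by simp) fun r => ?_)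
    rw [← hk]
    rfl

theorem closure_mapAlong_bandRep_eq_top (hkeep : Codisjoint (range kill) (range keep))
    {y₀ : BandHandlebody kill e} (w : Path y₀ (level kill e t (star g))) :
    Subgroup.closure (range fun k =>
      mapAlong (level kill e t) w (FundamentalGroup.fromPath (.mk (bandRep g (keep k))))) = ⊤ := by
  refine closure_range_comp_eq_top (Handlebody.surjective_mapAlong_level w)
    (closure_bandRep_eq_top g) fun b => ?_
  rcases codisjoint_iff_le_sup.1 hkeep (mem_univ b) with ⟨i, rfl⟩ | hb
  · exact Or.inl (mapAlong_eq_one w (mk_bandRep_eq_refl i t))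
  · exact Or.inr hb

theorem exists_collapse (hinj : Function.Injective keep)
    (hkeep : Disjoint (range kill) (range keep)) :
    ∃ θ : C(BandHandlebody kill e, Wedge κ), ∀ t,
      θ.comp (level kill e t) = (wedgeRestrict keep hinj).comp (collapse g) := by
  have h := Handlebody.isHandleAttachment (fun i => bandAnnulus g (kill i)) e
  let G₀ : Surface g × J → Wedge κ := fun x => wedgeRestrict keep hinj (collapse g x.1)
  have hG : ∀ i (u : sphere (0 : ℂ) 1 × J),
      1 = G₀ (Handlebody.attach (fun i => bandAnnulus g (kill i)) e (i, u)) := by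
    intro i u
    change 1 = wedgeRestrict keep hinj
      (collapse g (bandAnnulus g (kill i) (sphereToCircle u.1, u.2)))
    rcases le_total (sphereToCircle u.1 : ℂ).im 0 with hu | hu
    · rw [collapse_of_inBase (inBase_bandAnnulus _ u.2 hu), wedgeRestrict_one]
    · rw [bandAnnulus_eq_bandMap _ u.2 hu, collapse_bandMap,
        wedgeRestrict_incl_of_notMem_range _ _ (hkeep.notMem_of_mem_left ⟨i, rfl⟩)]
  refine ⟨⟨h.lift G₀ fun _ => 1, h.continuous ?_ ?_⟩, fun t => ?_⟩
  · simp only [h.lift_base (G₁ := fun _ => 1) hG]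
    fun_prop
  · simp only [h.lift_handle (G₁ := fun _ => 1) hG]
    exact continuous_const
  · exact ContinuousMap.ext fun x => h.lift_base (G₁ := fun _ => 1) hG (x, t)

variable {R : Type*} [CommRing R] {G : Subgroup Rˣ} {y₀ : BandHandlebody kill e}
  (w : Path y₀ (level kill e t (star g))) {A : Set (BandHandlebody kill e)}

theorem map_loopClass_eq_zero (hf : MapsTo (level kill e t) {star g} A)
    (φ : H1 (BandHandlebody kill e) y₀ →* G) (i : Fin g) :
    TwistedH1.map φ (level kill e t) w hf (loopClass _ (bandRep g (kill i))) = 0 := by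
  apply homologyToChains_injective
  rw [map_zero, homologyToChains_map_loopClass, edge_homotopic A φ (.mk w)
    (q := Path.refl _) (Path.Homotopic.Quotient.eq.1 (mk_bandRep_eq_refl i t)), edge_refl]

theorem exists_dual_forms [DecidableEq κ] (hinj : Function.Injective keep)
    (hkeep : IsCompl (range kill) (range keep))
    (hA : ∀ y ∈ A, ∃ r, level kill e r (star g) = y) (hw : ∀ r, w r ∈ A)
    (hf : MapsTo (level kill e t) {star g} A) (φ : H1 (BandHandlebody kill e) y₀ →* G) (k : κ) :
    ∃ F : TwistedH1 A φ →ₗ[R] R, ∀ k',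
      F (TwistedH1.map φ (level kill e t) w hf (loopClass _ (bandRep g (keep k')))) =
        (Pi.single k 1 : κ → R) k' := by
  have : Finite κ := Finite.of_injective keep hinj
  obtain ⟨θ, hθ⟩ := exists_collapse (e := e) hinj hkeep.disjoint
  have hA' : ∀ y ∈ A, θ y = 1 := by
    rintro y hy
    obtain ⟨r, rfl⟩ := hA y hy
    refine (DFunLike.congr_fun (hθ r) (star g)).trans ?_
    exact congrArg (wedgeRestrict keep hinj) (collapse_of_inBase (inBase_star g))
  have hgen := closure_mapAlong_bandRep_eq_top hkeep.codisjoint w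
  simp only [mapAlong_fromPath] at hgen
  have hwedge : ∀ k, IsWedgeLoop (θ.comp (level kill e t)) k (.mk (bandRep g (keep k))) := fun k =>
    hθ t ▸ (isWedgeLoop_bandRep (keep k)).restrict hinj
  obtain ⟨F, hF⟩ := exists_form_edge hA' hgen
    (fun k => (hwedge k).map_conj w fun r => hA' _ (hw r)) φ (Pi.single k 1 : κ → R)
  refine ⟨F ∘ₗ homologyToChains A φ, fun k' => ?_⟩
  rw [LinearMap.comp_apply, homologyToChains_map_loopClass]
  exact hF k' w _ (fun r => hA' _ (hw r)) (by rw [Path.Homotopic.Quotient.mk_map])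

end BandHandlebody

end BandHandlebody

/-! ## The Magnus submodules of the handlebodies -/

section LinearAlgebra

variable {R : Type*} [CommRing R] [IsDomain R] {H K L : Type*} [AddCommGroup H] [Module R H]
  [AddCommGroup K] [Module R K] [AddCommGroup L] [Module R L]

theorem closure_ker_eq_of_dual_forms {κ : Type*} [Finite κ] [DecidableEq κ] {f : H →ₗ[R] L}
    {N : Submodule R H} (hN : N ≤ LinearMap.ker f) {b : κ → H}
    (hspan : N ⊔ Submodule.span R (range b) = ⊤) (F : κ → L →ₗ[R] R)
    (hF : ∀ k k', F k (f (b k')) = (Pi.single k 1 : κ → R) k') :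
    closure (LinearMap.ker f) = N := by
  have := Fintype.ofFinite κ
  refine le_antisymm ?_ fun x hx => ⟨1, one_ne_zero, by rw [one_smul]; exact hN hx⟩
  rintro x ⟨r, hr, hx⟩
  obtain ⟨y, hy, z, hz, rfl⟩ := Submodule.mem_sup.1 (hspan ▸ Submodule.mem_top : x ∈ _)
  obtain ⟨d, rfl⟩ := (Submodule.mem_span_range_iff_exists_fun R).1 hz
  have hd : ∀ k, d k = 0 := fun k => by
    have h := congrArg (F k) (LinearMap.mem_ker.1 hx)
    simp only [map_smul, map_add, LinearMap.mem_ker.1 (hN hy), zero_add, map_sum, hF, map_zero,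
      smul_eq_mul, Pi.single_apply, mul_ite, mul_one, mul_zero, Finset.sum_ite_eq',
      Finset.mem_univ, if_true] at h
    exact (mul_eq_zero.1 h).resolve_left hr
  simpa only [hd, zero_smul, Finset.sum_const_zero, add_zero] using hy

theorem closure_ker_coprod_of_subsingleton_left [Subsingleton K] (f₀ : K →ₗ[R] L) (f : H →ₗ[R] L) :
    closure (LinearMap.ker (f₀.coprod f)) = Submodule.prod ⊥ (closure (LinearMap.ker f)) := by
  ext ⟨x, y⟩
  obtain rfl : x = 0 := Subsingleton.elim _ _
  simp [closure, Submodule.mem_prod]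

theorem closure_ker_coprod_of_subsingleton_right [Subsingleton K] (f₀ : K →ₗ[R] L)
    (f : H →ₗ[R] L) :
    closure (LinearMap.ker ((-f).coprod f₀)) = Submodule.prod (closure (LinearMap.ker f)) ⊥ := by
  ext ⟨x, y⟩
  obtain rfl : y = 0 := Subsingleton.elim _ _
  simp [closure, Submodule.mem_prod]

end LinearAlgebra

namespace BandHandlebody

theorem closure_ker_map_level {R : Type*} [CommRing R] [IsDomain R] {G : Subgroup Rˣ} {g : ℕ}
    {kill : Fin g → BandIndex g} {e t : J} {κ : Type*} {keep : κ → BandIndex g}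
    (hinj : Function.Injective keep) (hkeep : IsCompl (range kill) (range keep))
    {y₀ : BandHandlebody kill e} (w : Path y₀ (level kill e t (star g)))
    {A : Set (BandHandlebody kill e)} (hA : ∀ y ∈ A, ∃ r, level kill e r (star g) = y)
    (hw : ∀ r, w r ∈ A) (hf : MapsTo (level kill e t) {star g} A)
    (φ : H1 (BandHandlebody kill e) y₀ →* G) :
    closure (LinearMap.ker (TwistedH1.map φ (level kill e t) w hf)) =
      Submodule.span R (range fun i =>
        loopClass (φ.comp (H1.map (level kill e t) w)) (bandRep g (kill i))) := by
  classical
  have : Finite κ := Finite.of_injective keep hinj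
  let a : BandIndex g → TwistedH1 {star g} (φ.comp (H1.map (level kill e t) w)) :=
    fun b => loopClass _ (bandRep g b)
  have hunion : range kill ∪ range keep = univ := hkeep.sup_eq_top
  have hspan : Submodule.span R (range (a ∘ kill)) ⊔ Submodule.span R (range (a ∘ keep)) = ⊤ := by
    rw [← Submodule.span_union, range_comp, range_comp, ← image_union, hunion,
      image_univ]
    exact span_bandRep _
  choose F hF using exists_dual_forms (R := R) w hinj hkeep hA hw hf φ
  refine closure_ker_eq_of_dual_forms (Submodule.span_le.2 ?_) hspan F hF
  rintro _ ⟨i, rfl⟩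
  exact map_loopClass_eq_zero w hf φ i

end BandHandlebody

end Magnus

end

theorem lemma5p3 {R : Type*} [CommRing R] [IsDomain R] (G : Subgroup Rˣ) (g : ℕ) :
    (∀ (d : C(Magnus.Surface 0, Magnus.LowerSpace g))
        (hd : d (Magnus.star 0) =
          Magnus.Handlebody.level (Magnus.annulusA g) Magnus.jBot Magnus.jBot (Magnus.star g))
        (φ : (Magnus.lowerHandlebody g d hd).H1M →* G),
      let φTop := (Magnus.lowerHandlebody g d hd).phiTop φ
      let a : Fin g → Magnus.TwistedH1 {Magnus.star g} φTop :=
        fun i => Magnus.loopClass φTop (Magnus.loopA g i)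
      LinearIndependent R a ∧
        (Magnus.lowerHandlebody g d hd).Mag φ =
          Submodule.prod ⊥ (Submodule.span R (Set.range a))) ∧
    (∀ (d : C(Magnus.Surface 0, Magnus.UpperSpace g))
        (hd : d (Magnus.star 0) =
          Magnus.Handlebody.level (Magnus.annulusB g) Magnus.jTop Magnus.jTop (Magnus.star g))
        (φ : (Magnus.upperHandlebody g d hd).H1M →* G),
      let φBot := (Magnus.upperHandlebody g d hd).phiBot φ
      let b : Fin g → Magnus.TwistedH1 {Magnus.star g} φBot :=
        fun i => Magnus.loopClass φBot (Magnus.loopB g i)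
      LinearIndependent R b ∧
        (Magnus.upperHandlebody g d hd).Mag φ =
          Submodule.prod (Submodule.span R (Set.range b)) ⊥) := by
  refine ⟨fun d hd φ => ⟨?_, ?_⟩, fun d hd φ => ⟨?_, ?_⟩⟩
  · exact (Magnus.linearIndependent_bandRep _).comp Sum.inl Sum.inl_injective
  · have := Magnus.subsingleton_twistedH1_disk ((Magnus.lowerHandlebody g d hd).phiBot φ)
    refine (Magnus.closure_ker_coprod_of_subsingleton_left _ _).trans (congrArg _ ?_)
    refine Magnus.BandHandlebody.closure_ker_map_level (kill := Sum.inl) Sum.inr_injective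
      Set.isCompl_range_inl_range_inr _ ?_ Set.mem_range_self _ φ
    rintro _ ⟨r, rfl⟩
    exact ⟨_, rfl⟩
  · exact (Magnus.linearIndependent_bandRep _).comp Sum.inr Sum.inr_injective
  · have := Magnus.subsingleton_twistedH1_disk ((Magnus.upperHandlebody g d hd).phiTop φ)
    refine (Magnus.closure_ker_coprod_of_subsingleton_right _ _).trans
      (congrArg (Submodule.prod · ⊥) ?_)
    refine Magnus.BandHandlebody.closure_ker_map_level (kill := Sum.inr) Sum.inl_injective
      Set.isCompl_range_inl_range_inr.symm _ ?_
      (fun _ => Set.mem_range.2 ⟨0, (Magnus.upperHandlebody g d hd).side.source⟩) _ φ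
    rintro _ ⟨r, rfl⟩
    exact ⟨_, rfl⟩
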